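/- For $N\ge 1$ let $P_N$ be the law of the eigenvalues of the $N\times N$ complex Ginibre matrix with entries of variance $1/N$, i.e. the probability measure on $\mathbb C^N$ $$dP_N(z_1,\dots,z_N)=\frac1{Z_N}\prod_{1\le l<k\le N}|z_l-z_k|^2\prod_{k=1}^N e^{-N|z_k|^2}\,d\Re(z_k)\,d\Im(z_k),$$ where $Z_N$ is the normalizing constant, and let $\mathrm{Cov}_N$ be the covariance under $P_N$. All asymptotics are for $N\to\infty$ with the arcs and intervals fixed, and all implied constants may depend on these. **Angular counts.** Let $\alpha<\beta<\alpha+2\pi$ and $\delta<\gamma<\delta+2\pi$, let $[\alpha,\beta]$ denote the closed arc $\{e^{i\theta}:\alpha\le\theta\le\beta\}$ of the unit circle, let endpoints of arcs be compared modulo $2\pi$, and let $\#\Theta[\alpha,\beta]$ be the number of $k$ such that $\arg z_k$ lies in the arc $[\alpha,\beta]$. Put $$A_N=\mathrm{Cov}_N\!\left(\frac{\#\Theta[\alpha,\beta]}{(N/\pi^3)^{1/4}},\frac{\#\Theta[\delta,\gamma]}{(N/\pi^3)^{1/4}}\right).$$ * If $[\alpha,\beta]\subset[\delta,\gamma]$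 with $\alpha\ne\delta$ and $\beta\ne\gamma$, or if $[\alpha,\beta]\cap[\delta,\gamma]=\varnothing$, then $A_N=O(1/\sqrt N)$; moreover, for every $N$, $A_N\ge0$ in the first case and $A_N\le 0$ in the second. * If $\alpha=\delta$ and $\beta\neq\gamma$, or $\beta=\gamma$ and $\alpha\ne\delta$, then $A_N=+\frac12+O(\log N/\sqrt N)$. * If $\beta=\delta$ and $\alpha\ne\gamma$, or $\alpha=\gamma$ and $\beta\neq\delta$, then $A_N=-\frac12+O(\log N/\sqrt N)$. **Radial counts.** Let $0\le a<b\le1$ and $0\le c<d\le1$, let $\#\mathcal I[a,b]$ be the number of $k$ with $|z_k|\in[a,b]$, and put $$R_N=\mathrm{Cov}_N\!\left(\frac{\#\mathcal I[a,b]}{(N/\pi)^{1/4}},\frac{\#\mathcal I[c,d]}{(N/\pi)^{1/4}}\right).$$ * If $[a,b]\subset[c,d]$ with $a\ne c$ and $b\neq d$, or if $[a,b]\cap[c,d]=\varnothing$, then $R_N=O(e^{-c_1N})$ for some $c_1>0$ depending on $a,b,c,d$; moreover, for every $N$, $R_N\ge0$ in the first case and $R_N\le0$ in the second. * If $a=c$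 and $b\ne d$, then $R_N=+a+O(1/\sqrt N)$; if $b=d<1$ and $a\neq c$, then $R_N=+b+O(1/\sqrt N)$. * If $b=c$, then $R_N=-b+O(1/\sqrt N)$; if $a=d$, then $R_N=-a+O(1/\sqrt N)$. -/

import Mathlib

open MeasureTheory Filter Set
open scoped ENNReal Real

noncomputable section

/-- The Gaussian weight `μ_N(dz) = exp (-N |z|²) dRe(z) dIm(z)` on the complex plane. -/
def ginibreWeight (N : ℕ) : Measure ℂ :=
  (volume : Measure ℂ).withDensity fun z => ENNReal.ofReal (Real.exp (-(N : ℝ) * ‖z‖ ^ 2))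

/-- The squared Vandermonde factor `∏_{l < k} |z_l - z_k|²`. -/
def vandermondeSq {N : ℕ} (z : Fin N → ℂ) : ℝ :=
  ∏ k : Fin N, ∏ l ∈ Finset.Iio k, ‖z l - z k‖ ^ 2

/-- The unnormalized eigenvalue law
`∏_{l < k} |z_l - z_k|² μ_N(dz_1) ⋯ μ_N(dz_N)` on `ℂ^N`. -/
def ginibreUnnormalized (N : ℕ) : Measure (Fin N → ℂ) :=
  (Measure.pi fun _ : Fin N => ginibreWeight N).withDensity fun z =>
    ENNReal.ofReal (vandermondeSq z)

/-- The law `P_N` of the eigenvalues in the complex Ginibre ensemble: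
the measure above divided by its total mass `Z_N`. -/
def ginibreLaw (N : ℕ) : Measure (Fin N → ℂ) :=
  (ginibreUnnormalized N Set.univ)⁻¹ • ginibreUnnormalized N

/-- The linear eigenvalue statistic `X(f) = ∑ₖ f(z_k)`. -/
def linearStat {N : ℕ} (f : ℂ → ℝ) (z : Fin N → ℂ) : ℝ := ∑ k, f (z k)

/-- The closed arc of the circle running counterclockwise from the angle `α` to the angle `β`. -/
def circleArc (α β : ℝ) : Set Real.Angle := (fun θ : ℝ => (θ : Real.Angle)) '' Set.Icc α β

/-- The number of points `z_k` with `arg z_k` in the arc from `α` to `β`. -/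
def angularCount {N : ℕ} (α β : ℝ) : (Fin N → ℂ) → ℝ :=
  linearStat (Set.indicator {z : ℂ | (Complex.arg z : Real.Angle) ∈ circleArc α β} fun _ => 1)

/-- The number of points `z_k` with `|z_k| ∈ [a, b]`. -/
def radialCount {N : ℕ} (a b : ℝ) : (Fin N → ℂ) → ℝ :=
  linearStat (Set.indicator {z : ℂ | ‖z‖ ∈ Set.Icc a b} fun _ => 1)

/-- The covariance under `P_N` of two angular counts, each divided by `(N / π³)^{1/4}`. -/
def angularCov (α β δ γ : ℝ) (N : ℕ) : ℝ :=
  ProbabilityTheory.covariance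
    (fun z : Fin N → ℂ => angularCount α β z / ((N : ℝ) / π ^ 3) ^ (1 / 4 : ℝ))
    (fun z : Fin N → ℂ => angularCount δ γ z / ((N : ℝ) / π ^ 3) ^ (1 / 4 : ℝ))
    (ginibreLaw N)

/-- The covariance under `P_N` of two radial counts, each divided by `(N / π)^{1/4}`. -/
def radialCov (a b c d : ℝ) (N : ℕ) : ℝ :=
  ProbabilityTheory.covariance
    (fun z : Fin N → ℂ => radialCount a b z / ((N : ℝ) / π) ^ (1 / 4 : ℝ))
    (fun z : Fin N → ℂ => radialCount c d z / ((N : ℝ) / π) ^ (1 / 4 : ℝ))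
    (ginibreLaw N)

end

/-! ### Linear statistics of a squared Slater determinant. -/

section Determinantal

open ComplexConjugate

variable {ι : Type*} [Fintype ι] [DecidableEq ι]

/-! The density of `P_N` is, up to a constant, the squared modulus of the Slater determinant of the
monomials orthonormal for the Gaussian weight. Integrating such a determinant gives Cov(X(f), X(g))
= tr C(fg) - tr C(f)C(g), where C(f) is multiplication by f compressed to the span of the first N
monomials (`covariance_linearStat`). If f ≥ 0 then C(f) is positive semidefinite, so disjoint sets
have covariance -tr C(f)C(g) ≤ 0; as the total number of points is constant, nested sets reduce to
disjoint ones by passing to a complement.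

For the asymptotics, every count is almost everywhere a difference of two step functions, one per
endpoint, and the covariance is expanded bilinearly. To leading order only coinciding endpoints
matter.

Angular counts. Polarization (`ginibreCov_circleArc`) turns the covariance into half a signed sum of
four arc variances V. It is enough that V = √(N/π³) + O(log N) for any two distinct angles, and that
two such variances differ by O(1). By `arcVariance_eq_integral`, 4π²V is the integral of an overlap
function against a nonnegative kernel K_N, a cosine sum weighted by the numbers `gammaRatio i j ^
2`. Near s = 0 the overlap equals s whatever the arc is. Hence it differs from |sin s| by at most
C(1 - cos s), and two overlaps differ by at most C(1 - cos s)². The K_N-moments of these two error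
functions need only the frequencies 0, 1, 2 and are O(log N) and O(1). The function |sin| has even
frequencies only, for which `gammaRatio i j ^ 2` is a quotient of binomial coefficients; its
integral then telescopes along antidiagonals to 4·4^N / (central binomial coefficient of N), which
is about 4√(πN), up to O(log N).

Radial counts. Rotation invariance makes C(f) diagonal, with Poisson distribution functions F as
entries for a radial step. The steps at x ≤ y have covariance Σ_{k<N} F(Ny², k)(1 - F(Nx², k)). If x
< y, Chernoff bounds make it exponentially small. If x = y < 1, the sum over all k is E(Y - X)⁺ for
independent Poisson variables of mean Nx²; given X + Y this is a simple random walk expectation, and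
the sum is x√(N/π) + O(1). The tail k ≥ N is bounded because x < 1. -/

theorem perm_eq_of_eqOn_compl_singleton {σ τ : Equiv.Perm ι} {p : ι}
    (h : ∀ k, k ≠ p → σ k = τ k) : σ = τ := by
  ext k
  by_cases hk : k = p
  · subst hk
    obtain ⟨l, hl⟩ := σ.surjective (τ k)
    by_cases hlk : l = k
    · rw [hlk] at hl; exact hl
    · have := h l hlk
      rw [hl] at this
      exact absurd (τ.injective this).symm hlk
  · exact h k hk

theorem perm_eq_or_eq_mul_swap {σ τ : Equiv.Perm ι} {p q : ι}
    (h : ∀ k, k ≠ p → k ≠ q → σ k = τ k) : τ = σ ∨ τ = σ * Equiv.swap p q := by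
  by_cases hp : σ p = τ p
  · left
    refine (perm_eq_of_eqOn_compl_singleton (p := q) fun k hk => ?_).symm
    by_cases hkp : k = p
    · rw [hkp, hp]
    · exact h k hkp hk
  · right
    have hpq : p ≠ q := by
      rintro rfl
      exact hp (by rw [perm_eq_of_eqOn_compl_singleton (fun k hk => h k hk hk)])
    have hq : τ q = σ p := by
      obtain ⟨l, hl⟩ := τ.surjective (σ p)
      by_cases hlp : l = p
      · subst hlp; exact absurd hl.symm hp
      by_cases hlq : l = q
      · rw [← hlq]; exact hl
      · have := h l hlp hlq
        rw [hl] at this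
        exact absurd (σ.injective this) hlp
    refine (perm_eq_of_eqOn_compl_singleton (p := p) fun k hk => ?_).symm
    by_cases hkq : k = q
    · subst hkq; simp [hq]
    · rw [Equiv.Perm.mul_apply, Equiv.swap_apply_of_ne_of_ne hk hkq]
      exact h k hk hkq

/-- In the Leibniz double sum every coordinate other than p carries a Kronecker delta, so τ must
agree with σ off p and hence everywhere. -/
theorem sum_perm_one_point (A : ι → ι → ι → ℂ) (p : ι) (σ : Equiv.Perm ι)
    (hA : ∀ k, k ≠ p → ∀ i j, A k i j = if i = j then 1 else 0) :
    ∑ τ : Equiv.Perm ι, ((Equiv.Perm.sign σ : ℤ) : ℂ) * ((Equiv.Perm.sign τ : ℤ) : ℂ)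
      * ∏ k, A k (σ k) (τ k) = A p (σ p) (σ p) := by
  have hsq : ((Equiv.Perm.sign σ : ℤ) : ℂ) * ((Equiv.Perm.sign σ : ℤ) : ℂ) = 1 := by
    rw [← Int.cast_mul, ← Units.val_mul, Int.units_mul_self]; simp
  rw [Finset.sum_eq_single σ]
  · rw [hsq, one_mul, Finset.prod_eq_single p]
    · intro k _ hk; rw [hA k hk]; simp
    · simp
  · intro τ _ hτ
    have : ∃ k, k ≠ p ∧ σ k ≠ τ k := by
      by_contra! hcon
      exact hτ (perm_eq_of_eqOn_compl_singleton hcon).symm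
    obtain ⟨k, hk, hne⟩ := this
    rw [Finset.prod_eq_zero (Finset.mem_univ k) (by rw [hA k hk, if_neg hne]), mul_zero]
  · simp

/-- With two free coordinates the surviving τ are σ and σ composed with the transposition of p and
q. The second one has the opposite sign, which produces the negative exchange term. -/
theorem sum_perm_two_point (A : ι → ι → ι → ℂ) {p q : ι} (hpq : p ≠ q) (σ : Equiv.Perm ι)
    (hA : ∀ k, k ≠ p → k ≠ q → ∀ i j, A k i j = if i = j then 1 else 0) :
    ∑ τ : Equiv.Perm ι, ((Equiv.Perm.sign σ : ℤ) : ℂ) * ((Equiv.Perm.sign τ : ℤ) : ℂ)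
      * ∏ k, A k (σ k) (τ k) =
      A p (σ p) (σ p) * A q (σ q) (σ q) - A p (σ p) (σ q) * A q (σ q) (σ p) := by
  have hsq : ((Equiv.Perm.sign σ : ℤ) : ℂ) * ((Equiv.Perm.sign σ : ℤ) : ℂ) = 1 := by
    rw [← Int.cast_mul, ← Units.val_mul, Int.units_mul_self]; simp
  have hne : σ ≠ σ * Equiv.swap p q := by
    intro h
    have := congrArg (fun s : Equiv.Perm ι => s p) h
    simp at this
    exact hpq this
  rw [Fintype.sum_eq_add σ (σ * Equiv.swap p q) hne]
  · rw [hsq, Equiv.Perm.sign_mul, Equiv.Perm.sign_swap hpq, sub_eq_add_neg, one_mul]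
    congr 1
    · rw [Fintype.prod_eq_mul p q hpq]
      intro k hk; rw [hA k hk.1 hk.2]; simp
    · rw [Fintype.prod_eq_mul p q hpq]
      · simp [hsq]
      · intro k hk; rw [hA k hk.1 hk.2]
        simp [Equiv.swap_apply_of_ne_of_ne hk.1 hk.2]
  · intro τ hτ
    have : ∃ k, k ≠ p ∧ k ≠ q ∧ σ k ≠ τ k := by
      by_contra! hcon
      rcases perm_eq_or_eq_mul_swap hcon with h | h
      exacts [hτ.1 h, hτ.2 h]
    obtain ⟨k, hk, hk', hne⟩ := this
    rw [Finset.prod_eq_zero (Finset.mem_univ k) (by rw [hA k hk hk', if_neg hne]), mul_zero]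

variable {X : Type*} [MeasurableSpace X]

/-- The squared modulus of the Slater determinant `det (e_i (z_j))`. -/
noncomputable def slaterSq (e : ι → X → ℂ) (z : ι → X) : ℂ :=
  (Matrix.of fun i j => e i (z j)).det * conj (Matrix.of fun i j => e i (z j)).det

theorem slaterSq_eq_sum (e : ι → X → ℂ) (z : ι → X) :
    slaterSq e z = ∑ σ : Equiv.Perm ι, ∑ τ : Equiv.Perm ι,
      ((Equiv.Perm.sign σ : ℤ) : ℂ) * ((Equiv.Perm.sign τ : ℤ) : ℂ)
      * ∏ k, (e (σ k) (z k) * conj (e (τ k) (z k))) := by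
  unfold slaterSq
  rw [Matrix.det_apply', map_sum, Finset.sum_mul_sum]
  refine Finset.sum_congr rfl fun σ _ => Finset.sum_congr rfl fun τ _ => ?_
  simp only [Matrix.of_apply, map_mul, map_prod, Finset.prod_mul_distrib, map_intCast]
  ring

variable (μ : Measure X) [SigmaFinite μ]

/-- The matrix of multiplication by `f`, compressed to the span of the functions `e_i`. -/
noncomputable def compression (e : ι → X → ℂ) (f : X → ℂ) : Matrix ι ι ℂ :=
  Matrix.of fun i j => ∫ x, f x * (e i x * conj (e j x)) ∂μ

variable {μ}

theorem integrable_prod_mul_slaterSq {e : ι → X → ℂ} {F : ι → X → ℂ}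
    (h : ∀ k i j, Integrable (fun x => F k x * (e i x * conj (e j x))) μ) :
    Integrable (fun z : ι → X => (∏ k, F k (z k)) * slaterSq e z) (Measure.pi fun _ => μ) := by
  simp_rw [slaterSq_eq_sum, Finset.mul_sum]
  refine integrable_finsetSum _ fun σ _ => integrable_finsetSum _ fun τ _ => ?_
  have := (Integrable.fintype_prod (μ := fun _ : ι => μ) fun k => h k (σ k) (τ k)).const_mul
    (((Equiv.Perm.sign σ : ℤ) : ℂ) * ((Equiv.Perm.sign τ : ℤ) : ℂ))
  refine this.congr (ae_of_all _ fun z => ?_)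
  simp only [Finset.prod_mul_distrib]
  ring

/-- Both determinants are expanded by Leibniz; each term is a product of functions of single
coordinates, so Fubini factors it into compression entries. -/
theorem integral_prod_mul_slaterSq {e : ι → X → ℂ} {F : ι → X → ℂ}
    (h : ∀ k i j, Integrable (fun x => F k x * (e i x * conj (e j x))) μ) :
    ∫ z : ι → X, (∏ k, F k (z k)) * slaterSq e z ∂(Measure.pi fun _ => μ) =
      ∑ σ : Equiv.Perm ι, ∑ τ : Equiv.Perm ι,
      ((Equiv.Perm.sign σ : ℤ) : ℂ) * ((Equiv.Perm.sign τ : ℤ) : ℂ)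
      * ∏ k, compression μ e (F k) (σ k) (τ k) := by
  have hI : ∀ σ τ : Equiv.Perm ι, Integrable (fun z : ι → X =>
      ((Equiv.Perm.sign σ : ℤ) : ℂ) * ((Equiv.Perm.sign τ : ℤ) : ℂ) *
        ∏ k, (F k (z k) * (e (σ k) (z k) * conj (e (τ k) (z k))))) (Measure.pi fun _ => μ) :=
    fun σ τ => (Integrable.fintype_prod (μ := fun _ : ι => μ)
      fun k => h k (σ k) (τ k)).const_mul _
  have : ∀ z : ι → X, (∏ k, F k (z k)) * slaterSq e z = ∑ σ : Equiv.Perm ι,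
      ∑ τ : Equiv.Perm ι, ((Equiv.Perm.sign σ : ℤ) : ℂ) * ((Equiv.Perm.sign τ : ℤ) : ℂ) *
        ∏ k, (F k (z k) * (e (σ k) (z k) * conj (e (τ k) (z k)))) := by
    intro z
    simp_rw [slaterSq_eq_sum, Finset.mul_sum]
    refine Finset.sum_congr rfl fun σ _ => Finset.sum_congr rfl fun τ _ => ?_
    simp only [Finset.prod_mul_distrib]
    ring
  simp_rw [this]
  rw [integral_finsetSum _ fun σ _ => integrable_finsetSum _ fun τ _ => hI σ τ]
  refine Finset.sum_congr rfl fun σ _ => ?_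
  rw [integral_finsetSum _ fun τ _ => hI σ τ]
  refine Finset.sum_congr rfl fun τ _ => ?_
  rw [integral_const_mul, integral_fintype_prod_eq_prod
    (fun k x => F k x * (e (σ k) x * conj (e (τ k) x)))]
  rfl

theorem sum_perm_apply (Φ : ι → ℂ) :
    ∑ k, ∑ σ : Equiv.Perm ι, Φ (σ k) = (Fintype.card ι).factorial * ∑ i, Φ i := by
  rw [Finset.sum_comm]
  simp_rw [fun σ : Equiv.Perm ι => Equiv.sum_comp σ Φ]
  simp [Finset.card_univ, Fintype.card_perm]

/-- The sum over l is re-indexed by the bijection σ, diagonal l = k included. The diagonal may stay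
because the two-point integrand f_ii g_jj - f_ij g_ji vanishes at i = j. -/
theorem sum_perm_apply_apply (Φ : ι → ι → ℂ) :
    ∑ k, ∑ l, ∑ σ : Equiv.Perm ι, Φ (σ k) (σ l) =
      (Fintype.card ι).factorial * ∑ i, ∑ j, Φ i j := by
  have : ∀ k, ∑ l, ∑ σ : Equiv.Perm ι, Φ (σ k) (σ l) = ∑ σ : Equiv.Perm ι, ∑ j, Φ (σ k) j := by
    intro k
    rw [Finset.sum_comm]
    exact Finset.sum_congr rfl fun σ _ => Equiv.sum_comp σ (Φ (σ k))
  simp_rw [this]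
  exact sum_perm_apply fun i => ∑ j, Φ i j

/-- Orthonormality of the functions `e_i`. -/
structure OrthonormalSystem (μ : Measure X) (e : ι → X → ℂ) : Prop where
  integrable : ∀ i j, Integrable (fun x => e i x * conj (e j x)) μ
  integral : ∀ i j, ∫ x, e i x * conj (e j x) ∂μ = if i = j then 1 else 0

namespace OrthonormalSystem

variable {e : ι → X → ℂ} (he : OrthonormalSystem μ e)
include he

theorem integrable_mul {f : X → ℂ} (hf : Measurable f) {C : ℝ} (hC : ∀ x, ‖f x‖ ≤ C) (i j : ι) :
    Integrable (fun x => f x * (e i x * conj (e j x))) μ :=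
  (he.integrable i j).bdd_mul hf.aestronglyMeasurable (ae_of_all _ hC)

theorem compression_one : compression μ e (fun _ => 1) = 1 := by
  ext i j
  simp [compression, he.integral, Matrix.one_apply]

theorem integral_slaterSq :
    ∫ z : ι → X, slaterSq e z ∂(Measure.pi fun _ => μ) = (Fintype.card ι).factorial := by
  have := integral_prod_mul_slaterSq (μ := μ) (e := e) (F := fun _ _ => 1)
    (fun _ i j => by simpa using he.integrable i j)
  simp only [Finset.prod_const_one, one_mul, he.compression_one] at this
  rw [this]
  have h2 : ∀ σ : Equiv.Perm ι, ∑ τ : Equiv.Perm ι,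
      ((Equiv.Perm.sign σ : ℤ) : ℂ) * ((Equiv.Perm.sign τ : ℤ) : ℂ)
        * ∏ k, (1 : Matrix ι ι ℂ) (σ k) (τ k) = 1 := by
    intro σ
    -- The one-point lemma needs a distinguished coordinate; the empty index type is settled by
    -- hand.
    rcases isEmpty_or_nonempty ι with h | ⟨⟨p⟩⟩
    · simp [Subsingleton.elim σ 1]
    · rw [sum_perm_one_point (fun _ => (1 : Matrix ι ι ℂ)) p σ
        (fun k _ i j => Matrix.one_apply)]
      simp
  simp_rw [h2]
  simp [Finset.card_univ, Fintype.card_perm]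

theorem integrable_one_point {f : X → ℂ} (hf : Measurable f) {C : ℝ} (hC : ∀ x, ‖f x‖ ≤ C)
    (p : ι) : Integrable (fun z : ι → X => f (z p) * slaterSq e z) (Measure.pi fun _ => μ) := by
  have := integrable_prod_mul_slaterSq (μ := μ) (e := e)
    (F := Function.update (fun _ _ => 1) p f) (fun k i j => by
      by_cases hk : k = p
      · subst hk; simpa using he.integrable_mul hf hC i j
      · simpa [Function.update_of_ne hk] using he.integrable i j)
  refine this.congr (ae_of_all _ fun z => ?_)
  simp only
  rw [Finset.prod_eq_single p]
  · simp
  · intro k _ hk; simp [Function.update_of_ne hk]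
  · simp

theorem integral_one_point {f : X → ℂ} (hf : Measurable f) {C : ℝ} (hC : ∀ x, ‖f x‖ ≤ C)
    (p : ι) : ∫ z : ι → X, f (z p) * slaterSq e z ∂(Measure.pi fun _ => μ) =
      ∑ σ : Equiv.Perm ι, compression μ e f (σ p) (σ p) := by
  have := integral_prod_mul_slaterSq (μ := μ) (e := e)
    (F := Function.update (fun _ _ => 1) p f) (fun k i j => by
      by_cases hk : k = p
      · subst hk; simpa using he.integrable_mul hf hC i j
      · simpa [Function.update_of_ne hk] using he.integrable i j)
  have h2 : ∀ z : ι → X, ∏ k, (Function.update (fun _ _ => 1) p f : ι → X → ℂ) k (z k)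
      = f (z p) := by
    intro z
    rw [Finset.prod_eq_single p]
    · simp
    · intro k _ hk; simp [Function.update_of_ne hk]
    · simp
  simp_rw [h2] at this
  rw [this]
  refine Finset.sum_congr rfl fun σ _ => ?_
  rw [sum_perm_one_point
    (fun k => compression μ e ((Function.update (fun _ _ => 1) p f : ι → X → ℂ) k)) p σ]
  · simp
  · intro k hk i j
    simp only [Function.update_of_ne hk, he.compression_one, Matrix.one_apply]

theorem integrable_two_point {f g : X → ℂ} (hf : Measurable f) {C : ℝ} (hC : ∀ x, ‖f x‖ ≤ C)
    (hg : Measurable g) {D : ℝ} (hD : ∀ x, ‖g x‖ ≤ D) (p q : ι) :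
    Integrable (fun z : ι → X => f (z p) * g (z q) * slaterSq e z) (Measure.pi fun _ => μ) := by
  have := (he.integrable_one_point hg hD q).bdd_mul (c := C)
    (hf.comp (measurable_pi_apply p)).aestronglyMeasurable (ae_of_all _ fun z => hC (z p))
  refine this.congr (ae_of_all _ fun z => ?_)
  simp [mul_assoc]

theorem integral_two_point_of_ne {f g : X → ℂ} (hf : Measurable f) {C : ℝ}
    (hC : ∀ x, ‖f x‖ ≤ C) (hg : Measurable g) {D : ℝ} (hD : ∀ x, ‖g x‖ ≤ D) {p q : ι}
    (hpq : p ≠ q) :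
    ∫ z : ι → X, f (z p) * g (z q) * slaterSq e z ∂(Measure.pi fun _ => μ) =
      ∑ σ : Equiv.Perm ι,
        (compression μ e f (σ p) (σ p) * compression μ e g (σ q) (σ q) -
          compression μ e f (σ p) (σ q) * compression μ e g (σ q) (σ p)) := by
  set F : ι → X → ℂ := Function.update (Function.update (fun _ _ => 1) p f) q g with hF
  have hFp : F p = f := by simp [hF, Function.update_of_ne hpq]
  have hFq : F q = g := by simp [hF]
  have hFk : ∀ k, k ≠ p → k ≠ q → F k = fun _ => 1 := fun k hk hk' => by
    simp [hF, Function.update_of_ne hk, Function.update_of_ne hk']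
  have := integral_prod_mul_slaterSq (μ := μ) (e := e) (F := F) (fun k i j => by
      by_cases hk : k = p
      · rw [hk, hFp]; exact he.integrable_mul hf hC i j
      by_cases hk' : k = q
      · rw [hk', hFq]; exact he.integrable_mul hg hD i j
      · rw [hFk k hk hk']; simpa using he.integrable i j)
  have h2 : ∀ z : ι → X, ∏ k, F k (z k) = f (z p) * g (z q) := by
    intro z
    rw [Fintype.prod_eq_mul p q hpq, hFp, hFq]
    intro k hk
    rw [hFk k hk.1 hk.2]
  simp_rw [h2] at this
  rw [this]
  refine Finset.sum_congr rfl fun σ _ => ?_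
  rw [sum_perm_two_point (fun k => compression μ e (F k)) hpq σ]
  · simp only [hFp, hFq]
  · intro k hk hk' i j
    simp only [hFk k hk hk', he.compression_one, Matrix.one_apply]

theorem integral_two_point {f g : X → ℂ} (hf : Measurable f) {C : ℝ}
    (hC : ∀ x, ‖f x‖ ≤ C) (hg : Measurable g) {D : ℝ} (hD : ∀ x, ‖g x‖ ≤ D) (p q : ι) :
    ∫ z : ι → X, f (z p) * g (z q) * slaterSq e z ∂(Measure.pi fun _ => μ) =
      (if p = q then ∑ σ : Equiv.Perm ι, compression μ e (fun x => f x * g x) (σ p) (σ p)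
        else 0) +
      ∑ σ : Equiv.Perm ι,
        (compression μ e f (σ p) (σ p) * compression μ e g (σ q) (σ q) -
          compression μ e f (σ p) (σ q) * compression μ e g (σ q) (σ p)) := by
  split_ifs with hpq
  · subst hpq
    rw [he.integral_one_point (f := fun x => f x * g x) (hf.mul hg) (C := C * D) (fun x => by
      rw [norm_mul]
      exact mul_le_mul (hC x) (hD x) (norm_nonneg _) ((norm_nonneg _).trans (hC x))) p]
    simp
  · rw [he.integral_two_point_of_ne hf hC hg hD hpq, zero_add]

theorem integral_sum {f : X → ℂ} (hf : Measurable f) {C : ℝ} (hC : ∀ x, ‖f x‖ ≤ C) :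
    ∫ z : ι → X, (∑ k, f (z k)) * slaterSq e z ∂(Measure.pi fun _ => μ) =
      (Fintype.card ι).factorial * (compression μ e f).trace := by
  simp_rw [Finset.sum_mul]
  rw [integral_finsetSum _ fun k _ => he.integrable_one_point hf hC k]
  simp_rw [he.integral_one_point hf hC]
  rw [sum_perm_apply fun i => compression μ e f i i]
  rfl

/-- This is the determinantal covariance identity before normalization: the diagonal k = l gives tr
C(fg), and the two surviving permutations give tr C(f) tr C(g) and -tr C(f)C(g). -/
theorem integral_sum_mul_sum {f g : X → ℂ} (hf : Measurable f) {C : ℝ}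
    (hC : ∀ x, ‖f x‖ ≤ C) (hg : Measurable g) {D : ℝ} (hD : ∀ x, ‖g x‖ ≤ D) :
    ∫ z : ι → X, (∑ k, f (z k)) * (∑ k, g (z k)) * slaterSq e z ∂(Measure.pi fun _ => μ) =
      (Fintype.card ι).factorial * ((compression μ e fun x => f x * g x).trace +
        (compression μ e f).trace * (compression μ e g).trace -
        (compression μ e f * compression μ e g).trace) := by
  simp_rw [Finset.sum_mul_sum, Finset.sum_mul]
  rw [integral_finsetSum _ fun k _ => integrable_finsetSum _ fun l _ =>
    he.integrable_two_point hf hC hg hD k l]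
  simp_rw [fun k => integral_finsetSum Finset.univ fun l (_ : l ∈ Finset.univ) =>
    he.integrable_two_point hf hC hg hD k l, he.integral_two_point hf hC hg hD,
    Finset.sum_add_distrib, Finset.sum_ite_eq, Finset.mem_univ, if_true]
  rw [sum_perm_apply fun i => compression μ e (fun x => f x * g x) i i,
    sum_perm_apply_apply fun i j => compression μ e f i i * compression μ e g j j -
      compression μ e f i j * compression μ e g j i]
  simp only [Matrix.trace, Matrix.diag, Matrix.mul_apply, Finset.sum_sub_distrib,
    Finset.sum_mul_sum]
  ring

end OrthonormalSystem

end Determinantal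

/-! ### The Ginibre law as a determinantal process of orthonormal monomials. -/

section Ginibre

open ComplexConjugate

instance sigmaFinite_ginibreWeight (N : ℕ) : SigmaFinite (ginibreWeight N) := by
  unfold ginibreWeight
  infer_instance

theorem integral_ginibreWeight (N : ℕ) (f : ℂ → ℂ) :
    ∫ z, f z ∂ginibreWeight N = ∫ z : ℂ, (Real.exp (-(N : ℝ) * ‖z‖ ^ 2) : ℂ) * f z := by
  unfold ginibreWeight
  rw [integral_withDensity_eq_integral_toReal_smul (by fun_prop) (by simp)]
  refine integral_congr_ae (ae_of_all _ fun z => ?_)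
  simp only
  rw [ENNReal.toReal_ofReal (Real.exp_pos _).le, Complex.real_smul]

theorem integrable_ginibreWeight_iff (N : ℕ) (f : ℂ → ℂ) :
    Integrable f (ginibreWeight N) ↔
      Integrable (fun z : ℂ => (Real.exp (-(N : ℝ) * ‖z‖ ^ 2) : ℂ) * f z) := by
  unfold ginibreWeight
  rw [integrable_withDensity_iff_integrable_smul' (by fun_prop) (by simp)]
  refine integrable_congr (ae_of_all _ fun z => ?_)
  simp only
  rw [ENNReal.toReal_ofReal (Real.exp_pos _).le, Complex.real_smul]

/-- All matrix entries come from this separation of variables: in polar coordinates a monomial times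
a function of the angle and a function of the radius factors. The same identity serves
orthonormality, angular steps and radial steps. -/
theorem integral_polar_monomial (N : ℕ) (χ ψ : ℝ → ℂ) (i j : ℕ) :
    ∫ z, χ z.arg * ψ ‖z‖ * (z ^ i * conj z ^ j) ∂ginibreWeight N =
      (∫ r in Ioi (0 : ℝ), ψ r * ((r ^ (i + j + 1) * Real.exp (-(N : ℝ) * r ^ 2) : ℝ) : ℂ)) *
      ∫ θ in Ioo (-π) π, χ θ * Complex.exp ((((i : ℝ) - j) * θ : ℝ) * Complex.I) := by
  rw [integral_ginibreWeight, ← Complex.integral_comp_polarCoord_symm, polarCoord_target,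
    Measure.volume_eq_prod, ← setIntegral_prod_mul]
  refine setIntegral_congr_fun (measurableSet_Ioi.prod measurableSet_Ioo) fun p hp => ?_
  obtain ⟨hr, hθ⟩ := hp
  have hr' : (0 : ℝ) < p.1 := hr
  have hpc : (Complex.polarCoord.symm p : ℂ) = p.1 * Complex.exp (p.2 * Complex.I) := by
    rw [Complex.polarCoord_symm_apply, Complex.exp_mul_I]
    push_cast; ring
  have harg : (Complex.polarCoord.symm p).arg = p.2 := by
    rw [hpc, Complex.exp_mul_I]
    exact Complex.arg_mul_cos_add_sin_mul_I hr' ⟨hθ.1, hθ.2.le⟩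
  have hnorm : ‖Complex.polarCoord.symm p‖ = p.1 := by
    rw [hpc, norm_mul, Complex.norm_exp_ofReal_mul_I, Complex.norm_real, mul_one,
      Real.norm_of_nonneg hr'.le]
  rw [harg, hnorm, hpc, Complex.real_smul, map_mul, Complex.conj_ofReal, ← Complex.exp_conj,
    map_mul, Complex.conj_I, Complex.conj_ofReal, mul_pow, mul_pow, ← Complex.exp_nat_mul,
    ← Complex.exp_nat_mul]
  have : Complex.exp ((((i : ℝ) - j) * p.2 : ℝ) * Complex.I) =
      Complex.exp (i * (p.2 * Complex.I)) * Complex.exp (j * (p.2 * -Complex.I)) := by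
    rw [← Complex.exp_add]; congr 1; push_cast; ring
  rw [this]
  push_cast
  ring

/-- The squared norm of `z ^ k` for the Gaussian weight. -/
noncomputable def monomialNormSq (N k : ℕ) : ℝ := π * k.factorial / (N : ℝ) ^ (k + 1)

theorem monomialNormSq_pos {N : ℕ} (hN : 0 < N) (k : ℕ) : 0 < monomialNormSq N k := by
  unfold monomialNormSq; positivity

theorem integral_pow_mul_exp_neg_mul_sq {N : ℕ} (hN : 0 < N) (m : ℕ) :
    ∫ r in Ioi (0 : ℝ), r ^ (m + 1) * Real.exp (-(N : ℝ) * r ^ 2) =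
      Real.Gamma (m / 2 + 1) / (2 * (N : ℝ) ^ ((m : ℝ) / 2 + 1)) := by
  have h := integral_rpow_mul_exp_neg_mul_rpow (p := 2) (q := m + 1) (b := N) two_pos
    (by have : (0 : ℝ) ≤ m := m.cast_nonneg
        linarith) (by exact_mod_cast hN)
  have e1 : ((m : ℝ) + 1 + 1) / 2 = m / 2 + 1 := by ring
  rw [neg_div, e1, Real.rpow_neg (Nat.cast_nonneg N)] at h
  have : ∀ r : ℝ, r ^ (m + 1) * Real.exp (-(N : ℝ) * r ^ 2) =
      r ^ ((m : ℝ) + 1) * Real.exp (-(N : ℝ) * r ^ (2 : ℝ)) := by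
    intro r
    rw [← Real.rpow_natCast, ← Real.rpow_natCast]; push_cast; rfl
  simp_rw [this]
  rw [h]
  have : (0 : ℝ) < (N : ℝ) ^ ((m : ℝ) / 2 + 1) := Real.rpow_pos_of_pos (by exact_mod_cast hN) _
  field_simp

theorem integral_exp_int_mul_I (m : ℤ) (a : ℝ) :
    ∫ θ in a..(a + 2 * π), Complex.exp (((m : ℝ) * θ : ℝ) * Complex.I) =
      if m = 0 then ((2 * π : ℝ) : ℂ) else 0 := by
  split_ifs with h
  · simp [h]
  · have hc : (m : ℂ) * Complex.I ≠ 0 := by simp [h]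
    have : ∀ θ : ℝ, Complex.exp (((m : ℝ) * θ : ℝ) * Complex.I) =
        Complex.exp ((m : ℂ) * Complex.I * θ) := by
      intro θ; congr 1; push_cast; ring
    simp_rw [this]
    rw [integral_exp_mul_complex hc]
    have : Complex.exp ((m : ℂ) * Complex.I * ((a + 2 * π : ℝ) : ℂ)) =
        Complex.exp ((m : ℂ) * Complex.I * (a : ℂ)) := by
      rw [Complex.exp_eq_exp_iff_exists_int]
      exact ⟨m, by push_cast; ring⟩
    rw [this, sub_self, zero_div]

theorem setIntegral_Ioo_eq_intervalIntegral (f : ℝ → ℂ) :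
    ∫ θ in Ioo (-π) π, f θ = ∫ θ in (-π)..π, f θ := by
  rw [intervalIntegral.integral_of_le (by linarith [Real.pi_pos]), integral_Ioc_eq_integral_Ioo]

/-- The orthonormal monomials of the Gaussian weight. -/
noncomputable def ginibreBasis (N : ℕ) (i : Fin N) (z : ℂ) : ℂ :=
  z ^ (i : ℕ) / (√(monomialNormSq N i) : ℂ)

theorem integrable_monomial {N : ℕ} (hN : 0 < N) (i j : ℕ) :
    Integrable (fun z : ℂ => z ^ i * conj z ^ j) (ginibreWeight N) := by
  rw [integrable_ginibreWeight_iff]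
  have h : Integrable (fun z : ℂ => (‖z‖ ^ (i + j) * Real.exp (-(N : ℝ) * ‖z‖ ^ 2))) := by
    refine (integrable_fun_norm_addHaar (volume : Measure ℂ)
      (f := fun r : ℝ => r ^ (i + j) * Real.exp (-(N : ℝ) * r ^ 2))).2 ?_
    have h2 := integrableOn_rpow_mul_exp_neg_mul_rpow (p := 2) (s := ((i + j : ℕ) : ℝ) + 1) (b := N)
      (by have : (0 : ℝ) ≤ ((i + j : ℕ) : ℝ) := Nat.cast_nonneg _
          linarith) two_pos (by exact_mod_cast hN)
    refine h2.congr_fun (fun r hr => ?_) measurableSet_Ioi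
    simp only [Complex.finrank_real_complex, smul_eq_mul]
    rw [Real.rpow_add_one (ne_of_gt hr), Real.rpow_natCast, Real.rpow_two]
    ring
  refine h.mono (by fun_prop) (ae_of_all _ fun z => le_of_eq ?_)
  simp only [norm_mul, norm_pow, RCLike.norm_conj, Complex.norm_real, norm_norm]
  ring

theorem orthonormalSystem_ginibreBasis {N : ℕ} (hN : 0 < N) :
    OrthonormalSystem (ginibreWeight N) (ginibreBasis N) := by
  have key : ∀ i j : Fin N, ∀ z : ℂ, ginibreBasis N i z * conj (ginibreBasis N j z) =
      ((√(monomialNormSq N i) * √(monomialNormSq N j) : ℝ) : ℂ)⁻¹ *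
        (z ^ (i : ℕ) * conj z ^ (j : ℕ)) := by
    intro i j z
    simp only [ginibreBasis, map_div₀, map_pow, Complex.conj_ofReal]
    push_cast
    field_simp
  refine ⟨fun i j => ?_, fun i j => ?_⟩
  · simp_rw [key]
    exact (integrable_monomial hN _ _).const_mul _
  · simp_rw [key]
    rw [integral_const_mul]
    have := integral_polar_monomial N (fun _ => 1) (fun _ => 1) i j
    simp only [one_mul] at this
    rw [this, setIntegral_Ioo_eq_intervalIntegral, integral_complex_ofReal,
      integral_pow_mul_exp_neg_mul_sq hN]
    have h2 := integral_exp_int_mul_I ((i : ℤ) - j) (-π)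
    rw [show -π + 2 * π = π by ring] at h2
    push_cast at h2 ⊢
    rw [h2]
    by_cases hij : i = j
    · subst hij
      simp only [sub_self, if_true]
      have hpos := monomialNormSq_pos hN i
      rw [← Complex.ofReal_mul, Real.mul_self_sqrt hpos.le]
      have e : ((i : ℝ) + i) / 2 + 1 = (i : ℕ) + 1 := by ring
      norm_cast
      push_cast
      rw [e, Real.Gamma_nat_eq_factorial, ← Nat.cast_add_one, Real.rpow_natCast, monomialNormSq]
      have : (N : ℂ) ≠ 0 := by exact_mod_cast hN.ne'
      have hf : ((i : ℕ).factorial : ℂ) ≠ 0 := by exact_mod_cast (i : ℕ).factorial_ne_zero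
      have hπ : (π : ℂ) ≠ 0 := by exact_mod_cast Real.pi_ne_zero
      push_cast
      field_simp
    · have : ((i : ℤ) - j) ≠ 0 := by
        rw [sub_ne_zero]; exact_mod_cast fun h => hij (Fin.ext h)
      rw [if_neg this, if_neg hij]; simp

theorem vandermondeSq_eq {N : ℕ} (z : Fin N → ℂ) :
    (vandermondeSq z : ℂ) =
      (Matrix.vandermonde z).det * conj (Matrix.vandermonde z).det := by
  rw [Complex.mul_conj, Complex.normSq_eq_norm_sq, Matrix.det_vandermonde, norm_prod,
    ← Finset.prod_pow, vandermondeSq]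
  congr 1
  simp only [norm_prod, ← Finset.prod_pow]
  refine (Finset.prod_comm' (by simp)).trans
    (Finset.prod_congr rfl fun i _ => Finset.prod_congr rfl fun j _ => ?_)
  rw [norm_sub_rev]

/-- Row i of the Slater matrix is row i of the transposed Vandermonde matrix divided by the norm of
z^i, so the determinants differ by the product of the norms. -/
theorem slaterSq_ginibreBasis {N : ℕ} (hN : 0 < N) (z : Fin N → ℂ) :
    slaterSq (ginibreBasis N) z * ((∏ i : Fin N, monomialNormSq N i : ℝ) : ℂ) =
      (vandermondeSq z : ℂ) := by
  have h : (Matrix.of fun i j => ginibreBasis N i (z j)) =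
      Matrix.of fun i j : Fin N => ((√(monomialNormSq N i) : ℂ))⁻¹ * (Matrix.vandermonde z).transpose i j := by
    ext i j
    simp [ginibreBasis, Matrix.vandermonde, div_eq_inv_mul]
  rw [slaterSq, h, Matrix.det_mul_column, Matrix.det_transpose, vandermondeSq_eq, map_mul,
    map_prod]
  have h2 : ((∏ i : Fin N, monomialNormSq N i : ℝ) : ℂ) =
      (∏ i : Fin N, (√(monomialNormSq N i) : ℂ)) * ∏ i : Fin N, (√(monomialNormSq N i) : ℂ) := by
    rw [← Finset.prod_mul_distrib]
    push_cast
    refine Finset.prod_congr rfl fun i _ => ?_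
    rw [← Complex.ofReal_mul, Real.mul_self_sqrt (monomialNormSq_pos hN i).le]
  rw [h2]
  simp only [map_inv₀, Complex.conj_ofReal, Finset.prod_inv_distrib]
  have : (∏ i : Fin N, (√(monomialNormSq N i) : ℂ)) ≠ 0 := by
    refine Finset.prod_ne_zero_iff.2 fun i _ => ?_
    exact_mod_cast (Real.sqrt_pos.2 (monomialNormSq_pos hN i)).ne'
  field_simp

theorem vandermondeSq_nonneg {N : ℕ} (z : Fin N → ℂ) : 0 ≤ vandermondeSq z :=
  Finset.prod_nonneg fun _ _ => Finset.prod_nonneg fun _ _ => by positivity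

theorem measurable_vandermondeSq {N : ℕ} :
    Measurable (vandermondeSq : (Fin N → ℂ) → ℝ) := by
  unfold vandermondeSq
  fun_prop

theorem integral_ginibreUnnormalized {N : ℕ} (hN : 0 < N) (φ : (Fin N → ℂ) → ℝ) :
    ((∫ z, φ z ∂ginibreUnnormalized N : ℝ) : ℂ) =
      ((∏ i : Fin N, monomialNormSq N i : ℝ) : ℂ) *
        ∫ z, (φ z : ℂ) * slaterSq (ginibreBasis N) z ∂(Measure.pi fun _ => ginibreWeight N) := by
  unfold ginibreUnnormalized
  rw [integral_withDensity_eq_integral_toReal_smul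
    (measurable_vandermondeSq.ennreal_ofReal) (by simp), ← integral_const_mul,
    ← integral_complex_ofReal]
  refine integral_congr_ae (ae_of_all _ fun z => ?_)
  simp only
  rw [ENNReal.toReal_ofReal (vandermondeSq_nonneg z), smul_eq_mul]
  push_cast
  rw [← slaterSq_ginibreBasis hN z]
  push_cast
  ring

theorem ginibreUnnormalized_univ {N : ℕ} (hN : 0 < N) :
    (ginibreUnnormalized N univ).toReal =
      (∏ i : Fin N, monomialNormSq N i) * N.factorial := by
  have h := integral_ginibreUnnormalized hN (fun _ => 1)
  simp only [Complex.ofReal_one, one_mul] at h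
  rw [(orthonormalSystem_ginibreBasis hN).integral_slaterSq] at h
  simp only [integral_const, smul_eq_mul, mul_one, Measure.real, Fintype.card_fin] at h
  exact_mod_cast h

theorem ginibreUnnormalized_univ_pos {N : ℕ} (hN : 0 < N) :
    0 < (ginibreUnnormalized N univ).toReal := by
  rw [ginibreUnnormalized_univ hN]
  have := Finset.prod_pos fun (i : Fin N) (_ : i ∈ Finset.univ) => monomialNormSq_pos hN i
  positivity

theorem isProbabilityMeasure_ginibreLaw {N : ℕ} (hN : 0 < N) :
    IsProbabilityMeasure (ginibreLaw N) := by
  have h := ENNReal.toReal_pos_iff.1 (ginibreUnnormalized_univ_pos hN)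
  refine ⟨?_⟩
  rw [ginibreLaw, Measure.smul_apply, smul_eq_mul]
  exact ENNReal.inv_mul_cancel h.1.ne' h.2.ne

theorem integral_ginibreLaw {N : ℕ} (hN : 0 < N) (φ : (Fin N → ℂ) → ℝ) :
    ((∫ z, φ z ∂ginibreLaw N : ℝ) : ℂ) = (N.factorial : ℂ)⁻¹ *
        ∫ z, (φ z : ℂ) * slaterSq (ginibreBasis N) z ∂(Measure.pi fun _ => ginibreWeight N) := by
  rw [ginibreLaw, integral_smul_measure, smul_eq_mul, Complex.ofReal_mul,
    integral_ginibreUnnormalized hN, ENNReal.toReal_inv, ginibreUnnormalized_univ hN]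
  have : (∏ i : Fin N, (monomialNormSq N i : ℂ)) ≠ 0 :=
    Finset.prod_ne_zero_iff.2 fun i _ => by exact_mod_cast (monomialNormSq_pos hN i).ne'
  push_cast
  field_simp

/-- The compression of multiplication by `f` to the span of the first `N` monomials. -/
noncomputable def ginibreCompression (N : ℕ) (f : ℂ → ℝ) : Matrix (Fin N) (Fin N) ℂ :=
  compression (ginibreWeight N) (ginibreBasis N) fun z => (f z : ℂ)

theorem measurable_linearStat {N : ℕ} {f : ℂ → ℝ} (hf : Measurable f) :
    Measurable (linearStat f : (Fin N → ℂ) → ℝ) := by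
  unfold linearStat
  fun_prop

theorem memLp_linearStat {N : ℕ} (hN : 0 < N) {f : ℂ → ℝ} (hf : Measurable f) {C : ℝ}
    (hC : ∀ x, |f x| ≤ C) : MemLp (linearStat f : (Fin N → ℂ) → ℝ) 2 (ginibreLaw N) := by
  have := isProbabilityMeasure_ginibreLaw hN
  refine MemLp.of_bound (measurable_linearStat hf).aestronglyMeasurable (N * C)
    (ae_of_all _ fun z => ?_)
  refine (norm_sum_le _ _).trans ?_
  refine (Finset.sum_le_sum fun k _ => hC (z k)).trans ?_
  simp

theorem covariance_linearStat {N : ℕ} (hN : 0 < N) {f g : ℂ → ℝ} (hf : Measurable f) {C : ℝ}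
    (hC : ∀ x, |f x| ≤ C) (hg : Measurable g) {D : ℝ} (hD : ∀ x, |g x| ≤ D) :
    (ProbabilityTheory.covariance (linearStat f) (linearStat g) (ginibreLaw N) : ℂ) =
      (ginibreCompression N fun z => f z * g z).trace -
        (ginibreCompression N f * ginibreCompression N g).trace := by
  have hP := isProbabilityMeasure_ginibreLaw hN
  have he := orthonormalSystem_ginibreBasis hN
  have hf' : Measurable fun z => (f z : ℂ) := Complex.measurable_ofReal.comp hf
  have hg' : Measurable fun z => (g z : ℂ) := Complex.measurable_ofReal.comp hg
  have hC' : ∀ z, ‖(f z : ℂ)‖ ≤ C := fun z => by simpa using hC z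
  have hD' : ∀ z, ‖(g z : ℂ)‖ ≤ D := fun z => by simpa using hD z
  rw [ProbabilityTheory.covariance_eq_sub (memLp_linearStat hN hf hC) (memLp_linearStat hN hg hD)]
  push_cast
  rw [integral_ginibreLaw hN, integral_ginibreLaw hN, integral_ginibreLaw hN]
  simp only [Pi.mul_apply, linearStat, Complex.ofReal_mul, Complex.ofReal_sum]
  rw [he.integral_sum_mul_sum hf' hC' hg' hD', he.integral_sum hf' hC', he.integral_sum hg' hD']
  have : (N.factorial : ℂ) ≠ 0 := by exact_mod_cast N.factorial_ne_zero
  simp only [Fintype.card_fin, ginibreCompression, Complex.ofReal_mul]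
  field_simp
  ring

end Ginibre

/-! ### Bilinearity and signs of the covariance. -/

section CovarianceForm

open ComplexConjugate ComplexOrder

/-- The covariance of two linear statistics of the Ginibre eigenvalues. -/
noncomputable def ginibreCov (N : ℕ) (f g : ℂ → ℝ) : ℝ :=
  ProbabilityTheory.covariance (linearStat f) (linearStat g) (ginibreLaw N)

/-- Bounded measurable test functions. -/
structure BoundedMeasurable (f : ℂ → ℝ) : Prop where
  measurable : Measurable f
  bounded : ∃ C, ∀ z, |f z| ≤ C

theorem BoundedMeasurable.sub {f g : ℂ → ℝ} (hf : BoundedMeasurable f)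
    (hg : BoundedMeasurable g) : BoundedMeasurable (f - g) := by
  obtain ⟨C, hC⟩ := hf.bounded
  obtain ⟨D, hD⟩ := hg.bounded
  refine ⟨hf.measurable.sub hg.measurable, C + D, fun z => ?_⟩
  exact (abs_sub _ _).trans (add_le_add (hC z) (hD z))

theorem boundedMeasurable_indicator {A : Set ℂ} (hA : MeasurableSet A) :
    BoundedMeasurable (A.indicator fun _ => 1) := by
  refine ⟨measurable_const.indicator hA, 1, fun z => ?_⟩
  by_cases h : z ∈ A <;> simp [h]

theorem BoundedMeasurable.const (c : ℝ) : BoundedMeasurable fun _ => c :=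
  ⟨measurable_const, |c|, fun _ => le_rfl⟩

theorem ginibreCov_comm (N : ℕ) (f g : ℂ → ℝ) : ginibreCov N f g = ginibreCov N g f :=
  ProbabilityTheory.covariance_comm _ _

theorem ginibreCov_zero (f g : ℂ → ℝ) : ginibreCov 0 f g = 0 := by
  have : (linearStat f : (Fin 0 → ℂ) → ℝ) = 0 := by ext z; simp [linearStat]
  rw [ginibreCov, this, ProbabilityTheory.covariance_zero_left]

theorem linearStat_sub {N : ℕ} (f g : ℂ → ℝ) :
    (linearStat (f - g) : (Fin N → ℂ) → ℝ) = linearStat f - linearStat g := by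
  ext z; simp [linearStat]

variable {N : ℕ}

theorem ginibreCov_eq (hN : 0 < N) {f g : ℂ → ℝ} (hf : BoundedMeasurable f)
    (hg : BoundedMeasurable g) :
    (ginibreCov N f g : ℂ) = (ginibreCompression N fun z => f z * g z).trace -
        (ginibreCompression N f * ginibreCompression N g).trace := by
  obtain ⟨C, hC⟩ := hf.bounded
  obtain ⟨D, hD⟩ := hg.bounded
  exact covariance_linearStat hN hf.measurable hC hg.measurable hD

theorem BoundedMeasurable.memLp (hN : 0 < N) {f : ℂ → ℝ} (hf : BoundedMeasurable f) :
    MemLp (linearStat f : (Fin N → ℂ) → ℝ) 2 (ginibreLaw N) := by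
  obtain ⟨C, hC⟩ := hf.bounded
  exact memLp_linearStat hN hf.measurable hC

/-- The weight is absolutely continuous with respect to Lebesgue measure, so endpoints of arcs and
intervals can be ignored. -/
theorem ginibreCompression_congr {f g : ℂ → ℝ} (h : f =ᵐ[volume] g) :
    ginibreCompression N f = ginibreCompression N g := by
  ext i j
  refine integral_congr_ae ?_
  have : f =ᵐ[ginibreWeight N] g := (withDensity_absolutelyContinuous _ _).ae_eq h
  filter_upwards [this] with z hz
  simp only [hz]

theorem ginibreCov_congr {f g f' g' : ℂ → ℝ} (hf : BoundedMeasurable f)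
    (hg : BoundedMeasurable g) (hf' : BoundedMeasurable f')
    (hg' : BoundedMeasurable g') (h : f =ᵐ[volume] f') (h' : g =ᵐ[volume] g') :
    ginibreCov N f g = ginibreCov N f' g' := by
  rcases N.eq_zero_or_pos with rfl | hN
  -- For N = 0 all linear statistics are empty sums. The case is separated because the trace formula
  -- requires N > 0.
  · simp [ginibreCov_zero]
  have h2 : (fun z => f z * g z) =ᵐ[volume] fun z => f' z * g' z := by
    filter_upwards [h, h'] with z hz hz'
    rw [hz, hz']
  have := ginibreCov_eq hN hf hg
  rw [ginibreCompression_congr h, ginibreCompression_congr h', ginibreCompression_congr h2,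
    ← ginibreCov_eq hN hf' hg'] at this
  exact_mod_cast this

theorem ginibreCov_sub_sub {f g f' g' : ℂ → ℝ} (hf : BoundedMeasurable f)
    (hg : BoundedMeasurable g) (hf' : BoundedMeasurable f') (hg' : BoundedMeasurable g') :
    ginibreCov N (f - f') (g - g') =
      ginibreCov N f g - ginibreCov N f g' - ginibreCov N f' g + ginibreCov N f' g' := by
  rcases N.eq_zero_or_pos with rfl | hN
  · simp [ginibreCov_zero]
  have := isProbabilityMeasure_ginibreLaw hN
  simp only [ginibreCov, linearStat_sub]
  exact ProbabilityTheory.covariance_sub_sub (hf.memLp hN) (hf'.memLp hN) (hg.memLp hN)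
    (hg'.memLp hN)

theorem ginibreCov_sub_left {f g f' : ℂ → ℝ} (hf : BoundedMeasurable f)
    (hg : BoundedMeasurable g) (hf' : BoundedMeasurable f') :
    ginibreCov N (f - f') g = ginibreCov N f g - ginibreCov N f' g := by
  rcases N.eq_zero_or_pos with rfl | hN
  · simp [ginibreCov_zero]
  have := isProbabilityMeasure_ginibreLaw hN
  simp only [ginibreCov, linearStat_sub]
  exact ProbabilityTheory.covariance_sub_left (hf.memLp hN) (hf'.memLp hN) (hg.memLp hN)

theorem ginibreCov_const_left (c : ℝ) (g : ℂ → ℝ) :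
    ginibreCov N (fun _ => c) g = 0 := by
  rcases N.eq_zero_or_pos with rfl | hN
  · simp [ginibreCov_zero]
  have := isProbabilityMeasure_ginibreLaw hN
  have h : (linearStat (fun _ => c) : (Fin N → ℂ) → ℝ) = fun _ => N * c := by
    ext z; simp [linearStat]
  rw [ginibreCov, h, ProbabilityTheory.covariance_const_left]

theorem posSemidef_compression {ι X : Type*} [Fintype ι] [DecidableEq ι] [MeasurableSpace X]
    {μ : Measure X} {e : ι → X → ℂ} {f : X → ℝ} (hf : ∀ x, 0 ≤ f x)
    (hi : ∀ i j, Integrable (fun x => (f x : ℂ) * (e i x * conj (e j x))) μ) :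
    (compression μ e fun x => (f x : ℂ)).PosSemidef := by
  refine Matrix.PosSemidef.of_dotProduct_mulVec_nonneg ?_ fun y => ?_
  · ext i j
    simp only [compression, Matrix.conjTranspose_apply, Matrix.of_apply, RCLike.star_def,
      ← integral_conj]
    refine integral_congr_ae (ae_of_all _ fun x => ?_)
    simp only [map_mul, Complex.conj_conj, Complex.conj_ofReal]
    ring
  · have h1 : star y ⬝ᵥ ((compression μ e fun x => (f x : ℂ)).mulVec y) =
        ∫ x, ((f x * ‖∑ i, conj (y i) * e i x‖ ^ 2 : ℝ) : ℂ) ∂μ := by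
      have h2 : ∀ x, ((f x * ‖∑ i, conj (y i) * e i x‖ ^ 2 : ℝ) : ℂ) =
          ∑ i, ∑ j, conj (y i) * y j * ((f x : ℂ) * (e i x * conj (e j x))) := by
        intro x
        rw [← Complex.normSq_eq_norm_sq, Complex.ofReal_mul, ← Complex.mul_conj, map_sum,
          Finset.sum_mul_sum, Finset.mul_sum]
        refine Finset.sum_congr rfl fun i _ => ?_
        rw [Finset.mul_sum]
        refine Finset.sum_congr rfl fun j _ => ?_
        simp only [map_mul, Complex.conj_conj]
        ring
      simp_rw [h2]
      rw [integral_finsetSum _ fun i _ => integrable_finsetSum _ fun j _ => (hi i j).const_mul _]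
      simp only [dotProduct, Matrix.mulVec, Finset.mul_sum]
      refine Finset.sum_congr rfl fun i _ => ?_
      rw [integral_finsetSum _ fun j _ => (hi i j).const_mul _]
      refine Finset.sum_congr rfl fun j _ => ?_
      rw [integral_const_mul]
      simp only [compression, Matrix.of_apply, Pi.star_apply, RCLike.star_def]
      ring
    rw [h1, integral_complex_ofReal]
    exact_mod_cast integral_nonneg fun x => mul_nonneg (hf x) (by positivity)

/-- The trace of AB is the sum of all entries of the Hadamard product of A and Bᵀ, that is, its
quadratic form at the all-ones vector; the Schur product theorem applies. -/
theorem posSemidef_trace_mul_nonneg {ι : Type*} [Fintype ι] [DecidableEq ι]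
    {A B : Matrix ι ι ℂ} (hA : A.PosSemidef) (hB : B.PosSemidef) : 0 ≤ (A * B).trace := by
  have h := (hA.hadamard hB.transpose).dotProduct_mulVec_nonneg (fun _ => 1)
  convert h using 1
  simp [Matrix.trace, Matrix.mul_apply, dotProduct, Matrix.mulVec]

theorem posSemidef_ginibreCompression (hN : 0 < N) {f : ℂ → ℝ} (hf : BoundedMeasurable f)
    (h0 : ∀ z, 0 ≤ f z) : (ginibreCompression N f).PosSemidef := by
  obtain ⟨C, hC⟩ := hf.bounded
  exact posSemidef_compression h0 fun i j => (orthonormalSystem_ginibreBasis hN).integrable_mul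
    (Complex.measurable_ofReal.comp hf.measurable) (C := C) (fun z => by simpa using hC z) i j

theorem ginibreCov_indicator_nonpos {A B : Set ℂ} (hA : MeasurableSet A) (hB : MeasurableSet B)
    (h : Disjoint A B) :
    ginibreCov N (A.indicator fun _ => 1) (B.indicator fun _ => 1) ≤ 0 := by
  rcases N.eq_zero_or_pos with rfl | hN
  · simp [ginibreCov_zero]
  have hAb := boundedMeasurable_indicator hA
  have hBb := boundedMeasurable_indicator hB
  have h1 := ginibreCov_eq hN hAb hBb
  have h2 : (fun z => A.indicator (fun _ => (1 : ℝ)) z * B.indicator (fun _ => 1) z) =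
      fun _ => 0 := by
    ext z
    by_cases hz : z ∈ A
    · simp [hz, Set.disjoint_left.1 h hz]
    · simp [hz]
  have h3 : ginibreCompression N (fun _ => 0) = 0 := by
    ext i j; simp [ginibreCompression, compression]
  have h4 := posSemidef_trace_mul_nonneg
    (posSemidef_ginibreCompression hN hAb fun z => indicator_nonneg (by simp) z)
    (posSemidef_ginibreCompression hN hBb fun z => indicator_nonneg (by simp) z)
  rw [h2, h3, Matrix.trace_zero, zero_sub] at h1
  have h5 : (ginibreCov N (A.indicator fun _ => 1) (B.indicator fun _ => 1) : ℂ) ≤ 0 := by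
    rw [h1]; simpa using h4
  exact_mod_cast h5

/-- The total count is deterministic, so replacing B by its complement only changes the sign, and A
is disjoint from that complement. -/
theorem ginibreCov_indicator_nonneg {A B : Set ℂ} (hA : MeasurableSet A) (hB : MeasurableSet B)
    (h : A ⊆ B) :
    0 ≤ ginibreCov N (A.indicator fun _ => 1) (B.indicator fun _ => 1) := by
  have h1 : (B.indicator fun _ => 1) = (fun _ => (1 : ℝ)) - Bᶜ.indicator fun _ => 1 := by
    ext z; by_cases hz : z ∈ B <;> simp [hz]
  rw [ginibreCov_comm, h1, ginibreCov_sub_left (.const 1) (boundedMeasurable_indicator hA)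
    (boundedMeasurable_indicator hB.compl), ginibreCov_const_left, ginibreCov_comm, zero_sub,
    neg_nonneg]
  exact ginibreCov_indicator_nonpos hA hB.compl (disjoint_compl_right.mono_left h)

end CovarianceForm

/-! ### Arc counts as differences of step functions of the angle. -/

section Angular

open ComplexConjugate

/-- The step function of the angle with jumps at `x` and at the cut of the argument. -/
noncomputable def angularStep (x : ℝ) (z : ℂ) : ℝ := ⌊(x - z.arg) / (2 * π)⌋

theorem boundedMeasurable_angularStep (x : ℝ) : BoundedMeasurable (angularStep x) := by
  refine ⟨?_, |x| / (2 * π) + 2, fun z => ?_⟩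
  · have : Measurable fun z : ℂ => (x - z.arg) / (2 * π) := by fun_prop
    exact measurable_from_top.comp this.floor
  · have hπ := Real.pi_pos
    have h1 := Int.floor_le ((x - z.arg) / (2 * π))
    have h2 := Int.lt_floor_add_one ((x - z.arg) / (2 * π))
    have h3 : |(x - z.arg) / (2 * π)| ≤ |x| / (2 * π) + 1 := by
      rw [abs_div, abs_of_pos (by positivity : 0 < 2 * π), div_add_one (by positivity)]
      gcongr
      exact (abs_sub _ _).trans (add_le_add le_rfl ((Complex.abs_arg_le_pi z).trans (by linarith)))
    rw [abs_le] at h3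
    rw [angularStep, abs_le]
    constructor <;> linarith [h3.1, h3.2]

theorem angularStep_add_int (x : ℝ) (n : ℤ) (z : ℂ) :
    angularStep (x + n * (2 * π)) z = angularStep x z + n := by
  have : (x + n * (2 * π) - z.arg) / (2 * π) = (x - z.arg) / (2 * π) + n := by
    field_simp
    ring
  rw [angularStep, this, Int.floor_add_intCast]
  push_cast; rfl

/-- The set lies in a real line through the origin, a proper subspace of the plane. -/
theorem volume_arg_eq (c : ℝ) : volume {z : ℂ | z.arg = c} = 0 := by
  have h1 : {z : ℂ | z.arg = c} ⊆
      (Submodule.span ℝ {Complex.exp (c * Complex.I)} : Submodule ℝ ℂ) := by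
    intro z hz
    rw [SetLike.mem_coe, Submodule.mem_span_singleton]
    refine ⟨‖z‖, ?_⟩
    rw [Complex.real_smul, ← (show z.arg = c from hz)]
    exact Complex.norm_mul_exp_arg_mul_I z
  refine measure_mono_null h1 (Measure.addHaar_submodule volume _ fun h => ?_)
  have h2 := finrank_span_singleton (K := ℝ) (Complex.exp_ne_zero (c * Complex.I))
  rw [h, finrank_top, Complex.finrank_real_complex] at h2
  norm_num at h2

theorem floor_sub_floor_eq {a b : ℝ} (hab : a ≤ b) (hab1 : b ≤ a + 1) (ha : ∀ n : ℤ, a ≠ n) :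
    ((⌊b⌋ : ℝ) - ⌊a⌋ = 1 ∧ ∃ n : ℤ, a ≤ n ∧ n ≤ b) ∨
      ((⌊b⌋ : ℝ) - ⌊a⌋ = 0 ∧ ¬ ∃ n : ℤ, a ≤ n ∧ n ≤ b) := by
  have h1 := (Int.floor_le a).lt_of_ne (ha _).symm
  have h2 := Int.lt_floor_add_one a
  by_cases h : (⌊a⌋ : ℝ) + 1 ≤ b
  · left
    have : ⌊b⌋ = ⌊a⌋ + 1 := by
      rw [Int.floor_eq_iff]; push_cast; exact ⟨h, by linarith⟩
    rw [this]
    exact ⟨by push_cast; ring, ⌊a⌋ + 1, by push_cast; exact ⟨h2.le, h⟩⟩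
  · right
    push Not at h
    have : ⌊b⌋ = ⌊a⌋ := by
      rw [Int.floor_eq_iff]; exact ⟨by linarith, h⟩
    rw [this]
    refine ⟨by ring, ?_⟩
    rintro ⟨n, hn1, hn2⟩
    have h3 : (⌊a⌋ : ℝ) < n := by linarith
    have h4 : (n : ℝ) < ⌊a⌋ + 1 := by linarith
    norm_cast at h3 h4
    omega

theorem coe_arg_mem_circleArc_iff (α β θ : ℝ) :
    (θ : Real.Angle) ∈ circleArc α β ↔
      ∃ n : ℤ, (α - θ) / (2 * π) ≤ n ∧ n ≤ (β - θ) / (2 * π) := by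
  have hπ := Real.pi_pos
  simp only [circleArc, mem_image, mem_Icc, Real.Angle.angle_eq_iff_two_pi_dvd_sub,
    div_le_iff₀ (by positivity : 0 < 2 * π), le_div_iff₀ (by positivity : 0 < 2 * π)]
  constructor
  · rintro ⟨φ, ⟨h1, h2⟩, k, hk⟩
    exact ⟨k, by linarith, by linarith⟩
  · rintro ⟨k, h1, h2⟩
    exact ⟨θ + k * (2 * π), ⟨by linarith, by linarith⟩, k, by ring⟩

theorem ae_arg_ne (α : ℝ) : ∀ᵐ z : ℂ, ∀ n : ℤ, (α - z.arg) / (2 * π) ≠ n := by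
  rw [ae_all_iff]
  intro n
  refine measure_mono_null (fun z hz => ?_) (volume_arg_eq (α - n * (2 * π)))
  simp only [mem_compl_iff, mem_ofPred_eq, not_not, ne_eq] at hz ⊢
  have hπ := Real.pi_pos
  field_simp at hz
  linarith

/-- The difference of floors counts the integers n with α < θ + 2πn ≤ β, wherever the cut of the
argument falls. It differs from the closed arc only on the ray of angle α, which is null. -/
theorem indicator_circleArc_ae_eq {α β : ℝ} (h1 : α < β) (h2 : β < α + 2 * π) :
    (Set.indicator {z : ℂ | (Complex.arg z : Real.Angle) ∈ circleArc α β} fun _ => (1 : ℝ))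
      =ᵐ[volume] angularStep β - angularStep α := by
  have hπ := Real.pi_pos
  filter_upwards [ae_arg_ne α] with z hz
  have h3 : (α - z.arg) / (2 * π) ≤ (β - z.arg) / (2 * π) := by gcongr
  have h4 : (β - z.arg) / (2 * π) ≤ (α - z.arg) / (2 * π) + 1 := by
    rw [div_add_one (by positivity)]; gcongr; linarith
  simp only [Pi.sub_apply, angularStep]
  rcases floor_sub_floor_eq h3 h4 hz with ⟨h5, h6⟩ | ⟨h5, h6⟩
  · rw [h5, indicator_of_mem]
    exact (coe_arg_mem_circleArc_iff α β z.arg).2 h6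
  · rw [h5, indicator_of_notMem]
    exact fun h => h6 ((coe_arg_mem_circleArc_iff α β z.arg).1 h)

theorem measurableSet_circleArc (α β : ℝ) :
    MeasurableSet {z : ℂ | (Complex.arg z : Real.Angle) ∈ circleArc α β} := by
  simp_rw [coe_arg_mem_circleArc_iff, ofPred_exists, ofPred_and]
  refine MeasurableSet.iUnion fun n => (measurableSet_le ?_ ?_).inter (measurableSet_le ?_ ?_) <;>
    fun_prop

/-- The variance of the number of points between the angles `y` and `x`. -/
noncomputable def arcVariance (N : ℕ) (x y : ℝ) : ℝ :=
  ginibreCov N (angularStep x - angularStep y) (angularStep x - angularStep y)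

/-- Polarization: if steps are viewed as vectors and V(x, y) as the squared length of a difference,
the inner product of two differences is half this signed sum of four squared lengths. The individual
steps depend on the cut of the argument, while V depends only on the angles modulo 2π. -/
theorem ginibreCov_circleArc (N : ℕ) {α β δ γ : ℝ} (h1 : α < β) (h2 : β < α + 2 * π) (h3 : δ < γ)
    (h4 : γ < δ + 2 * π) :
    ginibreCov N
      (Set.indicator {z : ℂ | (Complex.arg z : Real.Angle) ∈ circleArc α β} fun _ => 1)
      (Set.indicator {z : ℂ | (Complex.arg z : Real.Angle) ∈ circleArc δ γ} fun _ => 1) =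
      (arcVariance N β δ + arcVariance N α γ - arcVariance N β γ - arcVariance N α δ) / 2 := by
  have hb := boundedMeasurable_angularStep
  rw [ginibreCov_congr (boundedMeasurable_indicator (measurableSet_circleArc α β))
    (boundedMeasurable_indicator (measurableSet_circleArc δ γ)) ((hb β).sub (hb α))
    ((hb γ).sub (hb δ)) (indicator_circleArc_ae_eq h1 h2) (indicator_circleArc_ae_eq h3 h4)]
  simp only [arcVariance]
  simp only [ginibreCov_sub_sub (hb _) (hb _) (hb _) (hb _)]
  rw [ginibreCov_comm N (angularStep δ) (angularStep β),
    ginibreCov_comm N (angularStep γ) (angularStep α),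
    ginibreCov_comm N (angularStep γ) (angularStep β),
    ginibreCov_comm N (angularStep δ) (angularStep α)]
  ring

/-- A full turn changes the step by a constant, whose covariance with anything is zero. -/
theorem arcVariance_eq_of_angle_eq (N : ℕ) {x x' y : ℝ} (h : (x : Real.Angle) = x') :
    arcVariance N x y = arcVariance N x' y := by
  obtain ⟨n, hn⟩ := Real.Angle.angle_eq_iff_two_pi_dvd_sub.1 h
  have hx : x = x' + n * (2 * π) := by linarith
  have h1 : angularStep x - angularStep y =
      (angularStep x' - angularStep y) - fun _ => (-n : ℝ) := by
    ext z
    simp only [Pi.sub_apply, hx, angularStep_add_int]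
    ring
  have hb := (boundedMeasurable_angularStep x').sub (boundedMeasurable_angularStep y)
  unfold arcVariance
  rw [h1, ginibreCov_sub_left hb (hb.sub (.const _)) (.const _), ginibreCov_const_left,
    ginibreCov_comm, ginibreCov_sub_left hb hb (.const _), ginibreCov_const_left]
  ring

theorem arcVariance_self (N : ℕ) (x : ℝ) : arcVariance N x x = 0 := by
  unfold arcVariance
  rw [sub_self]
  exact ginibreCov_const_left 0 _

end Angular

/-! ### The arc variance as an integral against a positive kernel. -/

section AngularKernel

open ComplexConjugate ComplexOrder

theorem ginibreBasis_mul_conj {N : ℕ} (i j : Fin N) (z : ℂ) :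
    ginibreBasis N i z * conj (ginibreBasis N j z) =
      ((√(monomialNormSq N i) * √(monomialNormSq N j) : ℝ) : ℂ)⁻¹ *
        (z ^ (i : ℕ) * conj z ^ (j : ℕ)) := by
  simp only [ginibreBasis, map_div₀, map_pow, Complex.conj_ofReal]
  push_cast
  field_simp

/-- The inner product of the radial parts of the normalized monomials. -/
noncomputable def gammaRatio (i j : ℕ) : ℝ :=
  Real.Gamma (((i : ℝ) + j) / 2 + 1) / (√(i.factorial) * √(j.factorial))

theorem radial_integral_eq_gammaRatio {N : ℕ} (hN : 0 < N) (i j : ℕ) :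
    (√(monomialNormSq N i) * √(monomialNormSq N j))⁻¹ *
      (∫ r in Ioi (0 : ℝ), r ^ (i + j + 1) * Real.exp (-(N : ℝ) * r ^ 2)) =
      gammaRatio i j / (2 * π) := by
  rw [integral_pow_mul_exp_neg_mul_sq hN]
  have hN' : (0 : ℝ) < N := by exact_mod_cast hN
  have hπ := Real.pi_pos
  have h1 : √(monomialNormSq N i) * √(monomialNormSq N j) =
      π * (√(i.factorial) * √(j.factorial)) / (N : ℝ) ^ (((i + j : ℕ) : ℝ) / 2 + 1) := by
    have h2 : (N : ℝ) ^ (((i + j : ℕ) : ℝ) / 2 + 1) = √((N : ℝ) ^ (i + 1)) * √((N : ℝ) ^ (j + 1)) := by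
      rw [← Real.sqrt_mul (by positivity), ← pow_add, Real.sqrt_eq_rpow, ← Real.rpow_natCast,
        ← Real.rpow_mul hN'.le]
      congr 1; push_cast; ring
    rw [h2, monomialNormSq, monomialNormSq, Real.sqrt_div (by positivity),
      Real.sqrt_div (by positivity), Real.sqrt_mul hπ.le, Real.sqrt_mul hπ.le]
    have h3 : √π * √π = π := Real.mul_self_sqrt hπ.le
    field_simp
    rw [sq, h3]
  rw [h1, gammaRatio]
  have h4 : (0 : ℝ) < (N : ℝ) ^ (((i + j : ℕ) : ℝ) / 2 + 1) := Real.rpow_pos_of_pos hN' _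
  push_cast at h4 ⊢
  field_simp

theorem gammaRatio_self (i : ℕ) : gammaRatio i i = 1 := by
  have e : ((i : ℝ) + i) / 2 + 1 = (i : ℕ) + 1 := by ring
  rw [gammaRatio, e, Real.Gamma_nat_eq_factorial, Real.mul_self_sqrt (by positivity),
    div_self (by positivity)]

theorem gammaRatio_comm (i j : ℕ) : gammaRatio i j = gammaRatio j i := by
  rw [gammaRatio, gammaRatio, add_comm (i : ℝ), mul_comm (√(i.factorial : ℝ))]

theorem floor_angle_of_mem_Ioc {x y θ : ℝ} (hxy : y ≤ x) (hxy' : x ≤ y + 2 * π)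
    (hθ : θ ∈ Ioc y (y + 2 * π)) :
    ((⌊(x - θ) / (2 * π)⌋ : ℝ) - ⌊(y - θ) / (2 * π)⌋) = if θ ≤ x then 1 else 0 := by
  have hπ := Real.pi_pos
  have h1 : ⌊(y - θ) / (2 * π)⌋ = -1 := by
    rw [Int.floor_eq_iff, le_div_iff₀ (by positivity), div_lt_iff₀ (by positivity)]
    push_cast
    constructor <;> linarith [hθ.1, hθ.2]
  split_ifs with h
  · have h2 : ⌊(x - θ) / (2 * π)⌋ = 0 := by
      rw [Int.floor_eq_iff, le_div_iff₀ (by positivity), div_lt_iff₀ (by positivity)]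
      push_cast
      constructor <;> linarith [hθ.1, hθ.2]
    rw [h1, h2]; norm_num
  · have h2 : ⌊(x - θ) / (2 * π)⌋ = -1 := by
      rw [Int.floor_eq_iff, le_div_iff₀ (by positivity), div_lt_iff₀ (by positivity)]
      push_cast
      push Not at h
      constructor <;> linarith [hθ.1, hθ.2]
    rw [h1, h2]; norm_num

/-- The integrand is 2π-periodic, so the window can be moved to start at y, where the floor
difference is simply the indicator of θ ≤ x. -/
theorem integral_floor_mul_exp {x y : ℝ} (hxy : y ≤ x) (hxy' : x ≤ y + 2 * π) (m : ℤ) :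
    ∫ θ in (-π)..π, ((⌊(x - θ) / (2 * π)⌋ : ℂ) - ⌊(y - θ) / (2 * π)⌋) *
      Complex.exp (((m : ℝ) * θ : ℝ) * Complex.I) =
    ∫ θ in y..x, Complex.exp (((m : ℝ) * θ : ℝ) * Complex.I) := by
  have hπ := Real.pi_pos
  have hper : Function.Periodic (fun θ : ℝ =>
      ((⌊(x - θ) / (2 * π)⌋ : ℂ) - ⌊(y - θ) / (2 * π)⌋) *
      Complex.exp (((m : ℝ) * θ : ℝ) * Complex.I)) (2 * π) := by
    intro θ
    have h1 : ∀ w : ℝ, (w - (θ + 2 * π)) / (2 * π) = (w - θ) / (2 * π) - (1 : ℤ) := by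
      intro w; field_simp; push_cast; ring
    have h2 : Complex.exp (((m : ℝ) * (θ + 2 * π) : ℝ) * Complex.I) =
        Complex.exp (((m : ℝ) * θ : ℝ) * Complex.I) := by
      rw [Complex.exp_eq_exp_iff_exists_int]
      exact ⟨m, by push_cast; ring⟩
    simp only [h1, h2, Int.floor_sub_intCast]
    push_cast; ring
  have h := hper.intervalIntegral_add_eq (-π) y
  rw [show -π + 2 * π = π by ring] at h
  rw [h, intervalIntegral.integral_of_le (by linarith), intervalIntegral.integral_of_le hxy]
  have h3 : ∀ θ ∈ Ioc y (y + 2 * π), ((⌊(x - θ) / (2 * π)⌋ : ℂ) - ⌊(y - θ) / (2 * π)⌋) *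
      Complex.exp (((m : ℝ) * θ : ℝ) * Complex.I) =
      (Iic x).indicator (fun θ : ℝ => Complex.exp (((m : ℝ) * θ : ℝ) * Complex.I)) θ := by
    intro θ hθ
    have h4 := floor_angle_of_mem_Ioc hxy hxy' hθ
    have h5 : ((⌊(x - θ) / (2 * π)⌋ : ℂ) - ⌊(y - θ) / (2 * π)⌋) =
        ((if θ ≤ x then 1 else 0 : ℝ) : ℂ) := by rw [← h4]; push_cast; rfl
    rw [h5]
    by_cases hx : θ ≤ x
    · rw [indicator_of_mem (mem_Iic.2 hx)]; simp [hx]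
    · rw [indicator_of_notMem (by simpa using hx)]; simp [hx]
  rw [setIntegral_congr_fun measurableSet_Ioc h3, setIntegral_indicator measurableSet_Iic]
  congr 2
  ext θ
  simp only [mem_inter_iff, mem_Ioc, mem_Iic]
  constructor
  · rintro ⟨⟨h1, _⟩, h2⟩; exact ⟨h1, h2⟩
  · rintro ⟨h1, h2⟩; exact ⟨⟨h1, h2.trans hxy'⟩, h2⟩

theorem ginibreCompression_angularStep {N : ℕ} (hN : 0 < N) {x y : ℝ} (hxy : y ≤ x)
    (hxy' : x ≤ y + 2 * π) (i j : Fin N) :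
    ginibreCompression N (angularStep x - angularStep y) i j =
      ((gammaRatio i j / (2 * π) : ℝ) : ℂ) *
        ∫ θ in y..x, Complex.exp ((((((i : ℕ) : ℤ) - ((j : ℕ) : ℤ) : ℤ) : ℝ) * θ : ℝ) * Complex.I) := by
  have h1 : ∀ z : ℂ, (((angularStep x - angularStep y) z : ℝ) : ℂ) *
      (ginibreBasis N i z * conj (ginibreBasis N j z)) =
      ((√(monomialNormSq N i) * √(monomialNormSq N j) : ℝ) : ℂ)⁻¹ *
      (((⌊(x - z.arg) / (2 * π)⌋ : ℂ) - ⌊(y - z.arg) / (2 * π)⌋) * 1 *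
        (z ^ (i : ℕ) * conj z ^ (j : ℕ))) := by
    intro z
    rw [ginibreBasis_mul_conj]
    simp only [Pi.sub_apply, angularStep]
    push_cast
    ring
  simp only [ginibreCompression, compression, Matrix.of_apply]
  simp_rw [h1]
  rw [integral_const_mul, integral_polar_monomial N
    (fun θ => (⌊(x - θ) / (2 * π)⌋ : ℂ) - ⌊(y - θ) / (2 * π)⌋) (fun _ => 1),
    setIntegral_Ioo_eq_intervalIntegral, ← integral_floor_mul_exp hxy hxy',
    ← radial_integral_eq_gammaRatio hN]
  simp only [one_mul]
  rw [integral_complex_ofReal]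
  push_cast
  ring

/-- The second antiderivative of `cos (m t)` vanishing to second order at the origin. -/
noncomputable def cosPrimitive (m : ℤ) (t : ℝ) : ℝ :=
  if m = 0 then t ^ 2 / 2 else (1 - Real.cos (m * t)) / m ^ 2

/-- The two factors are complex conjugates, so the product is the squared modulus of the m-th
Fourier integral of the arc. -/
theorem integral_exp_mul_integral_exp_neg (m : ℤ) (x y : ℝ) :
    (∫ θ in y..x, Complex.exp (((m : ℝ) * θ : ℝ) * Complex.I)) *
      (∫ θ in y..x, Complex.exp ((((-m : ℤ) : ℝ) * θ : ℝ) * Complex.I)) =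
      ((2 * cosPrimitive m (x - y) : ℝ) : ℂ) := by
  unfold cosPrimitive
  split_ifs with h
  · simp [h]; ring
  · have hm : (m : ℂ) ≠ 0 := by exact_mod_cast h
    have hc : (m : ℂ) * Complex.I ≠ 0 := by simp [h]
    have hc' : -(m : ℂ) * Complex.I ≠ 0 := by simp [h]
    have e1 : ∀ θ : ℝ, Complex.exp (((m : ℝ) * θ : ℝ) * Complex.I) =
        Complex.exp ((m : ℂ) * Complex.I * θ) := by
      intro θ; congr 1; push_cast; ring
    have e2 : ∀ θ : ℝ, Complex.exp ((((-m : ℤ) : ℝ) * θ : ℝ) * Complex.I) =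
        Complex.exp (-(m : ℂ) * Complex.I * θ) := by
      intro θ; congr 1; push_cast; ring
    simp_rw [e1, e2]
    rw [integral_exp_mul_complex hc, integral_exp_mul_complex hc']
    push_cast
    rw [Complex.cos]
    have e3 : Complex.exp ((m : ℂ) * (x - y) * Complex.I) =
        Complex.exp ((m : ℂ) * Complex.I * x) * Complex.exp (-(m : ℂ) * Complex.I * y) := by
      rw [← Complex.exp_add]; congr 1; ring
    have e4 : Complex.exp (-((m : ℂ) * (x - y)) * Complex.I) =
        Complex.exp (-(m : ℂ) * Complex.I * x) * Complex.exp ((m : ℂ) * Complex.I * y) := by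
      rw [← Complex.exp_add]; congr 1; ring
    have e5 : Complex.exp ((m : ℂ) * Complex.I * x) * Complex.exp (-(m : ℂ) * Complex.I * x) = 1 := by
      rw [← Complex.exp_add, ← Complex.exp_zero]; congr 1; ring
    have e6 : Complex.exp ((m : ℂ) * Complex.I * y) * Complex.exp (-(m : ℂ) * Complex.I * y) = 1 := by
      rw [← Complex.exp_add, ← Complex.exp_zero]; congr 1; ring
    rw [e3, e4]
    have hI : Complex.I ^ 2 = -1 := Complex.I_sq
    have hI0 : Complex.I ≠ 0 := Complex.I_ne_zero
    field_simp
    rw [hI]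
    simp only [neg_mul] at e5 e6
    linear_combination -e5 - e6

/-- The step difference is 0-1 valued, so tr C(f²) = tr C(f). The trace is absorbed into the
diagonal i = j of the double sum: there the bracket is 2πt - t² with t = x - y, and off the diagonal
periodicity of the cosine turns it into -2(1 - cos mt)/m². This combination is chosen because it is
exactly the cosine integral of the overlap function. -/
theorem arcVariance_eq_sum {N : ℕ} (hN : 0 < N) {x y : ℝ} (hxy : y ≤ x) (hxy' : x ≤ y + 2 * π) :
    4 * π ^ 2 * arcVariance N x y =
      ∑ i ∈ Finset.range N, ∑ j ∈ Finset.range N, gammaRatio i j ^ 2 *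
        (cosPrimitive ((i : ℤ) - j) (2 * π) - cosPrimitive ((i : ℤ) - j) (2 * π - (x - y))
          - cosPrimitive ((i : ℤ) - j) (x - y)) := by
  have hπ := Real.pi_pos
  set f := angularStep x - angularStep y with hf
  have hfb : BoundedMeasurable f :=
    (boundedMeasurable_angularStep x).sub (boundedMeasurable_angularStep y)
  have hff : (fun z => f z * f z) = f := by
    ext z
    have h1 : ⌊(x - z.arg) / (2 * π)⌋ ≤ ⌊(y - z.arg) / (2 * π)⌋ + 1 := by
      rw [← Int.floor_add_one]
      apply Int.floor_mono
      rw [div_add_one (by positivity)]; gcongr; linarith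
    have h2 : ⌊(y - z.arg) / (2 * π)⌋ ≤ ⌊(x - z.arg) / (2 * π)⌋ := by
      apply Int.floor_mono; gcongr
    have h3 : ⌊(x - z.arg) / (2 * π)⌋ = ⌊(y - z.arg) / (2 * π)⌋ ∨
      ⌊(x - z.arg) / (2 * π)⌋ = ⌊(y - z.arg) / (2 * π)⌋ + 1 := by omega
    simp only [hf, Pi.sub_apply, angularStep]
    rcases h3 with h3 | h3 <;> rw [h3] <;> push_cast <;> ring
  have h := ginibreCov_eq hN hfb hfb
  rw [hff] at h
  have htr : (ginibreCompression N f).trace = ((N * (x - y) / (2 * π) : ℝ) : ℂ) := by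
    simp only [Matrix.trace, Matrix.diag, hf, ginibreCompression_angularStep hN hxy hxy',
      gammaRatio_self, sub_self, Int.cast_zero, zero_mul, Complex.ofReal_zero, Complex.exp_zero]
    simp
    ring
  have hmul : (ginibreCompression N f * ginibreCompression N f).trace =
      ((∑ i : Fin N, ∑ j : Fin N, gammaRatio i j ^ 2 *
        (2 * cosPrimitive (((i : ℕ) : ℤ) - (j : ℕ)) (x - y)) / (4 * π ^ 2) : ℝ) : ℂ) := by
    simp only [Matrix.trace, Matrix.diag, Matrix.mul_apply]
    push_cast
    refine Finset.sum_congr rfl fun i _ => Finset.sum_congr rfl fun j _ => ?_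
    rw [hf, ginibreCompression_angularStep hN hxy hxy', ginibreCompression_angularStep hN hxy hxy',
      gammaRatio_comm j i]
    have h4 := integral_exp_mul_integral_exp_neg (((i : ℕ) : ℤ) - (j : ℕ)) x y
    rw [neg_sub] at h4
    rw [mul_mul_mul_comm, h4]
    push_cast
    field_simp
    ring
  rw [htr, hmul, ← Complex.ofReal_sub] at h
  have h' : arcVariance N x y = _ := Complex.ofReal_injective h
  rw [h']
  have hN1 : (N * (x - y) / (2 * π) : ℝ) = ∑ i : Fin N, ∑ j : Fin N,
      if j = i then (x - y) / (2 * π) else 0 := by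
    simp; ring
  rw [hN1, ← Finset.sum_sub_distrib, Finset.mul_sum, Finset.sum_range]
  refine Finset.sum_congr rfl fun i _ => ?_
  rw [← Finset.sum_sub_distrib, Finset.mul_sum, Finset.sum_range]
  refine Finset.sum_congr rfl fun j _ => ?_
  by_cases hij : j = i
  · subst hij
    simp only [if_true, gammaRatio_self, sub_self, cosPrimitive]
    field_simp
    ring
  · have hm : (((i : ℕ) : ℤ) - (j : ℕ)) ≠ 0 := by
      rw [sub_ne_zero]; exact_mod_cast fun h : (i : ℕ) = j => hij (Fin.ext h.symm)
    simp only [if_neg hij, cosPrimitive, if_neg hm]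
    generalize (((i : ℕ) : ℤ) - (j : ℕ)) = m at hm ⊢
    have e1 : Real.cos (m * (2 * π)) = 1 := Real.cos_int_mul_two_pi m
    have e2 : Real.cos (m * (2 * π - (x - y))) = Real.cos (m * (x - y)) := by
      rw [mul_sub, Real.cos_int_mul_two_pi_sub]
    rw [e1, e2]
    have hm' : (m : ℝ) ≠ 0 := by exact_mod_cast hm
    field_simp
    ring

/-- The angular density of the squared kernel, up to normalization. -/
noncomputable def angularKernel (N : ℕ) (t : ℝ) : ℝ :=
  ∑ i ∈ Finset.range N, ∑ j ∈ Finset.range N,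
    gammaRatio i j ^ 2 * Real.cos ((((i : ℤ) - j : ℤ) : ℝ) * t)

theorem continuous_angularKernel (N : ℕ) : Continuous (angularKernel N) := by
  unfold angularKernel
  fun_prop

/-- The overlap of an arc of length `u` with the translate by `s` of its complement. -/
noncomputable def arcOverlap (u s : ℝ) : ℝ :=
  (2 * π - s) - max (2 * π - u - s) 0 - max (u - s) 0

theorem continuous_arcOverlap (u : ℝ) : Continuous (arcOverlap u) := by
  unfold arcOverlap
  fun_prop

/-- The tent (t - s)⁺ is the kernel of double integration from 0, so pairing it with the cosine
gives the second antiderivative at t. -/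
theorem integral_max_sub_mul_cos (m : ℤ) {t T : ℝ} (ht : 0 ≤ t) (htT : t ≤ T) :
    ∫ s in (0 : ℝ)..T, max (t - s) 0 * Real.cos (m * s) = cosPrimitive m t := by
  have hc : Continuous fun s : ℝ => max (t - s) 0 * Real.cos (m * s) := by fun_prop
  rw [← intervalIntegral.integral_add_adjacent_intervals (hc.intervalIntegrable 0 t)
    (hc.intervalIntegrable t T)]
  have h1 : ∫ s in t..T, max (t - s) 0 * Real.cos (m * s) = 0 := by
    rw [intervalIntegral.integral_congr (g := fun _ => 0)]
    · simp
    · intro s hs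
      rw [uIcc_of_le htT] at hs
      simp [max_eq_right (sub_nonpos.2 hs.1)]
  have h2 : ∫ s in (0 : ℝ)..t, max (t - s) 0 * Real.cos (m * s) =
      ∫ s in (0 : ℝ)..t, (t - s) * Real.cos (m * s) := by
    refine intervalIntegral.integral_congr fun s hs => ?_
    rw [uIcc_of_le ht] at hs
    simp [max_eq_left (sub_nonneg.2 hs.2)]
  rw [h1, h2, add_zero, cosPrimitive]
  split_ifs with h
  · have := intervalIntegral.integral_eq_sub_of_hasDerivAt
      (f := fun s : ℝ => t * s - s ^ 2 / 2) (f' := fun s => (t - s) * Real.cos (m * s))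
      (a := 0) (b := t) (fun s _ => by
        have := ((hasDerivAt_id s).const_mul t).sub (((hasDerivAt_id s).pow 2).div_const 2)
        refine HasDerivAt.congr_deriv this ?_
        simp [h]) (by apply Continuous.intervalIntegrable; fun_prop)
    rw [this]; ring
  · have hm : (m : ℝ) ≠ 0 := by exact_mod_cast h
    have := intervalIntegral.integral_eq_sub_of_hasDerivAt
      (f := fun s : ℝ => (t - s) * Real.sin (m * s) / m - Real.cos (m * s) / m ^ 2)
      (f' := fun s => (t - s) * Real.cos (m * s))
      (a := 0) (b := t) (fun s _ => by
        have hl : HasDerivAt (fun s : ℝ => (m : ℝ) * s) m s := by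
          simpa using (hasDerivAt_id s).const_mul (m : ℝ)
        have := ((((hasDerivAt_id s).const_sub t).mul hl.sin).div_const (m : ℝ)).sub
          (hl.cos.div_const ((m : ℝ) ^ 2))
        refine HasDerivAt.congr_deriv this ?_
        simp only [id]
        field_simp
        ring) (by apply Continuous.intervalIntegrable; fun_prop)
    rw [this]
    simp
    field_simp
    ring

theorem arcVariance_eq_integral {N : ℕ} (hN : 0 < N) {x y : ℝ} (hxy : y ≤ x)
    (hxy' : x ≤ y + 2 * π) :
    4 * π ^ 2 * arcVariance N x y =
      ∫ s in (0 : ℝ)..(2 * π), arcOverlap (x - y) s * angularKernel N s := by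
  have hπ := Real.pi_pos
  rw [arcVariance_eq_sum hN hxy hxy']
  have h1 : ∀ s : ℝ, arcOverlap (x - y) s * angularKernel N s =
      ∑ i ∈ Finset.range N, ∑ j ∈ Finset.range N, gammaRatio i j ^ 2 *
        (arcOverlap (x - y) s * Real.cos ((((i : ℤ) - j : ℤ) : ℝ) * s)) := by
    intro s
    rw [angularKernel, Finset.mul_sum]
    refine Finset.sum_congr rfl fun i _ => ?_
    rw [Finset.mul_sum]
    refine Finset.sum_congr rfl fun j _ => ?_
    ring
  have hc := continuous_arcOverlap (x - y)
  simp_rw [h1]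
  rw [intervalIntegral.integral_finsetSum fun i _ => by
    apply Continuous.intervalIntegrable; fun_prop]
  refine Finset.sum_congr rfl fun i _ => ?_
  rw [intervalIntegral.integral_finsetSum fun j _ => by
    apply Continuous.intervalIntegrable; fun_prop]
  refine Finset.sum_congr rfl fun j _ => ?_
  rw [intervalIntegral.integral_const_mul]
  congr 1
  generalize ((i : ℤ) - j : ℤ) = m
  rw [← integral_max_sub_mul_cos m (t := 2 * π) (T := 2 * π) (by positivity) le_rfl,
    ← integral_max_sub_mul_cos m (t := 2 * π - (x - y)) (T := 2 * π) (by linarith) (by linarith),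
    ← integral_max_sub_mul_cos m (t := x - y) (T := 2 * π) (by linarith) (by linarith),
    ← intervalIntegral.integral_sub (by apply Continuous.intervalIntegrable; fun_prop)
      (by apply Continuous.intervalIntegrable; fun_prop),
    ← intervalIntegral.integral_sub (by apply Continuous.intervalIntegrable; fun_prop)
      (by apply Continuous.intervalIntegrable; fun_prop)]
  refine intervalIntegral.integral_congr fun s hs => ?_
  rw [uIcc_of_le (by positivity)] at hs
  simp only [arcOverlap, max_eq_left (sub_nonneg.2 hs.2)]
  ring

/-- This is the Gram matrix of the normalized powers of r for the weight r exp(-r²) on the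
half-line. -/
theorem posSemidef_gammaRatio (N : ℕ) :
    (Matrix.of fun i j : Fin N => (gammaRatio i j : ℂ)).PosSemidef := by
  have h := posSemidef_compression (ι := Fin N) (μ := volume.restrict (Ioi (0 : ℝ)))
    (e := fun i r => ((r ^ (i : ℕ) * (√2 / √((i : ℕ).factorial)) : ℝ) : ℂ))
    (f := fun r : ℝ => |r| * Real.exp (-((1 : ℕ) : ℝ) * r ^ 2)) (fun r => by positivity) ?_
  · convert h using 1
    ext i j
    simp only [compression, Matrix.of_apply, Complex.conj_ofReal]
    have h1 : ∀ r ∈ Ioi (0 : ℝ), ((|r| * Real.exp (-((1 : ℕ) : ℝ) * r ^ 2) : ℝ) : ℂ) *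
        (((r ^ (i : ℕ) * (√2 / √((i : ℕ).factorial)) : ℝ) : ℂ) *
          ((r ^ (j : ℕ) * (√2 / √((j : ℕ).factorial)) : ℝ) : ℂ)) =
        ((2 / (√((i : ℕ).factorial) * √((j : ℕ).factorial)) *
          (r ^ ((i : ℕ) + j + 1) * Real.exp (-((1 : ℕ) : ℝ) * r ^ 2)) : ℝ) : ℂ) := by
      intro r hr
      rw [abs_of_pos hr]
      have h2 : √2 * √2 = (2 : ℝ) := Real.mul_self_sqrt (by norm_num)
      norm_cast
      have hi : √((i : ℕ).factorial : ℝ) ≠ 0 := by positivity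
      have hj : √((j : ℕ).factorial : ℝ) ≠ 0 := by positivity
      field_simp
      rw [sq, h2]
      ring
    rw [setIntegral_congr_fun measurableSet_Ioi h1, integral_complex_ofReal, integral_const_mul,
      integral_pow_mul_exp_neg_mul_sq one_pos, gammaRatio]
    simp only [Nat.cast_one, Real.one_rpow]
    congr 1
    push_cast
    field_simp
  · intro i j
    have h2 := integrableOn_rpow_mul_exp_neg_mul_rpow (p := 2) (s := ((i + j : ℕ) : ℝ) + 1) (b := 1)
      (by have : (0 : ℝ) ≤ ((i + j : ℕ) : ℝ) := Nat.cast_nonneg _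
          linarith) two_pos one_pos
    have h3 := (h2.ofReal (𝕜 := ℂ)).const_mul
      (((√2 / √((i : ℕ).factorial)) * (√2 / √((j : ℕ).factorial)) : ℝ) : ℂ)
    refine h3.congr ((ae_restrict_iff' measurableSet_Ioi).2 (ae_of_all _ fun r hr => ?_))
    have hr' : (0 : ℝ) < r := hr
    simp only [Complex.conj_ofReal, Nat.cast_one]
    rw [Real.rpow_add_one hr'.ne', Real.rpow_natCast, Real.rpow_two, abs_of_pos hr']
    rw [← Complex.ofReal_mul, ← Complex.ofReal_mul]
    change Complex.ofReal _ * Complex.ofReal (r ^ ((i : ℕ) + j) * r * Real.exp (-1 * r ^ 2)) = _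
    rw [← Complex.ofReal_mul]
    congr 1
    ring

/-- By the Schur product theorem the entrywise square of the Gram matrix is positive semidefinite,
and the kernel is its quadratic form at a vector of phases. Positivity lets pointwise bounds on test
functions be integrated against the kernel. -/
theorem angularKernel_nonneg (N : ℕ) (t : ℝ) : 0 ≤ angularKernel N t := by
  have h := ((posSemidef_gammaRatio N).hadamard
    (posSemidef_gammaRatio N)).dotProduct_mulVec_nonneg
      (fun j => Complex.exp ((-((j : ℕ) : ℝ) * t : ℝ) * Complex.I))
  rw [Complex.le_def, Complex.zero_re] at h
  convert h.1 using 1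
  simp only [angularKernel, dotProduct, Matrix.mulVec, Matrix.hadamard_apply, Matrix.of_apply,
    Finset.mul_sum, Complex.re_sum, Finset.sum_range]
  refine Finset.sum_congr rfl fun i _ => Finset.sum_congr rfl fun j _ => ?_
  have h3 : star (Complex.exp ((-((i : ℕ) : ℝ) * t : ℝ) * Complex.I)) =
      Complex.exp ((((i : ℕ) : ℝ) * t : ℝ) * Complex.I) := by
    rw [Complex.star_def, ← Complex.exp_conj]
    congr 1
    simp
  have h4 : Complex.exp ((((i : ℕ) : ℝ) * t : ℝ) * Complex.I) *
      ((gammaRatio i j : ℂ) * (gammaRatio i j : ℂ) *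
        Complex.exp ((-((j : ℕ) : ℝ) * t : ℝ) * Complex.I)) =
      ((gammaRatio i j ^ 2 : ℝ) : ℂ) *
        Complex.exp ((((((i : ℕ) : ℤ) - ((j : ℕ) : ℤ) : ℤ) : ℝ) * t : ℝ) * Complex.I) := by
    rw [show ((((((i : ℕ) : ℤ) - ((j : ℕ) : ℤ) : ℤ) : ℝ) * t : ℝ) : ℂ) * Complex.I =
      (((i : ℕ) : ℝ) * t : ℝ) * Complex.I + (-((j : ℕ) : ℝ) * t : ℝ) * Complex.I by
        push_cast; ring, Complex.exp_add]
    push_cast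
    ring
  simp only [Pi.star_apply]
  rw [h3, h4, Complex.re_ofReal_mul, Complex.exp_ofReal_mul_I_re]

end AngularKernel

/-! ### Central binomial asymptotics and near-diagonal Gamma ratios. -/

section CentralBinomial

/-- The ratio `4 ^ n / centralBinom n`, asymptotically `√(π n)`. -/
noncomputable def wallisRatio (n : ℕ) : ℝ := 4 ^ n / n.centralBinom

theorem wallisRatio_pos (n : ℕ) : 0 < wallisRatio n := by
  have := n.centralBinom_pos
  unfold wallisRatio; positivity

theorem wallisRatio_zero : wallisRatio 0 = 1 := by simp [wallisRatio]

theorem wallisRatio_succ (n : ℕ) :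
    wallisRatio (n + 1) = wallisRatio n * ((2 * n + 2) / (2 * n + 1)) := by
  have h : ((n + 1 : ℕ) : ℝ) * (n + 1).centralBinom = 2 * (2 * n + 1) * n.centralBinom := by
    exact_mod_cast Nat.succ_mul_centralBinom_succ n
  have h1 : (0 : ℝ) < n.centralBinom := by exact_mod_cast n.centralBinom_pos
  have h2 : (0 : ℝ) < (n + 1).centralBinom := by exact_mod_cast (n + 1).centralBinom_pos
  unfold wallisRatio
  push_cast at h
  field_simp
  rw [pow_succ]
  linear_combination (-2 * (4 : ℝ) ^ n) * h

theorem wallisRatio_succ_sub (n : ℕ) :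
    wallisRatio (n + 1) - wallisRatio n = wallisRatio n / (2 * n + 1) := by
  rw [wallisRatio_succ]; field_simp; ring

/-- The link with the Wallis product supplies two-sided bounds of order πn with explicit constants.
-/
theorem wallisRatio_sq (n : ℕ) : wallisRatio n ^ 2 = Real.Wallis.W n * (2 * n + 1) := by
  induction n with
  | zero => simp [wallisRatio_zero, Real.Wallis.W]
  | succ n ih =>
    rw [wallisRatio_succ, Real.Wallis.W_succ, mul_pow, ih]
    push_cast
    field_simp
    ring

theorem wallisRatio_sq_le (n : ℕ) : wallisRatio n ^ 2 ≤ π * (n + 1 / 2) := by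
  rw [wallisRatio_sq]
  have := mul_le_mul_of_nonneg_right (Real.Wallis.W_le n) (by positivity : (0 : ℝ) ≤ 2 * n + 1)
  linarith

theorem le_wallisRatio_sq (n : ℕ) : π * n ≤ wallisRatio n ^ 2 := by
  rw [wallisRatio_sq]
  refine le_trans ?_ (mul_le_mul_of_nonneg_right (Real.Wallis.le_W n)
    (by positivity : (0 : ℝ) ≤ 2 * n + 1))
  have hπ := Real.pi_pos
  rw [div_mul_div_comm, div_mul_eq_mul_div, le_div_iff₀ (by positivity)]
  nlinarith

theorem Gamma_add_half_mul_wallisRatio (n : ℕ) :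
    Real.Gamma (n + 1 / 2) * wallisRatio n = √π * n.factorial := by
  induction n with
  | zero =>
    have := Real.Gamma_one_half_eq
    simpa [wallisRatio_zero] using this
  | succ n ih =>
    have e : ((n + 1 : ℕ) : ℝ) + 1 / 2 = (n + 1 / 2) + 1 := by push_cast; ring
    rw [e, Real.Gamma_add_one (by positivity), wallisRatio_succ, Nat.factorial_succ]
    push_cast
    rw [show ((n : ℝ) + 1 / 2) * Real.Gamma (n + 1 / 2) *
      (wallisRatio n * ((2 * n + 2) / (2 * n + 1))) = (Real.Gamma (n + 1 / 2) * wallisRatio n) *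
        (((n : ℝ) + 1 / 2) * ((2 * n + 2) / (2 * n + 1))) by ring, ih]
    field_simp

theorem gammaRatio_sq (i j : ℕ) :
    gammaRatio i j ^ 2 = Real.Gamma (((i : ℝ) + j) / 2 + 1) ^ 2 / (i.factorial * j.factorial) := by
  rw [gammaRatio, div_pow, mul_pow, Real.sq_sqrt (by positivity), Real.sq_sqrt (by positivity)]

theorem gammaRatio_succ_sq (i : ℕ) :
    gammaRatio (i + 1) i ^ 2 = π * (i + 1) / wallisRatio (i + 1) ^ 2 := by
  have h := Gamma_add_half_mul_wallisRatio (i + 1)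
  have hw := wallisRatio_pos (i + 1)
  rw [gammaRatio_sq]
  have e : (((i + 1 : ℕ) : ℝ) + i) / 2 + 1 = ((i + 1 : ℕ) : ℝ) + 1 / 2 := by push_cast; ring
  rw [e, eq_div_of_mul_eq hw.ne' h, div_pow, mul_pow, Real.sq_sqrt Real.pi_pos.le,
    Nat.factorial_succ]
  push_cast
  have : (i.factorial : ℝ) ≠ 0 := by positivity
  field_simp

theorem gammaRatio_succ_sq_le_one (i : ℕ) : gammaRatio (i + 1) i ^ 2 ≤ 1 := by
  rw [gammaRatio_succ_sq, div_le_one (by have := wallisRatio_pos (i + 1); positivity)]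
  exact_mod_cast le_wallisRatio_sq (i + 1)

/-- Adding 1/(4(k+1)) to the squared ratio gives a sequence that is decreasing and tends to a limit
at least 1, hence is at least 1 throughout. The sharp constant 1/4 matters: it makes the harmonic
sums cancel in the second moment below. -/
theorem le_gammaRatio_succ_sq (i : ℕ) : 1 - 1 / (4 * ((i : ℝ) + 1)) ≤ gammaRatio (i + 1) i ^ 2 := by
  set u : ℕ → ℝ := fun k => gammaRatio (k + 1) k ^ 2 + 1 / (4 * ((k : ℝ) + 1)) with hu
  have hanti : Antitone u := by
    refine antitone_nat_of_succ_le fun k => ?_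
    have h1 := gammaRatio_succ_sq_le_one k
    have hw := wallisRatio_pos (k + 1)
    -- Since the squared ratio is at most 1, its increment is at most 1/(4(k+1)(k+2)), which is
    -- exactly the drop of the added term.
    have h2 : gammaRatio (k + 1 + 1) (k + 1) ^ 2 =
        gammaRatio (k + 1) k ^ 2 * (1 + 1 / (4 * ((k : ℝ) + 1) * (k + 2))) := by
      rw [gammaRatio_succ_sq, gammaRatio_succ_sq, wallisRatio_succ (k + 1)]
      push_cast
      field_simp
      ring
    simp only [hu]
    rw [h2]
    have h3 : (1 : ℝ) / (4 * ((k : ℝ) + 1)) - 1 / (4 * (((k + 1 : ℕ) : ℝ) + 1)) =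
        1 / (4 * ((k : ℝ) + 1) * (k + 2)) := by
      push_cast; field_simp; ring
    have h4 : (0 : ℝ) ≤ 1 / (4 * ((k : ℝ) + 1) * (k + 2)) := by positivity
    nlinarith
  have hlow : ∀ k : ℕ, 1 - 1 / ((k : ℝ) + 1) ≤ u k := by
    intro k
    have hw := wallisRatio_pos (k + 1)
    have h1 := wallisRatio_sq_le (k + 1)
    have h2 : 1 - 1 / ((k : ℝ) + 1) ≤ gammaRatio (k + 1) k ^ 2 := by
      rw [gammaRatio_succ_sq, le_div_iff₀ (by positivity)]
      have h3 : (0 : ℝ) ≤ 1 - 1 / ((k : ℝ) + 1) := by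
        rw [sub_nonneg, div_le_one (by positivity)]; linarith [(Nat.cast_nonneg k : (0 : ℝ) ≤ k)]
      refine (mul_le_mul_of_nonneg_left h1 h3).trans ?_
      have hπ := Real.pi_pos
      have h5 : (1 - 1 / ((k : ℝ) + 1)) = k / (k + 1) := by field_simp; ring
      rw [h5, div_mul_eq_mul_div, div_le_iff₀ (by positivity)]
      push_cast
      nlinarith
    have h4 : (0 : ℝ) ≤ 1 / (4 * ((k : ℝ) + 1)) := by positivity
    simp only [hu]
    linarith
  have hlim : Tendsto (fun k : ℕ => 1 - 1 / ((k : ℝ) + 1)) atTop (nhds 1) := by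
    simpa using tendsto_const_nhds.sub (tendsto_one_div_add_atTop_nhds_zero_nat (𝕜 := ℝ))
  have h1 : 1 ≤ u i := by
    refine le_of_tendsto hlim ?_
    filter_upwards [eventually_ge_atTop i] with k hk
    exact (hlow k).trans (hanti hk)
  simp only [hu] at h1
  linarith

theorem gammaRatio_add_two_sq (i : ℕ) : gammaRatio (i + 2) i ^ 2 = 1 - 1 / ((i : ℝ) + 2) := by
  rw [gammaRatio_sq]
  have e : (((i + 2 : ℕ) : ℝ) + i) / 2 + 1 = ((i + 1 : ℕ) : ℝ) + 1 := by push_cast; ring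
  rw [e, Real.Gamma_nat_eq_factorial, Nat.factorial_succ, Nat.factorial_succ (i + 1),
    Nat.factorial_succ]
  push_cast
  have : (i.factorial : ℝ) ≠ 0 := by positivity
  field_simp
  ring

/-- When i + j is even the Gamma value is a factorial, so the weights along an antidiagonal are
binomial coefficients; this makes the |sin| integral computable. -/
theorem gammaRatio_sq_of_add_eq {n i j : ℕ} (h : i + j = 2 * n) :
    gammaRatio i j ^ 2 = (2 * n).choose i / n.centralBinom := by
  rw [gammaRatio_sq]
  have e : ((i : ℝ) + j) / 2 + 1 = (n : ℕ) + 1 := by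
    have : (i : ℝ) + j = 2 * n := by exact_mod_cast h
    rw [this]; ring
  have hj : j = 2 * n - i := by omega
  rw [e, Real.Gamma_nat_eq_factorial, Nat.centralBinom, Nat.cast_choose ℝ (by omega : i ≤ 2 * n),
    Nat.cast_choose ℝ (by omega : n ≤ 2 * n), ← hj, show 2 * n - n = n by omega]
  have h1 : (i.factorial : ℝ) ≠ 0 := by positivity
  have h2 : (j.factorial : ℝ) ≠ 0 := by positivity
  have h3 : (n.factorial : ℝ) ≠ 0 := by positivity
  have h4 : ((2 * n).factorial : ℝ) ≠ 0 := by positivity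
  field_simp

theorem sum_inv_le_one_add_log (n : ℕ) :
    ∑ i ∈ Finset.range n, 1 / ((i : ℝ) + 1) ≤ 1 + Real.log n := by
  refine le_trans (le_of_eq ?_) (harmonic_le_one_add_log n)
  rw [harmonic]
  push_cast
  simp [one_div]

end CentralBinomial

/-! ### Moments of the angular kernel. -/

section Moments

theorem integral_cos_int_mul (m : ℤ) :
    ∫ s in (0 : ℝ)..(2 * π), Real.cos (m * s) = if m = 0 then 2 * π else 0 := by
  split_ifs with h
  · simp [h]
  · have hm : (m : ℝ) ≠ 0 := by exact_mod_cast h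
    rw [intervalIntegral.integral_comp_mul_left (fun s => Real.cos s) hm, integral_cos]
    have := Real.sin_int_mul_pi (m * 2)
    push_cast at this
    rw [show (m : ℝ) * (2 * π) = m * 2 * π by ring, this]
    simp

theorem integral_cos_mul_cos (a b : ℤ) :
    ∫ s in (0 : ℝ)..(2 * π), Real.cos (b * s) * Real.cos (a * s) =
      (if a = b then π else 0) + (if a = -b then π else 0) := by
  have h : ∀ s : ℝ, Real.cos (b * s) * Real.cos (a * s) =
      (Real.cos (((a - b : ℤ) : ℝ) * s) + Real.cos (((a + b : ℤ) : ℝ) * s)) / 2 := by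
    intro s
    push_cast
    rw [sub_mul, add_mul, Real.cos_sub, Real.cos_add]
    ring
  simp_rw [h]
  rw [intervalIntegral.integral_div, intervalIntegral.integral_add
    (by apply Continuous.intervalIntegrable; fun_prop)
    (by apply Continuous.intervalIntegrable; fun_prop), integral_cos_int_mul, integral_cos_int_mul]
  simp only [sub_eq_zero, add_eq_zero_iff_eq_neg]
  split_ifs <;> ring

theorem integral_mul_angularKernel (N : ℕ) {φ : ℝ → ℝ} (hφ : Continuous φ) :
    ∫ s in (0 : ℝ)..(2 * π), φ s * angularKernel N s =
      ∑ i ∈ Finset.range N, ∑ j ∈ Finset.range N, gammaRatio i j ^ 2 *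
        ∫ s in (0 : ℝ)..(2 * π), φ s * Real.cos ((((i : ℤ) - j : ℤ) : ℝ) * s) := by
  have h1 : ∀ s : ℝ, φ s * angularKernel N s =
      ∑ i ∈ Finset.range N, ∑ j ∈ Finset.range N, gammaRatio i j ^ 2 *
        (φ s * Real.cos ((((i : ℤ) - j : ℤ) : ℝ) * s)) := by
    intro s
    rw [angularKernel, Finset.mul_sum]
    refine Finset.sum_congr rfl fun i _ => ?_
    rw [Finset.mul_sum]
    refine Finset.sum_congr rfl fun j _ => ?_
    ring
  simp_rw [h1]
  rw [intervalIntegral.integral_finsetSum fun i _ => by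
    apply Continuous.intervalIntegrable; fun_prop]
  refine Finset.sum_congr rfl fun i _ => ?_
  rw [intervalIntegral.integral_finsetSum fun j _ => by
    apply Continuous.intervalIntegrable; fun_prop]
  refine Finset.sum_congr rfl fun j _ => ?_
  rw [intervalIntegral.integral_const_mul]

theorem sum_range_sum_range_eq_add (N b : ℕ) (F : ℕ → ℕ → ℝ) :
    ∑ i ∈ Finset.range N, ∑ j ∈ Finset.range N, (if i = j + b then F i j else 0) =
      ∑ j ∈ Finset.range (N - b), F (j + b) j := by
  rw [Finset.sum_comm]
  have h : ∀ j ∈ Finset.range N, ∑ i ∈ Finset.range N, (if i = j + b then F i j else 0) =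
      if j + b < N then F (j + b) j else 0 := by
    intro j _
    rw [Finset.sum_ite_eq' ]
    simp
  rw [Finset.sum_congr rfl h, ← Finset.sum_filter]
  refine Finset.sum_congr ?_ fun _ _ => rfl
  ext j
  simp only [Finset.mem_filter, Finset.mem_range]
  omega

/-- Orthogonality keeps the two diagonals i - j = b and i - j = -b, with π each; for b = 0 they
coincide and both deltas fire, so the factor 2π persists. -/
theorem integral_cos_mul_angularKernel (N b : ℕ) :
    ∫ s in (0 : ℝ)..(2 * π), Real.cos (b * s) * angularKernel N s =
      2 * π * ∑ j ∈ Finset.range (N - b), gammaRatio (j + b) j ^ 2 := by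
  rw [integral_mul_angularKernel N (by fun_prop)]
  have h : ∀ i j : ℕ, gammaRatio i j ^ 2 *
      ∫ s in (0 : ℝ)..(2 * π), Real.cos (b * s) * Real.cos ((((i : ℤ) - j : ℤ) : ℝ) * s) =
      (if i = j + b then π * gammaRatio i j ^ 2 else 0) +
        (if j = i + b then π * gammaRatio j i ^ 2 else 0) := by
    intro i j
    have := integral_cos_mul_cos ((i : ℤ) - j) b
    push_cast at this ⊢
    rw [this, gammaRatio_comm j i]
    have e1 : ((i : ℤ) - j = b) ↔ i = j + b := by omega
    have e2 : ((i : ℤ) - j = -b) ↔ j = i + b := by omega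
    simp only [e1, e2]
    split_ifs <;> ring
  simp_rw [h, Finset.sum_add_distrib]
  rw [Finset.sum_comm (f := fun i j => if j = i + b then π * gammaRatio j i ^ 2 else 0),
    sum_range_sum_range_eq_add N b fun i j => π * gammaRatio i j ^ 2, ← Finset.mul_sum]
  ring

/-- The moment is 2π times N minus the sum of neighbouring squared ratios, whose deficits from 1 add
up to a harmonic sum. -/
theorem integral_one_sub_cos_mul_angularKernel_le {N : ℕ} (hN : 0 < N) :
    ∫ s in (0 : ℝ)..(2 * π), (1 - Real.cos s) * angularKernel N s ≤
      2 * π * (2 + Real.log N) := by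
  have hc := continuous_angularKernel N
  have h0 := integral_cos_mul_angularKernel N 0
  have h1 := integral_cos_mul_angularKernel N 1
  simp only [Nat.cast_zero, zero_mul, Real.cos_zero, one_mul, add_zero, gammaRatio_self, one_pow,
    Finset.sum_const, Finset.card_range, Nat.sub_zero, nsmul_eq_mul, mul_one, Nat.cast_one] at h0 h1
  have h2 : ∫ s in (0 : ℝ)..(2 * π), (1 - Real.cos s) * angularKernel N s =
      (∫ s in (0 : ℝ)..(2 * π), angularKernel N s) -
        ∫ s in (0 : ℝ)..(2 * π), Real.cos s * angularKernel N s := by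
    rw [← intervalIntegral.integral_sub (hc.intervalIntegrable _ _)
      (by apply Continuous.intervalIntegrable; fun_prop)]
    congr 1; ext s; ring
  rw [h2, h0, h1, ← mul_sub]
  have h3 : ((N - 1 : ℕ) : ℝ) - ∑ i ∈ Finset.range (N - 1), 1 / ((i : ℝ) + 1) ≤
      ∑ j ∈ Finset.range (N - 1), gammaRatio (j + 1) j ^ 2 := by
    have : ((N - 1 : ℕ) : ℝ) = ∑ i ∈ Finset.range (N - 1), (1 : ℝ) := by simp
    rw [this, ← Finset.sum_sub_distrib]
    refine Finset.sum_le_sum fun i _ => (sub_le_sub_left ?_ _).trans (le_gammaRatio_succ_sq i)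
    gcongr
    linarith [(Nat.cast_nonneg i : (0 : ℝ) ≤ i)]
  have h4 := sum_inv_le_one_add_log (N - 1)
  have h5 : Real.log ((N - 1 : ℕ) : ℝ) ≤ Real.log N := by
    rcases Nat.eq_zero_or_pos (N - 1) with h | h
    · rw [h]; simp [Real.log_natCast_nonneg]
    · exact Real.log_le_log (by exact_mod_cast h) (by exact_mod_cast Nat.sub_le N 1)
  rw [Nat.cast_pred hN] at h3
  have hπ := Real.pi_pos
  refine mul_le_mul_of_nonneg_left ?_ (by positivity)
  linarith

/-- In 3/2 - 2cos s + (1/2)cos 2s the linear terms in N cancel. The deficits 1/(4(i+1)) at frequency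
1 and 1/(i+2) at frequency 2 also cancel, up to one term of the harmonic sum, so no logarithm is
left. This is what gives O(1/√N) for arcs without common endpoints. -/
theorem integral_one_sub_cos_sq_mul_angularKernel_le {N : ℕ} (hN : 0 < N) :
    ∫ s in (0 : ℝ)..(2 * π), (1 - Real.cos s) ^ 2 * angularKernel N s ≤ 4 * π := by
  have hc := continuous_angularKernel N
  have h0 := integral_cos_mul_angularKernel N 0
  have h1 := integral_cos_mul_angularKernel N 1
  have h2 := integral_cos_mul_angularKernel N 2
  simp only [Nat.cast_zero, zero_mul, Real.cos_zero, one_mul, add_zero, gammaRatio_self, one_pow,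
    Finset.sum_const, Finset.card_range, Nat.sub_zero, nsmul_eq_mul, mul_one, Nat.cast_one,
    Nat.cast_ofNat] at h0 h1 h2
  have h3 : ∫ s in (0 : ℝ)..(2 * π), (1 - Real.cos s) ^ 2 * angularKernel N s =
      3 / 2 * (∫ s in (0 : ℝ)..(2 * π), angularKernel N s) -
        2 * (∫ s in (0 : ℝ)..(2 * π), Real.cos s * angularKernel N s) +
        1 / 2 * ∫ s in (0 : ℝ)..(2 * π), Real.cos (2 * s) * angularKernel N s := by
    rw [← intervalIntegral.integral_const_mul, ← intervalIntegral.integral_const_mul,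
      ← intervalIntegral.integral_const_mul, ← intervalIntegral.integral_sub
      (by apply Continuous.intervalIntegrable; fun_prop)
      (by apply Continuous.intervalIntegrable; fun_prop), ← intervalIntegral.integral_add
      (by apply Continuous.intervalIntegrable; fun_prop)
      (by apply Continuous.intervalIntegrable; fun_prop)]
    congr 1; ext s
    rw [Real.cos_two_mul]; ring
  rw [h3, h0, h1, h2]
  have hπ := Real.pi_pos
  rcases Nat.lt_or_ge N 2 with hlt | hge
  · have : N = 1 := by omega
    subst this
    simp
    linarith
  obtain ⟨M, rfl⟩ := Nat.exists_eq_add_of_le' hge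
  rw [show M + 2 - 1 = M + 1 by omega, show M + 2 - 2 = M by omega]
  have h4 : ((M : ℝ) + 1) - 1 / 4 * (∑ i ∈ Finset.range M, 1 / ((i : ℝ) + 2) + 1) ≤
      ∑ j ∈ Finset.range (M + 1), gammaRatio (j + 1) j ^ 2 := by
    have e1 : ((M : ℝ) + 1) = ∑ i ∈ Finset.range (M + 1), (1 : ℝ) := by simp
    have e2 : ∑ i ∈ Finset.range M, 1 / ((i : ℝ) + 2) + 1 =
        ∑ i ∈ Finset.range (M + 1), 1 / ((i : ℝ) + 1) := by
      rw [Finset.sum_range_succ']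
      norm_num [add_assoc]
    rw [e1, e2, Finset.mul_sum, ← Finset.sum_sub_distrib]
    refine Finset.sum_le_sum fun i _ => le_trans (le_of_eq ?_) (le_gammaRatio_succ_sq i)
    field_simp
  have h5 : ∑ j ∈ Finset.range M, gammaRatio (j + 2) j ^ 2 =
      M - ∑ i ∈ Finset.range M, 1 / ((i : ℝ) + 2) := by
    simp_rw [gammaRatio_add_two_sq, Finset.sum_sub_distrib]
    simp
  rw [h5]
  push_cast
  nlinarith

end Moments

/-! ### The integral of |sin| against the angular kernel. -/

section AbsSin

/-- The Fourier coefficients of `|sin|`. -/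
noncomputable def absSinCoeff (m : ℤ) : ℝ := if Even m then 4 / (1 - (m : ℝ) ^ 2) else 0

theorem one_sub_intCast_sq_ne_zero {m : ℤ} (hm : Even m) : 1 - (m : ℝ) ^ 2 ≠ 0 := by
  intro h
  have h1 : (m : ℤ) ^ 2 = 1 := by
    have : (m : ℝ) ^ 2 = 1 := by linarith
    exact_mod_cast this
  obtain ⟨k, rfl⟩ := hm
  have h2 : 4 * (k ^ 2) = 1 := by linear_combination h1
  omega

theorem integral_sin_mul_cos_even {m : ℤ} (hm : Even m) :
    ∫ s in (0 : ℝ)..π, Real.sin s * Real.cos (m * s) = 2 / (1 - (m : ℝ) ^ 2) := by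
  have h0 := one_sub_intCast_sq_ne_zero hm
  have := intervalIntegral.integral_eq_sub_of_hasDerivAt
      (f := fun s : ℝ => -(Real.cos s * Real.cos (m * s) + m * (Real.sin s * Real.sin (m * s))) /
        (1 - (m : ℝ) ^ 2))
      (f' := fun s => Real.sin s * Real.cos (m * s))
      (a := 0) (b := π) (fun s _ => by
        have hl : HasDerivAt (fun s : ℝ => (m : ℝ) * s) m s := by
          simpa using (hasDerivAt_id s).const_mul (m : ℝ)
        have := ((((Real.hasDerivAt_cos s).mul hl.cos).add
          (((Real.hasDerivAt_sin s).mul hl.sin).const_mul (m : ℝ))).neg).div_const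
            (1 - (m : ℝ) ^ 2)
        refine HasDerivAt.congr_deriv this ?_
        field_simp
        ring) (by apply Continuous.intervalIntegrable; fun_prop)
  rw [this]
  obtain ⟨k, rfl⟩ := hm
  have e : Real.cos (((k + k : ℤ) : ℝ) * π) = 1 := by
    have := Real.cos_int_mul_two_pi k
    push_cast
    rw [← this]; congr 1; ring
  rw [e]
  simp
  field_simp
  norm_num

theorem integral_abs_sin_mul {φ : ℝ → ℝ} (hφ : Continuous φ) :
    ∫ s in (0 : ℝ)..(2 * π), |Real.sin s| * φ s =
      (∫ s in (0 : ℝ)..π, Real.sin s * φ s) + ∫ s in (0 : ℝ)..π, Real.sin s * φ (s + π) := by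
  have hπ := Real.pi_pos
  rw [← intervalIntegral.integral_add_adjacent_intervals (b := π)
    (by apply Continuous.intervalIntegrable; fun_prop)
    (by apply Continuous.intervalIntegrable; fun_prop)]
  congr 1
  · refine intervalIntegral.integral_congr fun s hs => ?_
    rw [uIcc_of_le hπ.le] at hs
    simp only [abs_of_nonneg (Real.sin_nonneg_of_mem_Icc hs)]
  · have h := intervalIntegral.integral_comp_add_right (a := 0) (b := π)
      (fun s => |Real.sin s| * φ s) π
    rw [zero_add, ← two_mul] at h
    rw [← h]
    refine intervalIntegral.integral_congr fun s hs => ?_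
    rw [uIcc_of_le hπ.le] at hs
    simp only [Real.sin_add_pi, abs_neg, abs_of_nonneg (Real.sin_nonneg_of_mem_Icc hs)]

theorem integral_abs_sin_mul_cos (m : ℤ) :
    ∫ s in (0 : ℝ)..(2 * π), |Real.sin s| * Real.cos (m * s) = absSinCoeff m := by
  rw [integral_abs_sin_mul (by fun_prop)]
  have h : ∀ s : ℝ, Real.cos (m * (s + π)) = (-1) ^ m * Real.cos (m * s) := by
    intro s
    rw [mul_add, Real.cos_add, Real.sin_int_mul_pi, Real.cos_int_mul_pi]
    ring
  simp_rw [h, mul_left_comm (Real.sin _)]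
  rw [intervalIntegral.integral_const_mul, absSinCoeff]
  split_ifs with hm
  · rw [hm.neg_one_zpow, integral_sin_mul_cos_even hm]
    ring
  · rw [(Int.not_even_iff_odd.1 hm).neg_one_zpow]
    ring

theorem two_mul_cos_pow (n : ℕ) (s : ℝ) :
    (2 * Real.cos s) ^ (2 * n) = ∑ i ∈ Finset.range (2 * n + 1),
      ((2 * n).choose i : ℝ) * Real.cos (((i : ℤ) - ((2 * n - i : ℕ) : ℤ) : ℤ) * s) := by
  have h1 : ((2 * Real.cos s : ℝ) : ℂ) =
      Complex.exp (s * Complex.I) + Complex.exp (-s * Complex.I) := by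
    push_cast
    rw [Complex.cos]; ring
  have h2 : (((2 * Real.cos s) ^ (2 * n) : ℝ) : ℂ) = ∑ i ∈ Finset.range (2 * n + 1),
      (((2 * n).choose i : ℝ) : ℂ) *
        Complex.exp (((((i : ℤ) - ((2 * n - i : ℕ) : ℤ) : ℤ) * s : ℝ) : ℂ) * Complex.I) := by
    rw [Complex.ofReal_pow, h1, add_pow]
    refine Finset.sum_congr rfl fun i hi => ?_
    rw [← Complex.exp_nat_mul, ← Complex.exp_nat_mul, ← Complex.exp_add, mul_comm]
    congr 1
    push_cast; ring_nf
  have h3 := congrArg Complex.re h2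
  rw [Complex.ofReal_re, Complex.re_sum] at h3
  rw [h3]
  refine Finset.sum_congr rfl fun i _ => ?_
  rw [Complex.re_ofReal_mul, Complex.exp_ofReal_mul_I_re]

theorem integral_sin_mul_two_cos_pow (n : ℕ) :
    ∫ s in (0 : ℝ)..π, Real.sin s * (2 * Real.cos s) ^ (2 * n) = 2 * 4 ^ n / (2 * n + 1) := by
  have := intervalIntegral.integral_eq_sub_of_hasDerivAt
      (f := fun s : ℝ => -(4 ^ n / (2 * n + 1) * Real.cos s ^ (2 * n + 1)))
      (f' := fun s => Real.sin s * (2 * Real.cos s) ^ (2 * n))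
      (a := 0) (b := π) (fun s _ => by
        have := ((((Real.hasDerivAt_cos s).pow (2 * n + 1))).const_mul
          ((4 : ℝ) ^ n / (2 * n + 1))).neg
        refine HasDerivAt.congr_deriv this ?_
        rw [mul_pow, pow_mul (2 : ℝ)]
        push_cast
        field_simp
        norm_num
        ring) (by apply Continuous.intervalIntegrable; fun_prop)
  rw [this, Real.cos_pi, Real.cos_zero, Odd.neg_one_pow ⟨n, rfl⟩]
  ring

/-- By the binomial expansion of (2cos s)^(2n) the sum is the integral of |sin s|(2cos s)^(2n),
which has an elementary primitive on each half period. -/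
theorem sum_choose_mul_absSinCoeff (n : ℕ) :
    ∑ i ∈ Finset.range (2 * n + 1), ((2 * n).choose i : ℝ) *
      absSinCoeff ((i : ℤ) - ((2 * n - i : ℕ) : ℤ)) = 4 * 4 ^ n / (2 * n + 1) := by
  simp_rw [← integral_abs_sin_mul_cos, ← intervalIntegral.integral_const_mul]
  rw [← intervalIntegral.integral_finsetSum fun i _ => by
    apply Continuous.intervalIntegrable; fun_prop]
  have h : ∀ s : ℝ, ∑ i ∈ Finset.range (2 * n + 1), ((2 * n).choose i : ℝ) *
      (|Real.sin s| * Real.cos (((i : ℤ) - ((2 * n - i : ℕ) : ℤ) : ℤ) * s)) =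
      |Real.sin s| * (2 * Real.cos s) ^ (2 * n) := by
    intro s
    rw [two_mul_cos_pow, Finset.mul_sum]
    exact Finset.sum_congr rfl fun i _ => by ring
  simp_rw [h]
  rw [integral_abs_sin_mul (by fun_prop), integral_sin_mul_two_cos_pow]
  have h2 : ∀ s : ℝ, Real.sin s * (2 * Real.cos (s + π)) ^ (2 * n) =
      Real.sin s * (2 * Real.cos s) ^ (2 * n) := by
    intro s
    rw [Real.cos_add_pi, mul_neg, Even.neg_pow ⟨n, two_mul n⟩]
  simp_rw [h2]
  rw [integral_sin_mul_two_cos_pow]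
  ring

/-- The quotient 4·4^n / ((2n+1) · central binomial coefficient) is four times an increment of
`wallisRatio`, so summing over n telescopes. -/
theorem sum_antidiagonal_absSinCoeff (n : ℕ) :
    ∑ p ∈ Finset.HasAntidiagonal.antidiagonal (2 * n), gammaRatio p.1 p.2 ^ 2 *
      absSinCoeff ((p.1 : ℤ) - p.2) = 4 * (wallisRatio (n + 1) - wallisRatio n) := by
  rw [Finset.Nat.sum_antidiagonal_eq_sum_range_succ_mk]
  have h : ∀ i ∈ Finset.range (2 * n).succ, gammaRatio i (2 * n - i) ^ 2 *
      absSinCoeff ((i : ℤ) - ((2 * n - i : ℕ) : ℤ)) = (((2 * n).choose i : ℝ) *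
      absSinCoeff ((i : ℤ) - ((2 * n - i : ℕ) : ℤ))) / n.centralBinom := by
    intro i hi
    rw [Finset.mem_range] at hi
    rw [gammaRatio_sq_of_add_eq (n := n) (by omega)]
    ring
  rw [Finset.sum_congr rfl h, ← Finset.sum_div, sum_choose_mul_absSinCoeff, wallisRatio_succ_sub,
    wallisRatio]
  have : (0 : ℝ) < n.centralBinom := by exact_mod_cast n.centralBinom_pos
  field_simp

theorem sum_square_eq_sum_antidiagonal (N : ℕ) (F : ℕ → ℕ → ℝ)
    (hF : ∀ i j, ¬ Even (i + j) → F i j = 0) :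
    ∑ i ∈ Finset.range N, ∑ j ∈ Finset.range N, F i j =
      ∑ n ∈ Finset.range N, ∑ p ∈ Finset.HasAntidiagonal.antidiagonal (2 * n) with p.1 < N ∧ p.2 < N,
        F p.1 p.2 := by
  rw [← Finset.sum_product', ← Finset.sum_filter_of_ne (p := fun p : ℕ × ℕ => Even (p.1 + p.2))
    (fun p _ hp => by by_contra hcon; exact hp (hF _ _ hcon)),
    ← Finset.sum_fiberwise_of_maps_to (t := Finset.range N) (g := fun p => (p.1 + p.2) / 2)]
  · refine Finset.sum_congr rfl fun n _ => Finset.sum_congr ?_ fun _ _ => rfl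
    ext ⟨i, j⟩
    simp only [Finset.mem_filter, Finset.mem_product, Finset.mem_range, Finset.HasAntidiagonal.mem_antidiagonal]
    constructor
    · rintro ⟨⟨⟨h1, h2⟩, ⟨k, hk⟩⟩, h3⟩
      exact ⟨by omega, h1, h2⟩
    · rintro ⟨h1, h2, h3⟩
      exact ⟨⟨⟨h2, h3⟩, ⟨n, by omega⟩⟩, by omega⟩
  · rintro ⟨i, j⟩ h
    simp only [Finset.mem_filter, Finset.mem_product, Finset.mem_range] at h ⊢
    omega

theorem gammaRatio_sq_le_one_of_even {i j : ℕ} (h : Even (i + j)) : gammaRatio i j ^ 2 ≤ 1 := by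
  obtain ⟨n, hn⟩ := h
  rw [gammaRatio_sq_of_add_eq (n := n) (by omega)]
  have : (0 : ℝ) < n.centralBinom := by exact_mod_cast n.centralBinom_pos
  rw [div_le_one this]
  exact_mod_cast Nat.choose_le_centralBinom i n

theorem abs_absSinCoeff_le {n i : ℕ} (h : n < i) :
    |absSinCoeff (2 * ((i : ℤ) - n))| ≤
      2 / (2 * ((i : ℝ) - n) - 1) - 2 / (2 * (((i + 1 : ℕ) : ℝ) - n) - 1) := by
  have h1 : (1 : ℝ) ≤ (i : ℝ) - n := by
    have : (n : ℝ) + 1 ≤ i := by exact_mod_cast h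
    linarith
  rw [absSinCoeff, if_pos (even_two_mul _)]
  push_cast
  rw [show (i : ℝ) + 1 - n = (i : ℝ) - n + 1 by ring]
  generalize (i : ℝ) - n = l at h1 ⊢
  have h2 : 0 < 2 * l - 1 := by linarith
  have h3 : 0 < 2 * (l + 1) - 1 := by linarith
  -- The partial fraction 4/(4l² - 1) = 2/(2l-1) - 2/(2l+1) makes the stated bound an equality.
  have h4 : 1 - (2 * l) ^ 2 < 0 := by nlinarith
  rw [abs_div, abs_of_neg h4, div_sub_div _ _ h2.ne' h3.ne', abs_of_pos (by norm_num : (0 : ℝ) < 4)]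
  apply le_of_eq
  rw [div_eq_div_iff (by linarith) (by positivity)]
  ring

theorem absSinCoeff_neg (m : ℤ) : absSinCoeff (-m) = absSinCoeff m := by
  simp [absSinCoeff]

theorem sum_Ico_telescope_le {φ : ℕ → ℝ} {a : ℕ} (b : ℕ) (hφ : ∀ i, a ≤ i → 0 ≤ φ i) :
    ∑ i ∈ Finset.Ico a b, (φ i - φ (i + 1)) ≤ φ a := by
  rcases le_or_gt a b with h | h
  · have := Finset.sum_Ico_sub φ h
    rw [← neg_inj, ← Finset.sum_neg_distrib] at this
    simp only [neg_sub] at this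
    rw [this]
    linarith [hφ b h]
  · rw [Finset.Ico_eq_empty (by omega), Finset.sum_empty]
    exact hφ a le_rfl

theorem sum_antidiagonal_ge_le {n N : ℕ} (h : n < N) :
    ∑ p ∈ Finset.HasAntidiagonal.antidiagonal (2 * n),
      (if N ≤ p.1 then |gammaRatio p.1 p.2 ^ 2 * absSinCoeff ((p.1 : ℤ) - p.2)| else 0) ≤
      2 / (2 * ((N : ℝ) - n) - 1) := by
  set φ : ℕ → ℝ := fun i => 2 / (2 * ((i : ℝ) - n) - 1) with hφ
  have h0 : ∀ i, N ≤ i → 0 ≤ φ i := by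
    intro i hi
    have : (n : ℝ) + 1 ≤ i := by exact_mod_cast (h.trans_le hi)
    exact div_nonneg two_pos.le (by linarith)
  refine le_trans ?_ (sum_Ico_telescope_le (φ := φ) (2 * n + 1) h0)
  have e : Finset.Ico N (2 * n + 1) = (Finset.range (2 * n + 1)).filter (N ≤ ·) := by
    ext i; simp only [Finset.mem_Ico, Finset.mem_filter, Finset.mem_range]; omega
  rw [Finset.Nat.sum_antidiagonal_eq_sum_range_succ_mk, e, Finset.sum_filter]
  refine Finset.sum_le_sum fun i hi => ?_
  rw [Finset.mem_range] at hi
  split_ifs with hNi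
  · have h1 : (i : ℤ) - ((2 * n - i : ℕ) : ℤ) = 2 * ((i : ℤ) - n) := by omega
    rw [h1, abs_mul, abs_of_nonneg (sq_nonneg _)]
    refine (mul_le_of_le_one_left (abs_nonneg _)
      (gammaRatio_sq_le_one_of_even ⟨n, by omega⟩)).trans (abs_absSinCoeff_le (h.trans_le hNi))
  · exact le_rfl

/-- The pairs of the antidiagonal outside the square have i ≥ N or j ≥ N. The two ends are mirror
images, and each telescopes. -/
theorem abs_sum_antidiagonal_not_lt_le {n N : ℕ} (h : n < N) :
    |∑ p ∈ Finset.HasAntidiagonal.antidiagonal (2 * n) with ¬ (p.1 < N ∧ p.2 < N),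
      gammaRatio p.1 p.2 ^ 2 * absSinCoeff ((p.1 : ℤ) - p.2)| ≤
      4 / (2 * ((N : ℝ) - n) - 1) := by
  have h1 := sum_antidiagonal_ge_le h
  have h2 := Finset.Nat.sum_antidiagonal_swap (n := 2 * n) (f := fun p : ℕ × ℕ =>
    if N ≤ p.1 then |gammaRatio p.1 p.2 ^ 2 * absSinCoeff ((p.1 : ℤ) - p.2)| else 0)
  have h3 : (4 : ℝ) / (2 * ((N : ℝ) - n) - 1) = 2 / (2 * ((N : ℝ) - n) - 1) +
    2 / (2 * ((N : ℝ) - n) - 1) := by ring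
  rw [h3]
  refine (Finset.abs_sum_le_sum_abs _ _).trans (le_trans ?_ (add_le_add h1 (h2.trans_le h1)))
  rw [Finset.sum_filter, ← Finset.sum_add_distrib]
  refine Finset.sum_le_sum fun p _ => ?_
  have e : |gammaRatio p.2 p.1 ^ 2 * absSinCoeff ((p.2 : ℤ) - p.1)| =
      |gammaRatio p.1 p.2 ^ 2 * absSinCoeff ((p.1 : ℤ) - p.2)| := by
    rw [gammaRatio_comm, ← absSinCoeff_neg, neg_sub]
  simp only [Prod.fst_swap, Prod.snd_swap, e]
  have hpos := abs_nonneg (gammaRatio p.1 p.2 ^ 2 * absSinCoeff ((p.1 : ℤ) - p.2))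
  split_ifs <;> first | linarith | (exfalso; omega)

/-- Complete antidiagonals would give exactly 4(`wallisRatio N` - 1). The missing corners cost at
most 4/(N - n) on the n-th antidiagonal, hence a harmonic sum in all. -/
theorem abs_integral_abs_sin_mul_angularKernel_sub_le (N : ℕ) :
    |(∫ s in (0 : ℝ)..(2 * π), |Real.sin s| * angularKernel N s) -
      4 * (wallisRatio N - 1)| ≤ 4 * (1 + Real.log N) := by
  rw [integral_mul_angularKernel N (by fun_prop)]
  simp_rw [integral_abs_sin_mul_cos]
  rw [sum_square_eq_sum_antidiagonal N
    (fun i j => gammaRatio i j ^ 2 * absSinCoeff ((i : ℤ) - j))]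
  swap
  · intro i j hij
    have : ¬ Even ((i : ℤ) - j) := by
      rw [Int.even_sub, Int.even_coe_nat, Int.even_coe_nat]
      rwa [Nat.even_add] at hij
    simp [absSinCoeff, this]
  have h1 : 4 * (wallisRatio N - 1) = ∑ n ∈ Finset.range N,
      ∑ p ∈ Finset.HasAntidiagonal.antidiagonal (2 * n), gammaRatio p.1 p.2 ^ 2 *
        absSinCoeff ((p.1 : ℤ) - p.2) := by
    simp_rw [sum_antidiagonal_absSinCoeff]
    rw [← Finset.mul_sum, Finset.sum_range_sub, wallisRatio_zero]
  rw [h1, ← Finset.sum_sub_distrib]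
  refine (Finset.abs_sum_le_sum_abs _ _).trans ?_
  have h2 : ∀ n ∈ Finset.range N,
      |(∑ p ∈ Finset.HasAntidiagonal.antidiagonal (2 * n) with p.1 < N ∧ p.2 < N,
        gammaRatio p.1 p.2 ^ 2 * absSinCoeff ((p.1 : ℤ) - p.2)) -
      ∑ p ∈ Finset.HasAntidiagonal.antidiagonal (2 * n), gammaRatio p.1 p.2 ^ 2 *
        absSinCoeff ((p.1 : ℤ) - p.2)| ≤ 4 * (1 / (((N - 1 - n : ℕ) : ℝ) + 1)) := by
    intro n hn
    rw [Finset.mem_range] at hn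
    rw [← Finset.sum_filter_add_sum_filter_not (Finset.HasAntidiagonal.antidiagonal (2 * n))
      (fun p => p.1 < N ∧ p.2 < N), sub_add_cancel_left, abs_neg]
    refine (abs_sum_antidiagonal_not_lt_le hn).trans ?_
    have e : ((N - 1 - n : ℕ) : ℝ) + 1 = N - n := by
      have : (N - 1 - n) + 1 + n = N := by omega
      have h4 : (((N - 1 - n) + 1 + n : ℕ) : ℝ) = N := by rw [this]
      push_cast at h4; linarith
    have h5 : (n : ℝ) + 1 ≤ N := by exact_mod_cast hn
    rw [e, mul_one_div]
    exact div_le_div_of_nonneg_left (by norm_num) (by linarith) (by linarith)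
  refine (Finset.sum_le_sum h2).trans ?_
  rw [← Finset.mul_sum, Finset.sum_range_reflect (fun i => 1 / ((i : ℝ) + 1)) N]
  exact mul_le_mul_of_nonneg_left (sum_inv_le_one_add_log N) (by norm_num)

end AbsSin

/-! ### Comparison of overlap functions with |sin| and with each other. -/

section ArcOverlap

theorem arcOverlap_two_pi_sub (u s : ℝ) : arcOverlap u (2 * π - s) = arcOverlap u s := by
  unfold arcOverlap
  have h1 : max (2 * π - u - (2 * π - s)) 0 = (s - u) + max (u - s) 0 := by
    rw [← max_add_add_left]; rw [max_comm]; congr 1 <;> ring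
  have h2 : max (u - (2 * π - s)) 0 = (s - 2 * π + u) + max (2 * π - u - s) 0 := by
    rw [← max_add_add_left]; rw [max_comm]; congr 1 <;> ring
  rw [h1, h2]; ring

theorem arcOverlap_of_le {u s : ℝ} (h1 : s ≤ u) (h2 : s ≤ 2 * π - u) : arcOverlap u s = s := by
  unfold arcOverlap
  rw [max_eq_left (by linarith), max_eq_left (by linarith)]
  ring

theorem abs_arcOverlap_le {u s : ℝ} (hu : u ∈ Icc 0 (2 * π)) (hs : s ∈ Icc 0 (2 * π)) :
    |arcOverlap u s| ≤ 4 * π := by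
  unfold arcOverlap
  have h1 : max (2 * π - u - s) 0 ≤ 2 * π := max_le (by linarith [hu.1, hs.1]) (by linarith [hs.1, hs.2])
  have h2 : max (u - s) 0 ≤ 2 * π := max_le (by linarith [hu.2, hs.1]) (by linarith [hs.1, hs.2])
  have h3 := le_max_right (2 * π - u - s) 0
  have h4 := le_max_right (u - s) 0
  rw [abs_le]
  constructor <;> linarith [hs.1, hs.2]

theorem one_sub_cos_le_of_mem_Icc {ε s : ℝ} (hε : 0 ≤ ε) (h1 : ε ≤ s) (h2 : s ≤ 2 * π - ε) :
    1 - Real.cos ε ≤ 1 - Real.cos s := by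
  rcases le_or_gt s π with h | h
  · linarith [Real.cos_le_cos_of_nonneg_of_le_pi hε h h1]
  · have := Real.cos_le_cos_of_nonneg_of_le_pi hε (by linarith : 2 * π - s ≤ π) (by linarith)
    rw [Real.cos_two_pi_sub] at this
    linarith

/-- For small s the left side is cubic and 1 - cos s = 2 sin²(s/2) is quadratic; 3 is a convenient
constant. -/
theorem abs_sub_sin_le {s : ℝ} (h0 : 0 ≤ s) (h1 : s ≤ 1) : |s - abs (Real.sin s)| ≤ 3 * (1 - Real.cos s) := by
  rcases h0.eq_or_lt with rfl | hpos
  · simp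
  have hs : Real.sin s ≤ s := Real.sin_le h0
  have hs0 : 0 ≤ Real.sin s := Real.sin_nonneg_of_nonneg_of_le_pi h0 (by linarith [Real.pi_gt_three])
  have hs1 := Real.sin_gt_sub_cube hpos
  have hh := Real.sin_gt_sub_cube (x := s / 2) (by linarith)
  have hcos : Real.cos s = 1 - 2 * Real.sin (s / 2) ^ 2 := by
    have h1 := Real.cos_sq' (s / 2)
    have h2 := Real.cos_two_mul (s / 2)
    rw [mul_div_cancel₀ _ (two_ne_zero' ℝ)] at h2
    linarith
  rw [abs_of_nonneg hs0, abs_of_nonneg (by linarith), hcos]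
  have h2 : s / 2 * (5 / 6) ≤ Real.sin (s / 2) := by nlinarith [mul_nonneg h0 h0]
  have h3 : (s / 2 * (5 / 6)) ^ 2 ≤ Real.sin (s / 2) ^ 2 := by gcongr
  nlinarith [mul_nonneg h0 h0, mul_nonneg (mul_nonneg h0 h0) (sub_nonneg.2 h1)]

/-- Within ε of 0 or 2π the overlap is the distance to that endpoint and |sin| matches it to first
order; elsewhere 1 - cos s is bounded below and crude bounds suffice. -/
theorem exists_abs_arcOverlap_sub_abs_sin_le {u : ℝ} (hu : u ∈ Ioo 0 (2 * π)) :
    ∃ C : ℝ, 0 ≤ C ∧ ∀ s ∈ Icc 0 (2 * π),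
      |arcOverlap u s - abs (Real.sin s)| ≤ C * (1 - Real.cos s) := by
  obtain ⟨hu0, hu1⟩ := hu
  have hπ := Real.pi_gt_three
  obtain ⟨ε, hε0, hε1, hε2, hε3⟩ : ∃ ε : ℝ, 0 < ε ∧ ε ≤ 1 ∧ ε ≤ u ∧ ε ≤ 2 * π - u :=
    ⟨min 1 (min u (2 * π - u)), lt_min one_pos (lt_min hu0 (by linarith)), min_le_left _ _,
      (min_le_right _ _).trans (min_le_left _ _), (min_le_right _ _).trans (min_le_right _ _)⟩
  have hc : 0 < 1 - Real.cos ε := by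
    have := Real.cos_lt_cos_of_nonneg_of_le_pi le_rfl (by linarith : ε ≤ π) hε0
    rw [Real.cos_zero] at this; linarith
  refine ⟨max 3 ((4 * π + 1) / (1 - Real.cos ε)), by positivity, fun s hs => ?_⟩
  have hcs : 0 ≤ 1 - Real.cos s := by linarith [Real.cos_le_one s]
  have key : ∀ t, 0 ≤ t → t ≤ ε → |arcOverlap u t - abs (Real.sin t)| ≤ 3 * (1 - Real.cos t) := by
    intro t h0 h1
    rw [arcOverlap_of_le (h1.trans hε2) (h1.trans hε3)]
    exact abs_sub_sin_le h0 (h1.trans hε1)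
  rcases le_total s ε with h | h
  · exact (key s hs.1 h).trans (mul_le_mul_of_nonneg_right (le_max_left _ _) hcs)
  rcases le_total (2 * π - ε) s with h' | h'
  · have := key (2 * π - s) (by linarith [hs.2]) (by linarith)
    rw [arcOverlap_two_pi_sub, Real.sin_two_pi_sub, abs_neg, Real.cos_two_pi_sub] at this
    exact this.trans (mul_le_mul_of_nonneg_right (le_max_left _ _) hcs)
  · have h1 := one_sub_cos_le_of_mem_Icc hε0.le h h'
    have h2 : |arcOverlap u s - abs (Real.sin s)| ≤ 4 * π + 1 :=
      (abs_sub _ _).trans (add_le_add (abs_arcOverlap_le ⟨hu0.le, hu1.le⟩ hs)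
        (by rw [abs_abs]; exact Real.abs_sin_le_one s))
    refine h2.trans ?_
    calc 4 * π + 1 = (4 * π + 1) / (1 - Real.cos ε) * (1 - Real.cos ε) := by field_simp
      _ ≤ _ := mul_le_mul (le_max_right _ _) h1 hc.le (by positivity)

/-- Near 0 and 2π the two overlaps agree exactly, so the difference is bounded by any positive
multiple of (1 - cos s)² there and by a large one elsewhere. -/
theorem exists_abs_arcOverlap_sub_arcOverlap_le {u u' : ℝ} (hu : u ∈ Ioo 0 (2 * π))
    (hu' : u' ∈ Ioo 0 (2 * π)) :
    ∃ C : ℝ, 0 ≤ C ∧ ∀ s ∈ Icc 0 (2 * π),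
      |arcOverlap u s - arcOverlap u' s| ≤ C * (1 - Real.cos s) ^ 2 := by
  obtain ⟨hu0, hu1⟩ := hu
  obtain ⟨hu0', hu1'⟩ := hu'
  have hπ := Real.pi_gt_three
  obtain ⟨ε, hε0, hε1, hε2, hε3, hε4, hε5⟩ : ∃ ε : ℝ, 0 < ε ∧ ε ≤ 1 ∧ ε ≤ u ∧ ε ≤ 2 * π - u ∧
      ε ≤ u' ∧ ε ≤ 2 * π - u' :=
    ⟨min 1 (min (min u (2 * π - u)) (min u' (2 * π - u'))),
      lt_min one_pos (lt_min (lt_min hu0 (by linarith)) (lt_min hu0' (by linarith))),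
      by simp, by simp, by simp, by simp, by simp⟩
  have hc : 0 < 1 - Real.cos ε := by
    have := Real.cos_lt_cos_of_nonneg_of_le_pi le_rfl (by linarith : ε ≤ π) hε0
    rw [Real.cos_zero] at this; linarith
  refine ⟨8 * π / (1 - Real.cos ε) ^ 2, by positivity, fun s hs => ?_⟩
  have key : ∀ t, t ≤ ε → arcOverlap u t - arcOverlap u' t = 0 := by
    intro t h1
    rw [arcOverlap_of_le (h1.trans hε2) (h1.trans hε3),
      arcOverlap_of_le (h1.trans hε4) (h1.trans hε5), sub_self]
  rcases le_total s ε with h | h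
  · rw [key s h, abs_zero]; positivity
  rcases le_total (2 * π - ε) s with h' | h'
  · have := key (2 * π - s) (by linarith)
    rw [arcOverlap_two_pi_sub, arcOverlap_two_pi_sub] at this
    rw [this, abs_zero]; positivity
  · have h1 := one_sub_cos_le_of_mem_Icc hε0.le h h'
    have h2 : |arcOverlap u s - arcOverlap u' s| ≤ 8 * π :=
      ((abs_sub _ _).trans (add_le_add (abs_arcOverlap_le ⟨hu0.le, hu1.le⟩ hs)
        (abs_arcOverlap_le ⟨hu0'.le, hu1'.le⟩ hs))).trans (by linarith)
    refine h2.trans ?_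
    calc 8 * π = 8 * π / (1 - Real.cos ε) ^ 2 * (1 - Real.cos ε) ^ 2 := by field_simp
      _ ≤ _ := by gcongr

end ArcOverlap

/-! ### Asymptotics of the arc variance. -/

section ArcVariance

theorem exists_add_mem_Ioo_of_angle_ne {x y : ℝ} (h : (x : Real.Angle) ≠ y) :
    ∃ u ∈ Ioo 0 (2 * π), (x : Real.Angle) = ((y + u : ℝ) : Real.Angle) := by
  obtain ⟨n, hn, -⟩ := existsUnique_add_zsmul_mem_Ico Real.two_pi_pos x y
  have he : (x : Real.Angle) = ((x + n • (2 * π) : ℝ) : Real.Angle) := by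
    rw [Real.Angle.angle_eq_iff_two_pi_dvd_sub]
    exact ⟨-n, by rw [zsmul_eq_mul]; push_cast; ring⟩
  refine ⟨x + n • (2 * π) - y, ⟨?_, by linarith [hn.2]⟩, by rw [add_sub_cancel]; exact he⟩
  refine (sub_nonneg.2 hn.1).lt_of_ne fun h0 => h ?_
  rw [he, ← sub_eq_zero.1 h0.symm]

theorem abs_integral_mul_angularKernel_sub_le (N : ℕ) {φ χ ψ : ℝ → ℝ} (hφ : Continuous φ)
    (hχ : Continuous χ) (hψ : Continuous ψ) {C : ℝ}
    (h : ∀ s ∈ Icc 0 (2 * π), |φ s - χ s| ≤ C * ψ s) :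
    |(∫ s in (0 : ℝ)..(2 * π), φ s * angularKernel N s) -
      ∫ s in (0 : ℝ)..(2 * π), χ s * angularKernel N s| ≤
      C * ∫ s in (0 : ℝ)..(2 * π), ψ s * angularKernel N s := by
  have hc := continuous_angularKernel N
  have hπ := Real.two_pi_pos
  rw [← intervalIntegral.integral_sub (by apply Continuous.intervalIntegrable; fun_prop)
    (by apply Continuous.intervalIntegrable; fun_prop), ← intervalIntegral.integral_const_mul]
  refine (intervalIntegral.abs_integral_le_integral_abs hπ.le).trans ?_
  refine intervalIntegral.integral_mono_on hπ.le
    (by apply Continuous.intervalIntegrable; fun_prop)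
    (by apply Continuous.intervalIntegrable; fun_prop) fun s hs => ?_
  rw [← sub_mul, abs_mul, abs_of_nonneg (angularKernel_nonneg N s), ← mul_assoc]
  exact mul_le_mul_of_nonneg_right (h s hs) (angularKernel_nonneg N s)

theorem abs_wallisRatio_sub_sqrt_le (N : ℕ) : |wallisRatio N - √(π * N)| ≤ 2 := by
  have h1 := wallisRatio_sq_le N
  have h2 := le_wallisRatio_sq N
  have hw := wallisRatio_pos N
  have h3 : √(π * N) ≤ wallisRatio N := by
    rw [← Real.sqrt_sq hw.le]; exact Real.sqrt_le_sqrt h2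
  rw [abs_of_nonneg (by linarith), sub_le_iff_le_add]
  refine le_of_sq_le_sq ?_ (by positivity)
  have h4 : √(π * N) ^ 2 = π * N := Real.sq_sqrt (by positivity)
  have := Real.pi_lt_four
  nlinarith [Real.sqrt_nonneg (π * N)]

theorem sqrt_div_pi_cubed (x : ℝ) (hx : 0 ≤ x) : √(x / π ^ 3) = √(π * x) / π ^ 2 := by
  have hπ := Real.pi_pos
  rw [show x / π ^ 3 = π * x / (π ^ 2) ^ 2 by field_simp, Real.sqrt_div (by positivity),
    Real.sqrt_sq (by positivity)]

theorem exists_abs_arcVariance_sub_le {x y : ℝ} (h : (x : Real.Angle) ≠ y) :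
    ∃ C : ℝ, 0 ≤ C ∧ ∀ N : ℕ, 0 < N →
      |arcVariance N x y - √((N : ℝ) / π ^ 3)| ≤ C * (1 + Real.log N) := by
  obtain ⟨u, hu, hxu⟩ := exists_add_mem_Ioo_of_angle_ne h
  obtain ⟨C, hC0, hC⟩ := exists_abs_arcOverlap_sub_abs_sin_le hu
  have hπ := Real.pi_pos
  -- The term 4πC bounds the first-moment error 2πC(2 + log N). The 16 collects 4 from the missing
  -- corners, 4 from the -1 in the telescoped sum, and 8 from replacing `wallisRatio N` by √(πN).
  refine ⟨(C * (4 * π) + 16) / (4 * π ^ 2), by positivity, fun N hN => ?_⟩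
  rw [arcVariance_eq_of_angle_eq N hxu, sqrt_div_pi_cubed _ N.cast_nonneg]
  have h1 := arcVariance_eq_integral hN (x := y + u) (y := y) (by linarith [hu.1]) (by linarith [hu.2])
  rw [add_sub_cancel_left] at h1
  have h2 := abs_integral_mul_angularKernel_sub_le N (continuous_arcOverlap u)
    (Real.continuous_sin.abs) (ψ := fun s => 1 - Real.cos s) (by fun_prop) hC
  rw [← h1] at h2
  have h3 := mul_le_mul_of_nonneg_left (integral_one_sub_cos_mul_angularKernel_le hN) hC0
  have h4 := abs_integral_abs_sin_mul_angularKernel_sub_le N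
  have h5 := abs_wallisRatio_sub_sqrt_le N
  have hlog : 0 ≤ Real.log N := Real.log_natCast_nonneg N
  rw [abs_le] at h2 h4 h5
  rw [abs_le]
  have h6 : (C * (4 * π) + 16) / (4 * π ^ 2) * (1 + Real.log N) =
      (C * (4 * π) + 16) * (1 + Real.log N) / (4 * π ^ 2) := by ring
  have h7 : arcVariance N (y + u) y - √(π * N) / π ^ 2 =
      (4 * π ^ 2 * arcVariance N (y + u) y - 4 * √(π * N)) / (4 * π ^ 2) := by
    field_simp
  have h8 : 0 ≤ C * π * Real.log N := by positivity
  rw [h6, h7, ← neg_div]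
  constructor
  · gcongr
    nlinarith
  · gcongr
    nlinarith

theorem exists_abs_arcVariance_sub_arcVariance_le {x y x' y' : ℝ} (h : (x : Real.Angle) ≠ y)
    (h' : (x' : Real.Angle) ≠ y') :
    ∃ C : ℝ, 0 ≤ C ∧ ∀ N : ℕ, 0 < N → |arcVariance N x y - arcVariance N x' y'| ≤ C := by
  obtain ⟨u, hu, hxu⟩ := exists_add_mem_Ioo_of_angle_ne h
  obtain ⟨u', hu', hxu'⟩ := exists_add_mem_Ioo_of_angle_ne h'
  obtain ⟨C, hC0, hC⟩ := exists_abs_arcOverlap_sub_arcOverlap_le hu hu'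
  have hπ := Real.pi_pos
  refine ⟨C * (4 * π) / (4 * π ^ 2), by positivity, fun N hN => ?_⟩
  rw [arcVariance_eq_of_angle_eq N hxu, arcVariance_eq_of_angle_eq N hxu']
  have h1 := arcVariance_eq_integral hN (x := y + u) (y := y) (by linarith [hu.1]) (by linarith [hu.2])
  have h1' := arcVariance_eq_integral hN (x := y' + u') (y := y') (by linarith [hu'.1])
    (by linarith [hu'.2])
  rw [add_sub_cancel_left] at h1 h1'
  have h2 := abs_integral_mul_angularKernel_sub_le N (continuous_arcOverlap u)
    (continuous_arcOverlap u') (ψ := fun s => (1 - Real.cos s) ^ 2) (by fun_prop) hC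
  rw [← h1, ← h1', ← mul_sub, abs_mul, abs_of_pos (by positivity : 0 < 4 * π ^ 2)] at h2
  rw [le_div_iff₀ (by positivity), mul_comm]
  exact h2.trans (mul_le_mul_of_nonneg_left
    (integral_one_sub_cos_sq_mul_angularKernel_le hN) hC0)

end ArcVariance

/-! ### Covariances of angular counts. -/

section AngularCovariance

open Asymptotics

theorem isBigO_div_sqrt_sub {p κ C : ℝ} (hp : 0 < p) {G r : ℕ → ℝ}
    (hG : ∀ N : ℕ, 0 < N → |G N - κ * √((N : ℝ) / p)| ≤ C * r N) :
    (fun N : ℕ => G N / √((N : ℝ) / p) - κ) =O[atTop] fun N : ℕ => r N / √(N : ℝ) := by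
  refine IsBigO.of_bound (|C| * √p) ?_
  filter_upwards [eventually_gt_atTop 0] with N hN
  have hN' : (0 : ℝ) < N := by exact_mod_cast hN
  have h1 : 0 < √(N : ℝ) := Real.sqrt_pos.2 hN'
  have h2 : 0 < √p := Real.sqrt_pos.2 hp
  have h3 := hG N hN
  rw [Real.sqrt_div hN'.le] at h3 ⊢
  have h4 : G N / (√(N : ℝ) / √p) - κ = (G N - κ * (√(N : ℝ) / √p)) * (√p / √(N : ℝ)) := by
    field_simp
  rw [h4, norm_mul, Real.norm_eq_abs, Real.norm_of_nonneg (by positivity : 0 ≤ √p / √(N : ℝ)),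
    norm_div, Real.norm_of_nonneg h1.le]
  have h5 : C * r N ≤ |C| * ‖r N‖ := by
    rw [Real.norm_eq_abs, ← abs_mul]; exact le_abs_self _
  calc _ ≤ |C| * ‖r N‖ * (√p / √(N : ℝ)) := by gcongr; exact h3.trans h5
    _ = _ := by ring

theorem isBigO_one_add_log_div_sqrt :
    (fun N : ℕ => (1 + Real.log N) / √(N : ℝ)) =O[atTop] fun N : ℕ => Real.log N / √(N : ℝ) := by
  refine IsBigO.of_bound 2 ?_
  have h : ∀ᶠ N : ℕ in atTop, 1 ≤ Real.log N :=
    (Real.tendsto_log_atTop.comp tendsto_natCast_atTop_atTop).eventually_ge_atTop 1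
  filter_upwards [h] with N hN
  rw [norm_div, norm_div, Real.norm_of_nonneg (by linarith : 0 ≤ 1 + Real.log N),
    Real.norm_of_nonneg (by linarith : 0 ≤ Real.log N), ← mul_div_assoc]
  gcongr
  linarith

theorem rpow_one_fourth_mul_self {x : ℝ} (hx : 0 ≤ x) :
    x ^ (1 / 4 : ℝ) * x ^ (1 / 4 : ℝ) = √x := by
  rw [Real.sqrt_eq_rpow, ← Real.rpow_add_of_nonneg hx (by norm_num) (by norm_num)]
  norm_num

theorem covariance_div_eq (N : ℕ) (f g : ℂ → ℝ) {x : ℝ} (hx : 0 ≤ x) :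
    ProbabilityTheory.covariance (fun z : Fin N → ℂ => linearStat f z / x ^ (1 / 4 : ℝ))
      (fun z : Fin N → ℂ => linearStat g z / x ^ (1 / 4 : ℝ)) (ginibreLaw N) =
      ginibreCov N f g / √x := by
  rw [ProbabilityTheory.covariance_fun_div_left, ProbabilityTheory.covariance_fun_div_right,
    div_div, rpow_one_fourth_mul_self hx]
  rfl

theorem angularCov_eq (N : ℕ) (α β δ γ : ℝ) : angularCov α β δ γ N =
    ginibreCov N
      (Set.indicator {z : ℂ | (Complex.arg z : Real.Angle) ∈ circleArc α β} fun _ => 1)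
      (Set.indicator {z : ℂ | (Complex.arg z : Real.Angle) ∈ circleArc δ γ} fun _ => 1) /
      √((N : ℝ) / π ^ 3) :=
  covariance_div_eq N _ _ (by positivity)

theorem angularCov_nonneg (N : ℕ) {α β δ γ : ℝ} (h : circleArc α β ⊆ circleArc δ γ) :
    0 ≤ angularCov α β δ γ N := by
  rw [angularCov_eq]
  exact div_nonneg (ginibreCov_indicator_nonneg (measurableSet_circleArc _ _)
    (measurableSet_circleArc _ _) fun z hz => h hz) (Real.sqrt_nonneg _)

theorem angularCov_nonpos (N : ℕ) {α β δ γ : ℝ} (h : Disjoint (circleArc α β) (circleArc δ γ)) :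
    angularCov α β δ γ N ≤ 0 := by
  rw [angularCov_eq]
  exact div_nonpos_of_nonpos_of_nonneg (ginibreCov_indicator_nonpos (measurableSet_circleArc _ _)
    (measurableSet_circleArc _ _) (Set.disjoint_left.2 fun z hz hz' =>
      Set.disjoint_left.1 h hz hz')) (Real.sqrt_nonneg _)

variable {α β δ γ : ℝ}

theorem left_mem_circleArc (h : α < β) : (α : Real.Angle) ∈ circleArc α β :=
  ⟨α, ⟨le_rfl, h.le⟩, rfl⟩

theorem right_mem_circleArc (h : α < β) : (β : Real.Angle) ∈ circleArc α β :=
  ⟨β, ⟨h.le, le_rfl⟩, rfl⟩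

/-- If the inner arc ended where the outer one begins, points just before that angle would lie in
the inner arc but in the gap left by the outer one, which is nonempty since γ < δ + 2π. -/
theorem right_ne_left_of_circleArc_subset (h1 : α < β) (h4 : γ < δ + 2 * π)
    (h : circleArc α β ⊆ circleArc δ γ) : (β : Real.Angle) ≠ δ := by
  intro he
  obtain ⟨k, hk⟩ := Real.Angle.angle_eq_iff_two_pi_dvd_sub.1 he
  obtain ⟨ε, hε, hε1, hε2⟩ : ∃ ε : ℝ, 0 < ε ∧ ε ≤ β - α ∧ ε < δ + 2 * π - γ :=
    ⟨min (β - α) ((δ + 2 * π - γ) / 2), lt_min (by linarith) (by linarith), min_le_left _ _,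
      (min_le_right _ _).trans_lt (by linarith)⟩
  obtain ⟨φ, ⟨hφ1, hφ2⟩, hφ⟩ := h ⟨β - ε, ⟨by linarith, by linarith⟩, rfl⟩
  obtain ⟨m, hm⟩ := Real.Angle.angle_eq_iff_two_pi_dvd_sub.1 hφ
  have hπ := Real.two_pi_pos
  have h5 : φ = δ - ε + 2 * π * (k + m) := by linarith
  have h6 : (0 : ℝ) < ((k + m : ℤ) : ℝ) := by push_cast; nlinarith
  have h7 : (1 : ℝ) ≤ ((k + m : ℤ) : ℝ) := by exact_mod_cast Int.cast_pos.1 h6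
  push_cast at h7
  nlinarith

theorem left_ne_right_of_circleArc_subset (h1 : α < β) (h4 : γ < δ + 2 * π)
    (h : circleArc α β ⊆ circleArc δ γ) : (α : Real.Angle) ≠ γ := by
  intro he
  obtain ⟨k, hk⟩ := Real.Angle.angle_eq_iff_two_pi_dvd_sub.1 he
  obtain ⟨ε, hε, hε1, hε2⟩ : ∃ ε : ℝ, 0 < ε ∧ ε ≤ β - α ∧ ε < δ + 2 * π - γ :=
    ⟨min (β - α) ((δ + 2 * π - γ) / 2), lt_min (by linarith) (by linarith), min_le_left _ _,
      (min_le_right _ _).trans_lt (by linarith)⟩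
  obtain ⟨φ, ⟨hφ1, hφ2⟩, hφ⟩ := h ⟨α + ε, ⟨by linarith, by linarith⟩, rfl⟩
  obtain ⟨m, hm⟩ := Real.Angle.angle_eq_iff_two_pi_dvd_sub.1 hφ
  have hπ := Real.two_pi_pos
  have h5 : φ = γ + ε + 2 * π * (k + m) := by linarith
  have h6 : ((k + m : ℤ) : ℝ) < 0 := by push_cast; nlinarith
  have h7 : ((k + m : ℤ) : ℝ) ≤ -1 := by
    have : (k + m : ℤ) ≤ -1 := by
      have := Int.cast_lt_zero.1 h6
      omega
    exact_mod_cast this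
  push_cast at h7
  nlinarith

theorem angularCov_isBigO_of_ne (h1 : α < β) (h2 : β < α + 2 * π) (h3 : δ < γ)
    (h4 : γ < δ + 2 * π) (hαδ : (α : Real.Angle) ≠ δ) (hβγ : (β : Real.Angle) ≠ γ)
    (hβδ : (β : Real.Angle) ≠ δ) (hαγ : (α : Real.Angle) ≠ γ) :
    (fun N : ℕ => angularCov α β δ γ N) =O[atTop] fun N : ℕ => 1 / √(N : ℝ) := by
  -- All four variances are between distinct angles, so they are paired with opposite signs and each
  -- pair leaves only O(1).
  obtain ⟨C, -, hC⟩ := exists_abs_arcVariance_sub_arcVariance_le hβδ hβγ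
  obtain ⟨D, -, hD⟩ := exists_abs_arcVariance_sub_arcVariance_le hαγ hαδ
  have := isBigO_div_sqrt_sub (p := π ^ 3) (κ := 0) (C := (C + D) / 2) (r := fun _ => 1)
    (by have := Real.pi_pos; positivity)
    (G := fun N => ginibreCov N
      (Set.indicator {z : ℂ | (Complex.arg z : Real.Angle) ∈ circleArc α β} fun _ => 1)
      (Set.indicator {z : ℂ | (Complex.arg z : Real.Angle) ∈ circleArc δ γ} fun _ => 1))
    (fun N hN => by
      rw [ginibreCov_circleArc N h1 h2 h3 h4, zero_mul, sub_zero, mul_one]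
      have e1 := abs_le.1 (hC N hN)
      have e2 := abs_le.1 (hD N hN)
      rw [abs_le]
      constructor <;> linarith [e1.1, e1.2, e2.1, e2.2])
  simpa only [sub_zero, angularCov_eq] using this

theorem angularCov_isBigO_log {κ : ℝ} (h1 : α < β) (h2 : β < α + 2 * π) (h3 : δ < γ)
    (h4 : γ < δ + 2 * π)
    (h : ∃ C : ℝ, ∀ N : ℕ, 0 < N →
      |(arcVariance N β δ + arcVariance N α γ - arcVariance N β γ - arcVariance N α δ) / 2 -
        κ * √((N : ℝ) / π ^ 3)| ≤ C * (1 + Real.log N)) :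
    (fun N : ℕ => angularCov α β δ γ N - κ)
      =O[atTop] fun N : ℕ => Real.log N / √(N : ℝ) := by
  obtain ⟨C, hC⟩ := h
  have := isBigO_div_sqrt_sub (p := π ^ 3) (κ := κ) (C := C) (r := fun N => 1 + Real.log N)
    (by have := Real.pi_pos; positivity)
    (G := fun N => ginibreCov N
      (Set.indicator {z : ℂ | (Complex.arg z : Real.Angle) ∈ circleArc α β} fun _ => 1)
      (Set.indicator {z : ℂ | (Complex.arg z : Real.Angle) ∈ circleArc δ γ} fun _ => 1))
    (fun N hN => by
      rw [ginibreCov_circleArc N h1 h2 h3 h4]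
      exact hC N hN)
  simp only [angularCov_eq]
  exact this.trans isBigO_one_add_log_div_sqrt

theorem angle_ne_of_lt_of_lt {x y : ℝ} (h1 : x < y) (h2 : y < x + 2 * π) :
    (x : Real.Angle) ≠ y := by
  intro h
  obtain ⟨k, hk⟩ := Real.Angle.angle_eq_iff_two_pi_dvd_sub.1 h
  have hπ := Real.two_pi_pos
  have h6 : ((k : ℤ) : ℝ) < 0 := by nlinarith
  have h7 : (-1 : ℝ) < (k : ℝ) := by nlinarith
  have h8 : (-1 : ℤ) < k := by exact_mod_cast h7
  have h9 : k < 0 := by exact_mod_cast h6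
  omega

theorem arcVariance_eq_zero_of_angle_eq (N : ℕ) {x y : ℝ} (h : (x : Real.Angle) = y) :
    arcVariance N x y = 0 := by
  rw [arcVariance_eq_of_angle_eq N h, arcVariance_self]

/-- A common endpoint of the same kind kills one of the two negative variances; two positive and one
negative remain, giving (1 + 1 - 1)/2. In `angularCov_add_half_isBigO` a positive one is killed
instead, giving -1/2. -/
theorem angularCov_sub_half_isBigO (h1 : α < β) (h2 : β < α + 2 * π) (h3 : δ < γ)
    (h4 : γ < δ + 2 * π)
    (h : ((α : Real.Angle) = δ ∧ (β : Real.Angle) ≠ γ) ∨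
      ((β : Real.Angle) = γ ∧ (α : Real.Angle) ≠ δ)) :
    (fun N : ℕ => angularCov α β δ γ N - 1 / 2)
      =O[atTop] fun N : ℕ => Real.log N / √(N : ℝ) := by
  have hαβ := angle_ne_of_lt_of_lt h1 h2
  have hδγ := angle_ne_of_lt_of_lt h3 h4
  refine angularCov_isBigO_log h1 h2 h3 h4 ?_
  rcases h with ⟨he, hne⟩ | ⟨he, hne⟩
  · obtain ⟨C₁, -, hC₁⟩ := exists_abs_arcVariance_sub_le (he ▸ hαβ.symm : (β : Real.Angle) ≠ δ)
    obtain ⟨C₂, -, hC₂⟩ := exists_abs_arcVariance_sub_le (he ▸ hδγ : (α : Real.Angle) ≠ γ)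
    obtain ⟨C₃, -, hC₃⟩ := exists_abs_arcVariance_sub_le hne
    refine ⟨(C₁ + C₂ + C₃) / 2, fun N hN => ?_⟩
    have e1 := abs_le.1 (hC₁ N hN)
    have e2 := abs_le.1 (hC₂ N hN)
    have e3 := abs_le.1 (hC₃ N hN)
    rw [arcVariance_eq_zero_of_angle_eq N he, abs_le]
    constructor <;> linarith [e1.1, e1.2, e2.1, e2.2, e3.1, e3.2]
  · obtain ⟨C₁, -, hC₁⟩ := exists_abs_arcVariance_sub_le
      (he.symm ▸ hδγ.symm : (β : Real.Angle) ≠ δ)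
    obtain ⟨C₂, -, hC₂⟩ := exists_abs_arcVariance_sub_le (he ▸ hαβ : (α : Real.Angle) ≠ γ)
    obtain ⟨C₃, -, hC₃⟩ := exists_abs_arcVariance_sub_le hne
    refine ⟨(C₁ + C₂ + C₃) / 2, fun N hN => ?_⟩
    have e1 := abs_le.1 (hC₁ N hN)
    have e2 := abs_le.1 (hC₂ N hN)
    have e3 := abs_le.1 (hC₃ N hN)
    rw [arcVariance_eq_zero_of_angle_eq N he, abs_le]
    constructor <;> linarith [e1.1, e1.2, e2.1, e2.2, e3.1, e3.2]

theorem angularCov_add_half_isBigO (h1 : α < β) (h2 : β < α + 2 * π) (h3 : δ < γ)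
    (h4 : γ < δ + 2 * π)
    (h : ((β : Real.Angle) = δ ∧ (α : Real.Angle) ≠ γ) ∨
      ((α : Real.Angle) = γ ∧ (β : Real.Angle) ≠ δ)) :
    (fun N : ℕ => angularCov α β δ γ N + 1 / 2)
      =O[atTop] fun N : ℕ => Real.log N / √(N : ℝ) := by
  have hαβ := angle_ne_of_lt_of_lt h1 h2
  have hδγ := angle_ne_of_lt_of_lt h3 h4
  have key := angularCov_isBigO_log (κ := -(1 / 2)) h1 h2 h3 h4
  simp only [sub_neg_eq_add] at key
  refine key ?_
  rcases h with ⟨he, hne⟩ | ⟨he, hne⟩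
  · obtain ⟨C₁, -, hC₁⟩ := exists_abs_arcVariance_sub_le (he.symm ▸ hδγ : (β : Real.Angle) ≠ γ)
    obtain ⟨C₂, -, hC₂⟩ := exists_abs_arcVariance_sub_le (he ▸ hαβ : (α : Real.Angle) ≠ δ)
    obtain ⟨C₃, -, hC₃⟩ := exists_abs_arcVariance_sub_le hne
    refine ⟨(C₁ + C₂ + C₃) / 2, fun N hN => ?_⟩
    have e1 := abs_le.1 (hC₁ N hN)
    have e2 := abs_le.1 (hC₂ N hN)
    have e3 := abs_le.1 (hC₃ N hN)
    rw [arcVariance_eq_zero_of_angle_eq N he, abs_le]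
    constructor <;> linarith [e1.1, e1.2, e2.1, e2.2, e3.1, e3.2]
  · obtain ⟨C₁, -, hC₁⟩ := exists_abs_arcVariance_sub_le (he ▸ hαβ.symm : (β : Real.Angle) ≠ γ)
    obtain ⟨C₂, -, hC₂⟩ := exists_abs_arcVariance_sub_le (he.symm ▸ hδγ.symm : (α : Real.Angle) ≠ δ)
    obtain ⟨C₃, -, hC₃⟩ := exists_abs_arcVariance_sub_le hne
    refine ⟨(C₁ + C₂ + C₃) / 2, fun N hN => ?_⟩
    have e1 := abs_le.1 (hC₁ N hN)
    have e2 := abs_le.1 (hC₂ N hN)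
    have e3 := abs_le.1 (hC₃ N hN)
    rw [arcVariance_eq_zero_of_angle_eq N he, abs_le]
    constructor <;> linarith [e1.1, e1.2, e2.1, e2.2, e3.1, e3.2]

end AngularCovariance

/-! ### Poisson distribution functions and Chernoff bounds. -/

section Poisson

/-- The Poisson probability of `j` at intensity `T`. -/
noncomputable def poissonWeight (T : ℝ) (j : ℕ) : ℝ := Real.exp (-T) * T ^ j / j.factorial

/-- The Poisson distribution function at intensity `T`. -/
noncomputable def poissonCdf (T : ℝ) (k : ℕ) : ℝ := ∑ j ∈ Finset.range (k + 1), poissonWeight T j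

theorem poissonWeight_nonneg {T : ℝ} (hT : 0 ≤ T) (j : ℕ) : 0 ≤ poissonWeight T j := by
  unfold poissonWeight; positivity

theorem hasSum_poissonWeight (T : ℝ) : HasSum (poissonWeight T) 1 := by
  have h := (NormedSpace.expSeries_div_hasSum_exp (𝔸 := ℝ) T).mul_left (Real.exp (-T))
  rw [← Real.exp_eq_exp_ℝ, ← Real.exp_add, neg_add_cancel, Real.exp_zero] at h
  refine h.congr_fun ?_
  intro j
  rw [poissonWeight, mul_div_assoc]

theorem hasSum_one_sub_poissonCdf (T : ℝ) (k : ℕ) :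
    HasSum (fun j => poissonWeight T (j + (k + 1))) (1 - poissonCdf T k) :=
  (hasSum_nat_add_iff' (k + 1)).2 (hasSum_poissonWeight T)

theorem poissonCdf_nonneg {T : ℝ} (hT : 0 ≤ T) (k : ℕ) : 0 ≤ poissonCdf T k :=
  Finset.sum_nonneg fun j _ => poissonWeight_nonneg hT j

theorem one_sub_poissonCdf_nonneg {T : ℝ} (hT : 0 ≤ T) (k : ℕ) : 0 ≤ 1 - poissonCdf T k :=
  (hasSum_one_sub_poissonCdf T k).nonneg fun _ => poissonWeight_nonneg hT _

/-- Exponential tilting: the weights at intensity T are compared with those at Ts, and s^j ≥ s^k for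
j ≤ k. The next bound tilts by r ≥ 1 in the same way for the upper tail. -/
theorem poissonCdf_le {T s : ℝ} (hT : 0 ≤ T) (hs : 0 < s) (hs1 : s ≤ 1) (k : ℕ) :
    poissonCdf T k ≤ Real.exp (-(T * (1 - s))) * s⁻¹ ^ k := by
  have h1 : ∀ j ∈ Finset.range (k + 1), poissonWeight T j ≤
      Real.exp (-(T * (1 - s))) * s⁻¹ ^ k * poissonWeight (T * s) j := by
    intro j hj
    rw [Finset.mem_range] at hj
    have h2 : Real.exp (-(T * (1 - s))) * s⁻¹ ^ k * poissonWeight (T * s) j =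
        poissonWeight T j * (s⁻¹ ^ k * s ^ j) := by
      rw [poissonWeight, poissonWeight, mul_pow]
      rw [show Real.exp (-T) = Real.exp (-(T * (1 - s))) * Real.exp (-(T * s)) by
        rw [← Real.exp_add]; congr 1; ring]
      ring
    rw [h2]
    refine le_mul_of_one_le_right (poissonWeight_nonneg hT j) ?_
    rw [inv_pow, inv_mul_eq_div, one_le_div (by positivity)]
    exact pow_le_pow_of_le_one hs.le hs1 (by omega)
  refine (Finset.sum_le_sum h1).trans ?_
  rw [← Finset.mul_sum]
  refine mul_le_of_le_one_right (by positivity) ?_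
  have := one_sub_poissonCdf_nonneg (mul_nonneg hT hs.le) k
  rw [poissonCdf] at this
  linarith

theorem one_sub_poissonCdf_le {T r : ℝ} (hT : 0 ≤ T) (hr : 1 ≤ r) (k : ℕ) :
    1 - poissonCdf T k ≤ Real.exp (T * (r - 1)) * r⁻¹ ^ k := by
  have hr0 : 0 < r := by linarith
  have h1 : ∀ j, poissonWeight T (j + (k + 1)) ≤
      Real.exp (T * (r - 1)) * r⁻¹ ^ k * poissonWeight (T * r) (j + (k + 1)) := by
    intro j
    have h2 : Real.exp (T * (r - 1)) * r⁻¹ ^ k * poissonWeight (T * r) (j + (k + 1)) =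
        poissonWeight T (j + (k + 1)) * (r⁻¹ ^ k * r ^ (j + (k + 1))) := by
      rw [poissonWeight, poissonWeight, mul_pow]
      rw [show Real.exp (-T) = Real.exp (T * (r - 1)) * Real.exp (-(T * r)) by
        rw [← Real.exp_add]; congr 1; ring]
      ring
    rw [h2]
    refine le_mul_of_one_le_right (poissonWeight_nonneg hT _) ?_
    rw [inv_pow, inv_mul_eq_div, one_le_div (by positivity)]
    exact pow_le_pow_right₀ hr (by omega)
  have h3 := hasSum_le h1 (hasSum_one_sub_poissonCdf T k)
    ((hasSum_one_sub_poissonCdf (T * r) k).mul_left _)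
  refine h3.trans (mul_le_of_le_one_right (by positivity) ?_)
  linarith [poissonCdf_nonneg (mul_nonneg hT hr0.le) k]

/-- The derivative of each weight is a difference of consecutive weights, so the sum telescopes.
This identifies incomplete Gamma integrals with Poisson probabilities. -/
theorem hasDerivAt_poissonCdf (T : ℝ) (k : ℕ) :
    HasDerivAt (fun T => poissonCdf T k) (-poissonWeight T k) T := by
  have hexp : HasDerivAt (fun T : ℝ => Real.exp (-T)) (-Real.exp (-T)) T := by
    simpa using (hasDerivAt_neg T).exp
  induction k with
  | zero =>
    refine (hexp.congr_deriv (by simp [poissonWeight])).congr_of_eventuallyEq ?_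
    exact Eventually.of_forall fun T => by simp [poissonCdf, poissonWeight]
  | succ k ih =>
    have h2 : HasDerivAt (fun T => poissonWeight T (k + 1))
        (poissonWeight T k - poissonWeight T (k + 1)) T := by
      have h3 := (hexp.mul (hasDerivAt_pow (k + 1) T)).div_const ((k + 1).factorial : ℝ)
      refine HasDerivAt.congr_deriv h3 ?_
      rw [poissonWeight, poissonWeight, Nat.factorial_succ]
      have : (k.factorial : ℝ) ≠ 0 := by positivity
      push_cast
      field_simp
      ring
    have h4 := ih.add h2
    refine (h4.congr_deriv (by ring)).congr_of_eventuallyEq ?_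
    exact Eventually.of_forall fun T => by
      simp only [poissonCdf, Pi.add_apply]
      rw [Finset.sum_range_succ _ (k + 1)]

theorem tendsto_poissonCdf (k : ℕ) : Tendsto (fun T => poissonCdf T k) atTop (nhds 0) := by
  have h : Tendsto (fun T => ∑ j ∈ Finset.range (k + 1), poissonWeight T j) atTop
      (nhds (∑ j ∈ Finset.range (k + 1), (0 : ℝ))) := by
    refine tendsto_finsetSum _ fun j _ => ?_
    have := (Real.tendsto_pow_mul_exp_neg_atTop_nhds_zero j).div_const (j.factorial : ℝ)
    rw [zero_div] at this
    refine this.congr fun T => ?_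
    rw [poissonWeight, mul_comm]
  simpa [poissonCdf] using h

end Poisson

/-! ### Radial steps and their Poisson description. -/

section Radial

open ComplexConjugate

theorem integrableOn_pow_mul_exp_neg_mul_sq {N : ℕ} (hN : 0 < N) (m : ℕ) :
    IntegrableOn (fun r : ℝ => r ^ m * Real.exp (-(N : ℝ) * r ^ 2)) (Ioi 0) := by
  have h := integrableOn_rpow_mul_exp_neg_mul_rpow (p := 2) (s := (m : ℝ)) (b := N)
    (by have : (0 : ℝ) ≤ (m : ℝ) := Nat.cast_nonneg _
        linarith) two_pos (by exact_mod_cast hN)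
  refine h.congr_fun (fun r _ => ?_) measurableSet_Ioi
  simp only [Real.rpow_natCast, Real.rpow_two]

theorem integral_Ioi_pow_mul_exp_neg_mul_sq {N : ℕ} (hN : 0 < N) (k : ℕ) {x : ℝ} (hx : 0 ≤ x) :
    ∫ r in Ioi x, r ^ (k + k + 1) * Real.exp (-(N : ℝ) * r ^ 2) =
      k.factorial / (2 * (N : ℝ) ^ (k + 1)) * poissonCdf (N * x ^ 2) k := by
  have hN' : (0 : ℝ) < N := by exact_mod_cast hN
  have hd : ∀ r : ℝ, HasDerivAt (fun r : ℝ =>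
      -(k.factorial / (2 * (N : ℝ) ^ (k + 1)) * poissonCdf (N * r ^ 2) k))
      (r ^ (k + k + 1) * Real.exp (-(N : ℝ) * r ^ 2)) r := by
    intro r
    have h1 : HasDerivAt (fun r : ℝ => (N : ℝ) * r ^ 2) (N * (2 * r)) r := by
      simpa using (hasDerivAt_pow 2 r).const_mul (N : ℝ)
    have h2 := (((hasDerivAt_poissonCdf (N * r ^ 2) k).comp r h1).const_mul
      ((k.factorial : ℝ) / (2 * (N : ℝ) ^ (k + 1)))).neg
    refine HasDerivAt.congr_deriv h2 ?_
    rw [poissonWeight, neg_mul (N : ℝ)]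
    have : (k.factorial : ℝ) ≠ 0 := by positivity
    field_simp
    ring
  have ht : Tendsto (fun r : ℝ =>
      -(k.factorial / (2 * (N : ℝ) ^ (k + 1)) * poissonCdf (N * r ^ 2) k)) atTop (nhds 0) := by
    have h1 : Tendsto (fun r : ℝ => (N : ℝ) * r ^ 2) atTop atTop :=
      (tendsto_pow_atTop two_ne_zero).const_mul_atTop hN'
    simpa using (((tendsto_poissonCdf k).comp h1).const_mul
      ((k.factorial : ℝ) / (2 * (N : ℝ) ^ (k + 1)))).neg
  rw [integral_Ioi_of_hasDerivAt_of_tendsto' (fun r _ => hd r)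
    ((integrableOn_pow_mul_exp_neg_mul_sq hN _).mono_set (Ioi_subset_Ioi hx)) ht]
  ring

/-- The indicator function of the complement of the open disc of radius `x`. -/
noncomputable def radialStep (x : ℝ) : ℂ → ℝ := Set.indicator {z : ℂ | x ≤ ‖z‖} fun _ => 1

theorem measurableSet_le_norm (x : ℝ) : MeasurableSet {z : ℂ | x ≤ ‖z‖} :=
  measurableSet_le measurable_const measurable_norm

theorem boundedMeasurable_radialStep (x : ℝ) : BoundedMeasurable (radialStep x) :=
  boundedMeasurable_indicator (measurableSet_le_norm x)

/-- The angular integral kills off-diagonal entries; the diagonal ones are normalized incomplete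
Gamma integrals. -/
theorem ginibreCompression_radialStep {N : ℕ} (hN : 0 < N) {x : ℝ} (hx : 0 ≤ x) :
    ginibreCompression N (radialStep x) =
      Matrix.diagonal fun i : Fin N => ((poissonCdf (N * x ^ 2) i : ℝ) : ℂ) := by
  ext i j
  have h1 : ∀ z : ℂ, ((radialStep x z : ℝ) : ℂ) *
      (ginibreBasis N i z * conj (ginibreBasis N j z)) =
      ((√(monomialNormSq N i) * √(monomialNormSq N j) : ℝ) : ℂ)⁻¹ *
      (1 * (Ici x).indicator (fun _ => (1 : ℂ)) ‖z‖ * (z ^ (i : ℕ) * conj z ^ (j : ℕ))) := by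
    intro z
    rw [ginibreBasis_mul_conj]
    by_cases hz : x ≤ ‖z‖
    · simp [radialStep, hz]
    · simp [radialStep, hz]
  simp only [ginibreCompression, compression, Matrix.of_apply]
  simp_rw [h1]
  rw [integral_const_mul, integral_polar_monomial N (fun _ => 1)
    ((Ici x).indicator fun _ => (1 : ℂ)), setIntegral_Ioo_eq_intervalIntegral]
  have h2 := integral_exp_int_mul_I ((i : ℤ) - j) (-π)
  rw [show -π + 2 * π = π by ring] at h2
  push_cast at h2
  simp only [one_mul]
  push_cast
  rw [h2]
  by_cases hij : i = j
  · subst hij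
    rw [Matrix.diagonal_apply_eq, sub_self, if_pos rfl]
    have h3 : ∫ r in Ioi (0 : ℝ), (Ici x).indicator (fun _ => (1 : ℂ)) r *
        ((r : ℂ) ^ ((i : ℕ) + i + 1) * Complex.exp (-(N : ℂ) * (r : ℂ) ^ 2)) =
        ((∫ r in Ioi x, r ^ ((i : ℕ) + i + 1) * Real.exp (-(N : ℝ) * r ^ 2) : ℝ) : ℂ) := by
      rw [← integral_complex_ofReal, ← integral_Ici_eq_integral_Ioi,
        ← integral_Ici_eq_integral_Ioi]
      have h4 : ∀ r : ℝ, (Ici x).indicator (fun _ => (1 : ℂ)) r *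
        ((r : ℂ) ^ ((i : ℕ) + i + 1) * Complex.exp (-(N : ℂ) * (r : ℂ) ^ 2)) =
          (Ici x).indicator (fun r : ℝ =>
            ((r ^ ((i : ℕ) + i + 1) * Real.exp (-(N : ℝ) * r ^ 2) : ℝ) : ℂ)) r := by
        intro r
        by_cases hr : x ≤ r
        · simp [hr]
        · simp [hr]
      simp_rw [h4]
      rw [setIntegral_indicator measurableSet_Ici, Ici_inter_Ici, max_eq_right hx]
    rw [h3, integral_Ioi_pow_mul_exp_neg_mul_sq hN _ hx, ← Complex.ofReal_mul,
      Real.mul_self_sqrt (monomialNormSq_pos hN i).le, monomialNormSq]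
    have hN' : (N : ℂ) ≠ 0 := by exact_mod_cast hN.ne'
    have hf : ((i : ℕ).factorial : ℂ) ≠ 0 := by exact_mod_cast (i : ℕ).factorial_ne_zero
    have hπ : (π : ℂ) ≠ 0 := by exact_mod_cast Real.pi_ne_zero
    push_cast
    field_simp
  · have : ((i : ℤ) - j) ≠ 0 := by
      rw [sub_ne_zero]; exact_mod_cast fun h => hij (Fin.ext h)
    rw [if_neg this, Matrix.diagonal_apply_ne _ hij]; simp

theorem ginibreCov_radialStep {N : ℕ} (hN : 0 < N) {x y : ℝ} (hx : 0 ≤ x) (hxy : x ≤ y) :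
    ginibreCov N (radialStep x) (radialStep y) =
      ∑ k ∈ Finset.range N, poissonCdf (N * y ^ 2) k * (1 - poissonCdf (N * x ^ 2) k) := by
  have h := ginibreCov_eq hN (boundedMeasurable_radialStep x) (boundedMeasurable_radialStep y)
  have h1 : (fun z => radialStep x z * radialStep y z) = radialStep y := by
    ext z
    by_cases hz : y ≤ ‖z‖
    · simp [radialStep, hz, hxy.trans hz]
    · simp [radialStep, hz]
  rw [h1, ginibreCompression_radialStep hN hx, ginibreCompression_radialStep hN (hx.trans hxy),
    Matrix.diagonal_mul_diagonal, Matrix.trace_diagonal, Matrix.trace_diagonal,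
    ← Finset.sum_sub_distrib] at h
  rw [Finset.sum_range]
  have h2 : (ginibreCov N (radialStep x) (radialStep y) : ℂ) = ((∑ k : Fin N,
      poissonCdf (N * y ^ 2) k * (1 - poissonCdf (N * x ^ 2) k) : ℝ) : ℂ) := by
    rw [h]
    push_cast
    exact Finset.sum_congr rfl fun k _ => by ring
  exact_mod_cast h2

theorem indicator_norm_mem_Icc_ae_eq {a b : ℝ} (hab : a < b) :
    (Set.indicator {z : ℂ | ‖z‖ ∈ Set.Icc a b} fun _ => (1 : ℝ)) =ᵐ[volume]
      radialStep a - radialStep b := by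
  have h : ∀ᵐ z : ℂ, ‖z‖ ≠ b := by
    refine measure_mono_null (fun z hz => ?_) (Measure.addHaar_sphere volume (0 : ℂ) b)
    simpa using hz
  filter_upwards [h] with z hz
  by_cases h1 : a ≤ ‖z‖ <;> by_cases h2 : b ≤ ‖z‖
  · have h3 : ¬ ‖z‖ ≤ b := fun h4 => hz (le_antisymm h4 h2)
    simp [radialStep, h1, h2, h3]
  · simp [radialStep, h1, h2, (not_le.1 h2).le]
  · exact absurd (hab.le.trans h2) h1
  · simp [radialStep, h1, h2]

theorem measurableSet_norm_mem_Icc (a b : ℝ) : MeasurableSet {z : ℂ | ‖z‖ ∈ Set.Icc a b} :=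
  measurable_norm measurableSet_Icc

theorem ginibreCov_norm_mem_Icc (N : ℕ) {a b c d : ℝ} (h1 : a < b) (h2 : c < d) :
    ginibreCov N (Set.indicator {z : ℂ | ‖z‖ ∈ Set.Icc a b} fun _ => 1)
      (Set.indicator {z : ℂ | ‖z‖ ∈ Set.Icc c d} fun _ => 1) =
      ginibreCov N (radialStep a) (radialStep c) - ginibreCov N (radialStep a) (radialStep d) -
        ginibreCov N (radialStep b) (radialStep c) + ginibreCov N (radialStep b) (radialStep d) := by
  have hb := boundedMeasurable_radialStep
  rw [ginibreCov_congr (boundedMeasurable_indicator (measurableSet_norm_mem_Icc a b))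
    (boundedMeasurable_indicator (measurableSet_norm_mem_Icc c d)) ((hb a).sub (hb b))
    ((hb c).sub (hb d)) (indicator_norm_mem_Icc_ae_eq h1) (indicator_norm_mem_Icc_ae_eq h2),
    ginibreCov_sub_sub (hb _) (hb _) (hb _) (hb _)]

end Radial

/-! ### The sum of F(1 - F) through a random walk. -/

section PoissonSums

/-- Each term is (i+1)·C(M, i+1) - i·C(M, i), so the sum telescopes. -/
theorem sum_range_sub_two_mul_choose (M I : ℕ) (h : I ≤ M) :
    ∑ i ∈ Finset.range I, ((M : ℝ) - 2 * i) * M.choose i = I * M.choose I := by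
  induction I with
  | zero => simp
  | succ I ih =>
    rw [Finset.sum_range_succ, ih (by omega)]
    have h1 := Nat.choose_succ_right_eq M I
    have h2 : (M.choose (I + 1) : ℝ) * ((I : ℝ) + 1) = M.choose I * ((M : ℝ) - I) := by
      rw [← Nat.cast_sub (by omega)]; exact_mod_cast h1
    push_cast
    linear_combination -h2

theorem sum_antidiagonal_tsub_mul_choose (M : ℕ) :
    ∑ p ∈ Finset.HasAntidiagonal.antidiagonal M, ((p.2 - p.1 : ℕ) : ℝ) * M.choose p.1 =
      ((M + 1) / 2 : ℕ) * M.choose ((M + 1) / 2) := by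
  rw [Finset.Nat.sum_antidiagonal_eq_sum_range_succ_mk]
  rcases M.eq_zero_or_pos with rfl | hM
  · simp
  rw [← sum_range_sub_two_mul_choose M ((M + 1) / 2) (by omega)]
  have hsub : Finset.range ((M + 1) / 2) ⊆ Finset.range M.succ := by
    intro i hi; rw [Finset.mem_range] at hi ⊢; omega
  rw [← Finset.sum_subset hsub]
  · refine Finset.sum_congr rfl fun i hi => ?_
    rw [Finset.mem_range] at hi
    congr 1
    simp only
    rw [Nat.sub_sub, ← two_mul, Nat.cast_sub (by omega)]
    push_cast; ring
  · intro i hi hi'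
    rw [Finset.mem_range] at hi hi'
    have : M - i - i = 0 := by omega
    simp [this]

/-- The mean of the positive part of a simple random walk after `M` steps. -/
noncomputable def walkMean (M : ℕ) : ℝ := ((M + 1) / 2 : ℕ) / wallisRatio ((M + 1) / 2)

theorem mul_choose_half_eq (M : ℕ) :
    (((M + 1) / 2 : ℕ) : ℝ) * M.choose ((M + 1) / 2) = 2 ^ M * walkMean M := by
  rw [walkMean]
  rcases Nat.even_or_odd' M with ⟨c, rfl | rfl⟩
  · rw [show (2 * c + 1) / 2 = c by omega, wallisRatio, Nat.centralBinom]
    have : (0 : ℝ) < (2 * c).choose c := by exact_mod_cast c.centralBinom_pos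
    rw [pow_mul]
    norm_num
    field_simp
  · rw [show (2 * c + 1 + 1) / 2 = c + 1 by omega, wallisRatio]
    have h : ((c + 1).centralBinom : ℝ) = 2 * (2 * c + 1).choose (c + 1) := by
      have h1 : (c + 1).centralBinom = 2 * (2 * c + 1).choose (c + 1) := by
        have h2 := Nat.choose_symm_half c
        rw [Nat.centralBinom, show 2 * (c + 1) = (2 * c + 1) + 1 by ring, Nat.choose_succ_succ]
        simp only [Nat.succ_eq_add_one]
        omega
      exact_mod_cast h1
    have : (0 : ℝ) < (c + 1).centralBinom := by exact_mod_cast (c + 1).centralBinom_pos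
    have h4 : (4 : ℝ) ^ (c + 1) = 2 ^ (2 * c + 1) * 2 := by
      rw [← pow_succ, show 2 * c + 1 + 1 = 2 * (c + 1) by ring, pow_mul]; norm_num
    rw [h4]
    field_simp
    rw [h]
    ring

/-- For independent Poisson(T) variables the sum is Poisson(2T), and given the sum M the split is
binomial with parameter 1/2. The truncated natural-number subtraction is the positive part of Y - X.
-/
theorem sum_antidiagonal_tsub_mul_poissonWeight (T : ℝ) (M : ℕ) :
    ∑ p ∈ Finset.HasAntidiagonal.antidiagonal M,
      ((p.2 - p.1 : ℕ) : ℝ) * (poissonWeight T p.1 * poissonWeight T p.2) =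
      poissonWeight (2 * T) M * walkMean M := by
  have h : ∀ p ∈ Finset.HasAntidiagonal.antidiagonal M,
      ((p.2 - p.1 : ℕ) : ℝ) * (poissonWeight T p.1 * poissonWeight T p.2) =
      Real.exp (-(2 * T)) * T ^ M / M.factorial * (((p.2 - p.1 : ℕ) : ℝ) * M.choose p.1) := by
    intro p hp
    rw [Finset.HasAntidiagonal.mem_antidiagonal] at hp
    rw [Nat.cast_choose ℝ (by omega : p.1 ≤ M), show M - p.1 = p.2 by omega, poissonWeight,
      poissonWeight, ← hp, pow_add, show Real.exp (-(2 * T)) = Real.exp (-T) * Real.exp (-T) by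
        rw [← Real.exp_add]; congr 1; ring]
    have h1 : (p.1.factorial : ℝ) ≠ 0 := by positivity
    have h2 : (p.2.factorial : ℝ) ≠ 0 := by positivity
    have h3 : ((p.1 + p.2).factorial : ℝ) ≠ 0 := by positivity
    field_simp
  rw [Finset.sum_congr rfl h, ← Finset.mul_sum, sum_antidiagonal_tsub_mul_choose,
    mul_choose_half_eq, poissonWeight, mul_pow]
  ring

theorem hasSum_indicator_one_sub_poissonCdf (T : ℝ) (k : ℕ) :
    HasSum (fun j => if k < j then poissonWeight T j else 0) (1 - poissonCdf T k) := by
  rw [← hasSum_nat_add_iff' (k + 1)]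
  have h1 : ∑ i ∈ Finset.range (k + 1), (if k < i then poissonWeight T i else 0) = 0 :=
    Finset.sum_eq_zero fun i hi => by
      rw [Finset.mem_range] at hi; rw [if_neg (by omega)]
  rw [h1, sub_zero]
  refine (hasSum_one_sub_poissonCdf T k).congr_fun fun j => ?_
  rw [if_pos (by omega)]

theorem hasSum_indicator_poissonCdf (T : ℝ) (k : ℕ) :
    HasSum (fun i => if i ≤ k then poissonWeight T i else 0) (poissonCdf T k) := by
  have h : poissonCdf T k =
      ∑ i ∈ Finset.range (k + 1), (if i ≤ k then poissonWeight T i else 0) :=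
    Finset.sum_congr rfl fun i hi => by
      rw [Finset.mem_range] at hi; rw [if_pos (by omega)]
  rw [h]
  exact hasSum_sum_of_ne_finset_zero fun i hi => by
    rw [Finset.mem_range] at hi; rw [if_neg (by omega)]

/-- F(1 - F) at k is the probability that X ≤ k < Y. Summing over k counts Y - X such integers, so
the left side is E(Y - X)⁺, which is then grouped by X + Y. Working in `ENNReal` allows every
exchange of sums without prior summability. -/
theorem tsum_ofReal_poissonCdf_mul {T : ℝ} (hT : 0 ≤ T) :
    ∑' k, ENNReal.ofReal (poissonCdf T k * (1 - poissonCdf T k)) =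
      ∑' M, ENNReal.ofReal (poissonWeight (2 * T) M * walkMean M) := by
  have hp := poissonWeight_nonneg hT
  have hite : ∀ (P : Prop) [Decidable P] (j : ℕ), 0 ≤ if P then poissonWeight T j else 0 := by
    intro P _ j; split_ifs
    exacts [hp j, le_rfl]
  have h1 : ∀ k, ENNReal.ofReal (poissonCdf T k * (1 - poissonCdf T k)) =
      ∑' i, ∑' j, (if i ≤ k ∧ k < j then
        ENNReal.ofReal (poissonWeight T i * poissonWeight T j) else 0) := by
    intro k
    rw [ENNReal.ofReal_mul (poissonCdf_nonneg hT k),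
      ← (hasSum_indicator_one_sub_poissonCdf T k).tsum_eq,
      ← (hasSum_indicator_poissonCdf T k).tsum_eq,
      ENNReal.ofReal_tsum_of_nonneg (fun i => hite _ i) (hasSum_indicator_poissonCdf T k).summable,
      ENNReal.ofReal_tsum_of_nonneg (fun i => hite _ i)
        (hasSum_indicator_one_sub_poissonCdf T k).summable, ← ENNReal.tsum_mul_right]
    refine tsum_congr fun i => ?_
    rw [← ENNReal.tsum_mul_left]
    refine tsum_congr fun j => ?_
    by_cases h1 : i ≤ k <;> by_cases h2 : k < j <;> simp [h1, h2, ENNReal.ofReal_mul (hp i)]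
  simp_rw [h1]
  rw [ENNReal.tsum_comm]
  have h3 : ∀ i : ℕ, ∑' k, ∑' j, (if i ≤ k ∧ k < j then
      ENNReal.ofReal (poissonWeight T i * poissonWeight T j) else 0) =
      ∑' j, ∑' k, (if i ≤ k ∧ k < j then
        ENNReal.ofReal (poissonWeight T i * poissonWeight T j) else 0) :=
    fun i => ENNReal.tsum_comm
  simp_rw [h3]
  have h2 : ∀ i j : ℕ, ∑' k, (if i ≤ k ∧ k < j then
        ENNReal.ofReal (poissonWeight T i * poissonWeight T j) else 0) =
      ENNReal.ofReal (((j - i : ℕ) : ℝ) * (poissonWeight T i * poissonWeight T j)) := by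
    intro i j
    have hin : ∀ k ∈ Finset.Ico i j, (if i ≤ k ∧ k < j then
        ENNReal.ofReal (poissonWeight T i * poissonWeight T j) else 0) =
        ENNReal.ofReal (poissonWeight T i * poissonWeight T j) :=
      fun k hk => if_pos (Finset.mem_Ico.1 hk)
    rw [tsum_eq_sum (s := Finset.Ico i j) fun k hk => if_neg fun h => hk (Finset.mem_Ico.2 h),
      Finset.sum_congr rfl hin, Finset.sum_const, Nat.card_Ico, nsmul_eq_mul, ENNReal.ofReal_mul (Nat.cast_nonneg _),
      ENNReal.ofReal_natCast]
  simp_rw [h2]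
  rw [← ENNReal.tsum_prod (f := fun i j =>
    ENNReal.ofReal (((j - i : ℕ) : ℝ) * (poissonWeight T i * poissonWeight T j))),
    ← Finset.HasAntidiagonal.sigmaAntidiagonalEquivProd.tsum_eq, ENNReal.tsum_sigma']
  refine tsum_congr fun M => ?_
  rw [← sum_antidiagonal_tsub_mul_poissonWeight, tsum_fintype,
    ENNReal.ofReal_sum_of_nonneg fun p _ =>
      mul_nonneg (Nat.cast_nonneg _) (mul_nonneg (hp _) (hp _))]
  exact Finset.sum_coe_sort (Finset.HasAntidiagonal.antidiagonal M) fun p : ℕ × ℕ =>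
    ENNReal.ofReal (((p.2 - p.1 : ℕ) : ℝ) * (poissonWeight T p.1 * poissonWeight T p.2))

theorem walkMean_nonneg (M : ℕ) : 0 ≤ walkMean M :=
  div_nonneg (Nat.cast_nonneg _) (wallisRatio_pos _).le

theorem walkMean_sq_le (M : ℕ) : walkMean M ^ 2 ≤ (M + 1) / (2 * π) := by
  have h1 := le_wallisRatio_sq ((M + 1) / 2)
  have hw := wallisRatio_pos ((M + 1) / 2)
  have hπ := Real.pi_pos
  have h2 : 2 * (((M + 1) / 2 : ℕ) : ℝ) ≤ (M : ℝ) + 1 := by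
    exact_mod_cast (by omega : 2 * ((M + 1) / 2) ≤ M + 1)
  rw [walkMean, div_pow, div_le_div_iff₀ (by positivity) (by positivity)]
  have hI : (0 : ℝ) ≤ (((M + 1) / 2 : ℕ) : ℝ) := Nat.cast_nonneg _
  generalize (((M + 1) / 2 : ℕ) : ℝ) = I at *
  calc I ^ 2 * (2 * π) = 2 * I * (π * I) := by ring
    _ ≤ (M + 1) * (π * I) := by gcongr
    _ ≤ _ := by gcongr

theorem le_walkMean_sq (M : ℕ) : (M - 1) / (2 * π) ≤ walkMean M ^ 2 := by
  have h1 := wallisRatio_sq_le ((M + 1) / 2)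
  have hw := wallisRatio_pos ((M + 1) / 2)
  have hπ := Real.pi_pos
  rcases M.eq_zero_or_pos with rfl | hM
  · refine le_trans ?_ (sq_nonneg _)
    apply div_nonpos_of_nonpos_of_nonneg <;> simp [hπ.le]
  have h2 : (M : ℝ) ≤ 2 * (((M + 1) / 2 : ℕ) : ℝ) := by
    exact_mod_cast (by omega : M ≤ 2 * ((M + 1) / 2))
  have h3 : (1 : ℝ) ≤ M := by exact_mod_cast hM
  rw [walkMean, div_pow, div_le_div_iff₀ (by positivity) (by positivity)]
  generalize (((M + 1) / 2 : ℕ) : ℝ) = I at *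
  calc ((M : ℝ) - 1) * wallisRatio ((M + 1) / 2) ^ 2 ≤ (M - 1) * (π * (I + 1 / 2)) := by
        gcongr
    _ ≤ (2 * I - 1) * (π * (I + 1 / 2)) := by
        refine mul_le_mul_of_nonneg_right (by linarith) ?_
        have : 0 ≤ I := by linarith
        positivity
    _ = I ^ 2 * (2 * π) - π / 2 := by ring
    _ ≤ _ := by linarith

theorem abs_walkMean_sub_sqrt_le (M : ℕ) : |walkMean M - √(M / (2 * π))| ≤ 1 := by
  have h1 := walkMean_sq_le M
  have h2 := le_walkMean_sq M
  have h0 := walkMean_nonneg M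
  have hπ := Real.pi_gt_three
  set a := √((M : ℝ) / (2 * π)) with ha
  have ha0 : 0 ≤ a := Real.sqrt_nonneg _
  have ha2 : a ^ 2 = M / (2 * π) := Real.sq_sqrt (by positivity)
  have h3 : (1 : ℝ) / (2 * π) ≤ 1 := by
    rw [div_le_one (by positivity)]; linarith
  rw [add_div, ← ha2] at h1
  rw [sub_div, ← ha2] at h2
  rw [abs_le]
  constructor
  · rcases le_or_gt a 1 with h | h
    · linarith
    · have : a - 1 ≤ walkMean M := le_of_sq_le_sq (by nlinarith) h0
      linarith
  · have : walkMean M ≤ a + 1 := le_of_sq_le_sq (by nlinarith) (by linarith)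
    linarith

theorem hasSum_mul_poissonWeight (μ : ℝ) :
    HasSum (fun M : ℕ => (M : ℝ) * poissonWeight μ M) μ := by
  rw [← hasSum_nat_add_iff' 1]
  have h := (hasSum_poissonWeight μ).mul_left μ
  simp only [Finset.range_one, Finset.sum_singleton, Nat.cast_zero, zero_mul, sub_zero]
  rw [mul_one] at h
  refine h.congr_fun fun M => ?_
  rw [poissonWeight, poissonWeight, Nat.factorial_succ]
  have : (M.factorial : ℝ) ≠ 0 := by positivity
  push_cast
  field_simp
  ring

theorem hasSum_sq_mul_poissonWeight (μ : ℝ) :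
    HasSum (fun M : ℕ => (M : ℝ) ^ 2 * poissonWeight μ M) (μ ^ 2 + μ) := by
  rw [← hasSum_nat_add_iff' 1]
  have h := ((hasSum_mul_poissonWeight μ).add (hasSum_poissonWeight μ)).mul_left μ
  simp only [Finset.range_one, Finset.sum_singleton, Nat.cast_zero, zero_mul, sub_zero, ne_eq,
    OfNat.ofNat_ne_zero, not_false_eq_true, zero_pow]
  rw [mul_add, mul_one, ← sq] at h
  refine h.congr_fun fun M => ?_
  rw [poissonWeight, poissonWeight, Nat.factorial_succ]
  have : (M.factorial : ℝ) ≠ 0 := by positivity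
  push_cast
  field_simp
  ring

theorem tangent_sub_le_self {a m : ℝ} (ha : 0 ≤ a) (hm : 0 < m) :
    m + (a ^ 2 - m ^ 2) / (2 * m) - (a ^ 2 - m ^ 2) ^ 2 / (2 * m ^ 3) ≤ a := by
  have h : m + (a ^ 2 - m ^ 2) / (2 * m) - (a ^ 2 - m ^ 2) ^ 2 / (2 * m ^ 3) =
      a - (a - m) ^ 2 * (a * (a + 2 * m)) / (2 * m ^ 3) := by
    field_simp
    ring
  rw [h]
  have : 0 ≤ (a - m) ^ 2 * (a * (a + 2 * m)) / (2 * m ^ 3) := by positivity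
  linarith

theorem le_tangent {a m : ℝ} (hm : 0 < m) : a ≤ m + (a ^ 2 - m ^ 2) / (2 * m) := by
  have h : m + (a ^ 2 - m ^ 2) / (2 * m) = a + (a - m) ^ 2 / (2 * m) := by field_simp; ring
  rw [h]
  have : 0 ≤ (a - m) ^ 2 / (2 * m) := by positivity
  linarith

/-- The walk mean is within 1 of √(M/2π), and M/2π has mean m² = T/π. The square root is squeezed
between its tangent at m² and that tangent minus a quadratic term; averaging leaves m above and m
minus a variance term below. -/
theorem exists_hasSum_poissonWeight_mul_walkMean {T : ℝ} (hT : 0 < T) :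
    ∃ S : ℝ, HasSum (fun M => poissonWeight (2 * T) M * walkMean M) S ∧
      |S - √(T / π)| ≤ 1 + 1 / (4 * π * √(T / π)) := by
  have hπ := Real.pi_pos
  set m := √(T / π) with hm
  have hm0 : 0 < m := Real.sqrt_pos.2 (by positivity)
  have hm2 : m ^ 2 = 2 * T / (2 * π) := by rw [Real.sq_sqrt (by positivity)]; field_simp
  have hT2 : 2 * T = 2 * π * m ^ 2 := by rw [hm2]; field_simp
  have hp := poissonWeight_nonneg (by positivity : 0 ≤ 2 * T)
  have s0 := hasSum_poissonWeight (2 * T)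
  have s1 := hasSum_mul_poissonWeight (2 * T)
  have s2 := hasSum_sq_mul_poissonWeight (2 * T)
  have hup : HasSum (fun M : ℕ => poissonWeight (2 * T) M *
      (1 + (m + ((M : ℝ) / (2 * π) - m ^ 2) / (2 * m)))) (1 + m) := by
    have h := (s0.mul_left (1 + m - m ^ 2 / (2 * m))).add (s1.mul_left (1 / (2 * π * (2 * m))))
    have hval : (1 + m - m ^ 2 / (2 * m)) * 1 + 1 / (2 * π * (2 * m)) * (2 * T) = 1 + m := by
      rw [hT2]
      field_simp
      ring
    rw [hval] at h
    refine h.congr_fun fun M => ?_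
    generalize poissonWeight (2 * T) M = p
    field_simp
    ring
  have hlow : HasSum (fun M : ℕ => poissonWeight (2 * T) M *
      (-1 + (m + ((M : ℝ) / (2 * π) - m ^ 2) / (2 * m) -
        ((M : ℝ) / (2 * π) - m ^ 2) ^ 2 / (2 * m ^ 3)))) (-1 + m - 1 / (4 * π * m)) := by
    -- The average uses E M² = (2T)² + 2T; the variance of M/2π is m²/(2π), which divided by 2m³
    -- gives 1/(4πm).
    have h := ((s0.mul_left (-1 + m - m ^ 2 / (2 * m) - m ^ 4 / (2 * m ^ 3))).add
      (s1.mul_left (1 / (2 * π * (2 * m)) + 2 * m ^ 2 / (2 * π) / (2 * m ^ 3)))).add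
      (s2.mul_left (-(1 / ((2 * π) ^ 2 * (2 * m ^ 3)))))
    have hval : (-1 + m - m ^ 2 / (2 * m) - m ^ 4 / (2 * m ^ 3)) * 1 +
        (1 / (2 * π * (2 * m)) + 2 * m ^ 2 / (2 * π) / (2 * m ^ 3)) * (2 * T) +
        -(1 / ((2 * π) ^ 2 * (2 * m ^ 3))) * ((2 * T) ^ 2 + 2 * T) =
        -1 + m - 1 / (4 * π * m) := by
      rw [hT2]
      field_simp
      ring
    rw [hval] at h
    refine h.congr_fun fun M => ?_
    generalize poissonWeight (2 * T) M = p
    field_simp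
    ring
  have hcmp : ∀ M : ℕ, |walkMean M - √(M / (2 * π))| ≤ 1 ∧
      √((M : ℝ) / (2 * π)) ^ 2 = M / (2 * π) :=
    fun M => ⟨abs_walkMean_sub_sqrt_le M, Real.sq_sqrt (by positivity)⟩
  have hle : ∀ M : ℕ, poissonWeight (2 * T) M * walkMean M ≤ poissonWeight (2 * T) M *
      (1 + (m + ((M : ℝ) / (2 * π) - m ^ 2) / (2 * m))) := by
    intro M
    refine mul_le_mul_of_nonneg_left ?_ (hp M)
    obtain ⟨h1, h2⟩ := hcmp M
    have h3 := le_tangent (a := √((M : ℝ) / (2 * π))) hm0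
    rw [h2] at h3
    linarith [(abs_le.1 h1).2]
  have hge : ∀ M : ℕ, poissonWeight (2 * T) M *
      (-1 + (m + ((M : ℝ) / (2 * π) - m ^ 2) / (2 * m) -
        ((M : ℝ) / (2 * π) - m ^ 2) ^ 2 / (2 * m ^ 3))) ≤ poissonWeight (2 * T) M * walkMean M := by
    intro M
    refine mul_le_mul_of_nonneg_left ?_ (hp M)
    obtain ⟨h1, h2⟩ := hcmp M
    have h3 := tangent_sub_le_self (Real.sqrt_nonneg ((M : ℝ) / (2 * π))) hm0
    rw [h2] at h3
    linarith [(abs_le.1 h1).1]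
  have hs : Summable fun M => poissonWeight (2 * T) M * walkMean M :=
    Summable.of_nonneg_of_le (fun M => mul_nonneg (hp M) (walkMean_nonneg M)) hle hup.summable
  refine ⟨_, hs.hasSum, ?_⟩
  have h1 := hasSum_le hle hs.hasSum hup
  have h2 := hasSum_le hge hlow hs.hasSum
  have h3 : 0 < 1 / (4 * π * m) := by positivity
  rw [abs_le]
  constructor <;> linarith

theorem exists_hasSum_poissonCdf_mul {T : ℝ} (hT : 0 < T) :
    ∃ S : ℝ, HasSum (fun k => poissonCdf T k * (1 - poissonCdf T k)) S ∧
      |S - √(T / π)| ≤ 1 + 1 / (4 * π * √(T / π)) := by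
  obtain ⟨S, hS, hS'⟩ := exists_hasSum_poissonWeight_mul_walkMean hT
  refine ⟨S, ?_, hS'⟩
  have hnn : ∀ M, 0 ≤ poissonWeight (2 * T) M * walkMean M := fun M =>
    mul_nonneg (poissonWeight_nonneg (by positivity) M) (walkMean_nonneg M)
  have h := tsum_ofReal_poissonCdf_mul hT.le
  rw [← ENNReal.ofReal_tsum_of_nonneg hnn hS.summable, hS.tsum_eq] at h
  have hnn' : ∀ k, 0 ≤ poissonCdf T k * (1 - poissonCdf T k) := fun k =>
    mul_nonneg (poissonCdf_nonneg hT.le k) (one_sub_poissonCdf_nonneg hT.le k)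
  have hsum : Summable fun k => poissonCdf T k * (1 - poissonCdf T k) := by
    have h1 := ENNReal.summable_toReal (h.trans_ne ENNReal.ofReal_ne_top)
    refine h1.congr fun k => ENNReal.toReal_ofReal (hnn' k)
  rw [← ENNReal.ofReal_tsum_of_nonneg hnn' hsum] at h
  have h2 : ∑' k, poissonCdf T k * (1 - poissonCdf T k) = S :=
    (ENNReal.ofReal_eq_ofReal_iff (tsum_nonneg hnn') (hS.nonneg hnn)).1 h
  rw [← h2]
  exact hsum.hasSum

end PoissonSums

/-! ### Covariances of radial counts. -/

section RadialBounds

open Asymptotics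

/-- The full series is known to within O(1); the condition x < 1 makes the discarded tail k ≥ N at
most a geometric series in x². -/
theorem exists_abs_sum_poissonCdf_mul_sub_le {x : ℝ} (hx : 0 ≤ x) (hx1 : x < 1) :
    ∃ C : ℝ, ∀ N : ℕ, 0 < N →
      |∑ k ∈ Finset.range N, poissonCdf (N * x ^ 2) k * (1 - poissonCdf (N * x ^ 2) k) -
        x * √((N : ℝ) / π)| ≤ C := by
  have hπ := Real.pi_pos
  rcases hx.eq_or_lt with rfl | hx0
  · refine ⟨0, fun N _ => ?_⟩
    have h : ∀ k, poissonCdf 0 k = 1 := by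
      intro k
      rw [poissonCdf, Finset.sum_range_succ']
      simp [poissonWeight]
    simp [h]
  refine ⟨1 + 1 / (4 * π * (x * √(1 / π))) + 1 / (1 - x ^ 2), fun N hN => ?_⟩
  have hN1 : (1 : ℝ) ≤ N := by exact_mod_cast hN
  have hT : 0 < (N : ℝ) * x ^ 2 := by positivity
  obtain ⟨S, hS, hS'⟩ := exists_hasSum_poissonCdf_mul hT
  have e : √((N : ℝ) * x ^ 2 / π) = x * √((N : ℝ) / π) := by
    rw [show (N : ℝ) * x ^ 2 / π = x ^ 2 * (N / π) by ring, Real.sqrt_mul (by positivity),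
      Real.sqrt_sq hx]
  rw [e] at hS'
  have h1 : 1 / (4 * π * (x * √((N : ℝ) / π))) ≤ 1 / (4 * π * (x * √(1 / π))) := by
    gcongr
  have hx2 : x ^ 2 < 1 := by nlinarith
  have htail := (hasSum_nat_add_iff' N).2 hS
  -- Its N-th power absorbs the exponential prefactor of the Chernoff bound with r = x⁻².
  have hbase : Real.exp (1 - x ^ 2) * x ^ 2 ≤ 1 := by
    have h2 := Real.add_one_le_exp (-(1 - x ^ 2))
    calc Real.exp (1 - x ^ 2) * x ^ 2 ≤ Real.exp (1 - x ^ 2) * Real.exp (-(1 - x ^ 2)) := by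
          gcongr; linarith
      _ = 1 := by rw [← Real.exp_add]; simp
  have hbound : ∀ k, poissonCdf (N * x ^ 2) (k + N) * (1 - poissonCdf (N * x ^ 2) (k + N)) ≤
      (x ^ 2) ^ k := by
    intro k
    have h2 := one_sub_poissonCdf_nonneg hT.le (k + N)
    have h3 := one_sub_poissonCdf_le hT.le (r := (x ^ 2)⁻¹) ((one_le_inv₀ (by positivity)).2 hx2.le)
      (k + N)
    refine (mul_le_of_le_one_left h2 (by linarith)).trans (h3.trans ?_)
    rw [inv_inv, show (N : ℝ) * x ^ 2 * ((x ^ 2)⁻¹ - 1) = N * (1 - x ^ 2) by field_simp,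
      Real.exp_nat_mul, pow_add, mul_left_comm, ← mul_pow]
    exact mul_le_of_le_one_right (by positivity) (pow_le_one₀ (by positivity) hbase)
  have h4 := hasSum_le hbound htail (hasSum_geometric_of_lt_one (by positivity) hx2)
  have h5 := htail.nonneg fun k => mul_nonneg (poissonCdf_nonneg hT.le _)
    (one_sub_poissonCdf_nonneg hT.le _)
  rw [← one_div] at h4
  have h6 := abs_le.1 hS'
  rw [abs_le]
  constructor <;> linarith [h6.1, h6.2]

theorem exists_ginibreCov_radialStep_self_sub_le {x : ℝ} (hx : 0 ≤ x) (hx1 : x < 1) :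
    ∃ C : ℝ, ∀ N : ℕ, 0 < N →
      |ginibreCov N (radialStep x) (radialStep x) - x * √((N : ℝ) / π)| ≤ C := by
  obtain ⟨C, hC⟩ := exists_abs_sum_poissonCdf_mul_sub_le hx hx1
  exact ⟨C, fun N hN => by rw [ginibreCov_radialStep hN hx le_rfl]; exact hC N hN⟩

theorem exists_ginibreCov_radialStep_le_of_lt {x y : ℝ} (hx : 0 ≤ x) (hxy : x < y) :
    ∃ c C : ℝ, 0 < c ∧ 0 ≤ C ∧ ∀ N : ℕ, 0 < N →
      |ginibreCov N (radialStep x) (radialStep y)| ≤ C * Real.exp (-c * N) := by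
  have hy : 0 < y := hx.trans_lt hxy
  have hq : x ^ 2 / y ^ 2 < 1 := by
    rw [div_lt_one (by positivity)]; gcongr
  have hq0 : 0 ≤ x ^ 2 / y ^ 2 := by positivity
  -- The two tails are tilted by s and s⁻¹, so their k-dependent factors cancel. The remaining
  -- exponent -N(1 - s)(y² - x²/s) is negative exactly when x²/y² < s < 1; the midpoint is taken.
  obtain ⟨s, hs0, hs1, hs2⟩ : ∃ s : ℝ, 0 < s ∧ s < 1 ∧ x ^ 2 / s < y ^ 2 := by
    refine ⟨(1 + x ^ 2 / y ^ 2) / 2, by positivity, by linarith, ?_⟩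
    rw [div_lt_iff₀ (by positivity)]
    have : x ^ 2 = y ^ 2 * (x ^ 2 / y ^ 2) := by field_simp
    have hy2 : 0 < y ^ 2 := by positivity
    nlinarith
  set c := (1 - s) * (y ^ 2 - x ^ 2 / s) with hc
  have hc0 : 0 < c := mul_pos (by linarith) (by linarith)
  -- Half of the rate c is spent on absorbing the factor N from the number of summands.
  refine ⟨c / 2, 2 / c, by positivity, by positivity, fun N hN => ?_⟩
  have hTx : (0 : ℝ) ≤ N * x ^ 2 := by positivity
  have hTy : (0 : ℝ) ≤ N * y ^ 2 := by positivity
  rw [ginibreCov_radialStep hN hx hxy.le, abs_of_nonneg (Finset.sum_nonneg fun k _ =>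
    mul_nonneg (poissonCdf_nonneg hTy k) (one_sub_poissonCdf_nonneg hTx k))]
  have h1 : ∀ k ∈ Finset.range N,
      poissonCdf (N * y ^ 2) k * (1 - poissonCdf (N * x ^ 2) k) ≤ Real.exp (-(c * N)) := by
    intro k _
    have h2 := poissonCdf_le hTy hs0 hs1.le k
    have h3 := one_sub_poissonCdf_le hTx (r := s⁻¹) ((one_le_inv₀ hs0).2 hs1.le) k
    refine (mul_le_mul h2 h3 (one_sub_poissonCdf_nonneg hTx k) (by positivity)).trans (le_of_eq ?_)
    rw [mul_mul_mul_comm, ← mul_pow, inv_inv, inv_mul_cancel₀ hs0.ne', one_pow, mul_one,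
      ← Real.exp_add]
    congr 1
    rw [hc]
    field_simp
    ring
  refine (Finset.sum_le_sum h1).trans ?_
  rw [Finset.sum_const, Finset.card_range, nsmul_eq_mul]
  have h4 := Real.add_one_le_exp (c / 2 * N)
  have h5 : Real.exp (-(c * N)) = Real.exp (-(c / 2) * N) * Real.exp (-(c / 2) * N) := by
    rw [← Real.exp_add]; congr 1; ring
  have h6 : Real.exp (-(c / 2) * N) * Real.exp (c / 2 * N) = 1 := by
    rw [← Real.exp_add, ← Real.exp_zero]; congr 1; ring
  have h7 : (N : ℝ) ≤ 2 / c * Real.exp (c / 2 * N) := by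
    rw [div_mul_eq_mul_div, le_div_iff₀ hc0]; linarith
  calc (N : ℝ) * Real.exp (-(c * N)) ≤ 2 / c * Real.exp (c / 2 * N) * Real.exp (-(c * N)) := by
        gcongr
    _ = 2 / c * Real.exp (-(c / 2) * N) * (Real.exp (-(c / 2) * N) * Real.exp (c / 2 * N)) := by
        rw [h5]; ring
    _ = _ := by rw [h6, mul_one]

theorem exists_ginibreCov_radialStep_le_of_ne {x y : ℝ} (hx : 0 ≤ x) (hy : 0 ≤ y) (hxy : x ≠ y) :
    ∃ c C : ℝ, 0 < c ∧ 0 ≤ C ∧ ∀ N : ℕ, 0 < N →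
      |ginibreCov N (radialStep x) (radialStep y)| ≤ C * Real.exp (-c * N) := by
  rcases hxy.lt_or_gt with h | h
  · exact exists_ginibreCov_radialStep_le_of_lt hx h
  · simp_rw [ginibreCov_comm _ (radialStep x)]
    exact exists_ginibreCov_radialStep_le_of_lt hy h

theorem exists_ginibreCov_radialStep_le_const_of_ne {x y : ℝ} (hx : 0 ≤ x) (hy : 0 ≤ y)
    (hxy : x ≠ y) :
    ∃ C : ℝ, ∀ N : ℕ, 0 < N → |ginibreCov N (radialStep x) (radialStep y)| ≤ C := by
  obtain ⟨c, C, hc, hC, h⟩ := exists_ginibreCov_radialStep_le_of_ne hx hy hxy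
  refine ⟨C, fun N hN => (h N hN).trans (mul_le_of_le_one_right hC ?_)⟩
  rw [Real.exp_le_one_iff]
  have : (0 : ℝ) ≤ c * N := by positivity
  linarith

theorem radialCov_eq (N : ℕ) (a b c d : ℝ) : radialCov a b c d N =
    ginibreCov N (Set.indicator {z : ℂ | ‖z‖ ∈ Set.Icc a b} fun _ => 1)
      (Set.indicator {z : ℂ | ‖z‖ ∈ Set.Icc c d} fun _ => 1) / √((N : ℝ) / π) :=
  covariance_div_eq N _ _ (by positivity)

theorem radialCov_nonneg (N : ℕ) {a b c d : ℝ} (h : Icc a b ⊆ Icc c d) :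
    0 ≤ radialCov a b c d N := by
  rw [radialCov_eq]
  exact div_nonneg (ginibreCov_indicator_nonneg (measurableSet_norm_mem_Icc _ _)
    (measurableSet_norm_mem_Icc _ _) fun z hz => h hz) (Real.sqrt_nonneg _)

theorem radialCov_nonpos (N : ℕ) {a b c d : ℝ} (h : Disjoint (Icc a b) (Icc c d)) :
    radialCov a b c d N ≤ 0 := by
  rw [radialCov_eq]
  exact div_nonpos_of_nonpos_of_nonneg (ginibreCov_indicator_nonpos
    (measurableSet_norm_mem_Icc _ _) (measurableSet_norm_mem_Icc _ _)
    (Set.disjoint_left.2 fun z hz hz' => Set.disjoint_left.1 h hz hz')) (Real.sqrt_nonneg _)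

variable {a b c d : ℝ}

theorem radialCov_isBigO_exp (ha : 0 ≤ a) (hab : a < b) (hc : 0 ≤ c) (hcd : c < d) (hac : a ≠ c)
    (had : a ≠ d) (hbc : b ≠ c) (hbd : b ≠ d) :
    ∃ c₁ : ℝ, 0 < c₁ ∧
      (fun N : ℕ => radialCov a b c d N) =O[atTop] fun N : ℕ => Real.exp (-c₁ * N) := by
  have hb := ha.trans hab.le
  have hd := hc.trans hcd.le
  obtain ⟨c1, C1, hc1, hC1, h1⟩ := exists_ginibreCov_radialStep_le_of_ne ha hc hac
  obtain ⟨c2, C2, hc2, hC2, h2⟩ := exists_ginibreCov_radialStep_le_of_ne ha hd had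
  obtain ⟨c3, C3, hc3, hC3, h3⟩ := exists_ginibreCov_radialStep_le_of_ne hb hc hbc
  obtain ⟨c4, C4, hc4, hC4, h4⟩ := exists_ginibreCov_radialStep_le_of_ne hb hd hbd
  obtain ⟨e, he, he1, he2, he3, he4⟩ : ∃ e : ℝ, 0 < e ∧ e ≤ c1 ∧ e ≤ c2 ∧ e ≤ c3 ∧ e ≤ c4 :=
    ⟨min (min c1 c2) (min c3 c4), by positivity, by simp, by simp, by simp, by simp⟩
  refine ⟨e, he, IsBigO.of_bound ((C1 + C2 + C3 + C4) * √π) ?_⟩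
  filter_upwards [eventually_gt_atTop 0] with N hN
  have hN1 : (1 : ℝ) ≤ N := by exact_mod_cast hN
  have hπ := Real.pi_pos
  have hmono : ∀ c' : ℝ, e ≤ c' → Real.exp (-c' * N) ≤ Real.exp (-e * N) := by
    intro c' h'
    apply Real.exp_le_exp.2
    nlinarith
  rw [radialCov_eq, ginibreCov_norm_mem_Icc N hab hcd, Real.norm_eq_abs, abs_div,
    abs_of_nonneg (Real.sqrt_nonneg _), Real.norm_of_nonneg (Real.exp_pos _).le,
    Real.sqrt_div (Nat.cast_nonneg N), div_div_eq_mul_div, div_le_iff₀ (by positivity)]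
  have k1 := abs_le.1 ((h1 N hN).trans (mul_le_mul_of_nonneg_left (hmono _ he1) hC1))
  have k2 := abs_le.1 ((h2 N hN).trans (mul_le_mul_of_nonneg_left (hmono _ he2) hC2))
  have k3 := abs_le.1 ((h3 N hN).trans (mul_le_mul_of_nonneg_left (hmono _ he3) hC3))
  have k4 := abs_le.1 ((h4 N hN).trans (mul_le_mul_of_nonneg_left (hmono _ he4) hC4))
  have hsq : 1 ≤ √(N : ℝ) := Real.one_le_sqrt.2 hN1
  refine le_trans ?_ (le_mul_of_one_le_right (by positivity) hsq)
  rw [mul_right_comm]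
  refine mul_le_mul_of_nonneg_right ?_ (Real.sqrt_nonneg _)
  rw [abs_le]
  constructor <;> linarith [k1.1, k1.2, k2.1, k2.2, k3.1, k3.2, k4.1, k4.2]

theorem radialCov_sub_isBigO {κ : ℝ} (hab : a < b) (hcd : c < d)
    (h : ∃ C : ℝ, ∀ N : ℕ, 0 < N →
      |ginibreCov N (radialStep a) (radialStep c) - ginibreCov N (radialStep a) (radialStep d) -
        ginibreCov N (radialStep b) (radialStep c) + ginibreCov N (radialStep b) (radialStep d) -
        κ * √((N : ℝ) / π)| ≤ C) :
    (fun N : ℕ => radialCov a b c d N - κ) =O[atTop] fun N : ℕ => 1 / √(N : ℝ) := by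
  obtain ⟨C, hC⟩ := h
  simp only [radialCov_eq]
  refine isBigO_div_sqrt_sub (C := C) Real.pi_pos (r := fun _ => 1) fun N hN => ?_
  rw [ginibreCov_norm_mem_Icc N hab hcd, mul_one]
  exact hC N hN

theorem radialCov_sub_left_isBigO (ha : 0 ≤ a) (hab : a < b) (hb : b ≤ 1) (hcd : c < d)
    (hac : a = c) (hbd : b ≠ d) :
    (fun N : ℕ => radialCov a b c d N - a) =O[atTop] fun N : ℕ => 1 / √(N : ℝ) := by
  subst hac
  have hb0 := ha.trans hab.le
  have hd0 := ha.trans hcd.le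
  obtain ⟨C1, h1⟩ := exists_ginibreCov_radialStep_self_sub_le ha (hab.trans_le hb)
  -- Only the pair of equal endpoints contributes at order √N; the other three are merely needed to
  -- be bounded.
  obtain ⟨C2, h2⟩ := exists_ginibreCov_radialStep_le_const_of_ne ha hd0 hcd.ne
  obtain ⟨C3, h3⟩ := exists_ginibreCov_radialStep_le_const_of_ne hb0 ha hab.ne'
  obtain ⟨C4, h4⟩ := exists_ginibreCov_radialStep_le_const_of_ne hb0 hd0 hbd
  refine radialCov_sub_isBigO hab hcd ⟨C1 + C2 + C3 + C4, fun N hN => ?_⟩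
  have k1 := abs_le.1 (h1 N hN)
  have k2 := abs_le.1 (h2 N hN)
  have k3 := abs_le.1 (h3 N hN)
  have k4 := abs_le.1 (h4 N hN)
  rw [abs_le]
  constructor <;> linarith [k1.1, k1.2, k2.1, k2.2, k3.1, k3.2, k4.1, k4.2]

theorem radialCov_sub_right_isBigO (ha : 0 ≤ a) (hab : a < b) (hc : 0 ≤ c) (hcd : c < d)
    (hbd : b = d) (hac : a ≠ c) (hb : b < 1) :
    (fun N : ℕ => radialCov a b c d N - b) =O[atTop] fun N : ℕ => 1 / √(N : ℝ) := by
  subst hbd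
  have hb0 := ha.trans hab.le
  obtain ⟨C1, h1⟩ := exists_ginibreCov_radialStep_self_sub_le hb0 hb
  obtain ⟨C2, h2⟩ := exists_ginibreCov_radialStep_le_const_of_ne ha hc hac
  obtain ⟨C3, h3⟩ := exists_ginibreCov_radialStep_le_const_of_ne ha hb0 hab.ne
  obtain ⟨C4, h4⟩ := exists_ginibreCov_radialStep_le_const_of_ne hb0 hc hcd.ne'
  refine radialCov_sub_isBigO hab hcd ⟨C1 + C2 + C3 + C4, fun N hN => ?_⟩
  have k1 := abs_le.1 (h1 N hN)
  have k2 := abs_le.1 (h2 N hN)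
  have k3 := abs_le.1 (h3 N hN)
  have k4 := abs_le.1 (h4 N hN)
  rw [abs_le]
  constructor <;> linarith [k1.1, k1.2, k2.1, k2.2, k3.1, k3.2, k4.1, k4.2]

theorem radialCov_add_isBigO_of_right_eq_left (ha : 0 ≤ a) (hab : a < b) (hcd : c < d)
    (hd : d ≤ 1) (hbc : b = c) :
    (fun N : ℕ => radialCov a b c d N + b) =O[atTop] fun N : ℕ => 1 / √(N : ℝ) := by
  subst hbc
  have hb0 := ha.trans hab.le
  have hd0 := hb0.trans hcd.le
  obtain ⟨C1, h1⟩ := exists_ginibreCov_radialStep_self_sub_le hb0 (hcd.trans_le hd)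
  obtain ⟨C2, h2⟩ := exists_ginibreCov_radialStep_le_const_of_ne ha hb0 hab.ne
  obtain ⟨C3, h3⟩ := exists_ginibreCov_radialStep_le_const_of_ne ha hd0 (hab.trans hcd).ne
  obtain ⟨C4, h4⟩ := exists_ginibreCov_radialStep_le_const_of_ne hb0 hd0 hcd.ne
  have key := radialCov_sub_isBigO (κ := -b) hab hcd ⟨C1 + C2 + C3 + C4, fun N hN => ?_⟩
  · simpa only [sub_neg_eq_add] using key
  have k1 := abs_le.1 (h1 N hN)
  have k2 := abs_le.1 (h2 N hN)
  have k3 := abs_le.1 (h3 N hN)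
  have k4 := abs_le.1 (h4 N hN)
  rw [abs_le]
  constructor <;> linarith [k1.1, k1.2, k2.1, k2.2, k3.1, k3.2, k4.1, k4.2]

theorem radialCov_comm (a b c d : ℝ) (N : ℕ) : radialCov a b c d N = radialCov c d a b N :=
  ProbabilityTheory.covariance_comm _ _

end RadialBounds

/-! ### Assembly of the angular and radial cases. -/

theorem theorem7 :
    (∀ α β δ γ : ℝ, α < β → β < α + 2 * π → δ < γ → γ < δ + 2 * π →
      -- nested arcs without a common endpoint
      (circleArc α β ⊆ circleArc δ γ →
        (α : Real.Angle) ≠ (δ : Real.Angle) → (β : Real.Angle) ≠ (γ : Real.Angle) →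
          (∀ N : ℕ, 0 ≤ angularCov α β δ γ N) ∧
          (fun N : ℕ => angularCov α β δ γ N) =O[atTop] fun N : ℕ => 1 / √(N : ℝ)) ∧
      -- disjoint arcs
      (Disjoint (circleArc α β) (circleArc δ γ) →
          (∀ N : ℕ, angularCov α β δ γ N ≤ 0) ∧
          (fun N : ℕ => angularCov α β δ γ N) =O[atTop] fun N : ℕ => 1 / √(N : ℝ)) ∧
      -- exactly one common left or exactly one common right endpoint
      (((α : Real.Angle) = (δ : Real.Angle) ∧ (β : Real.Angle) ≠ (γ : Real.Angle)) ∨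
        ((β : Real.Angle) = (γ : Real.Angle) ∧ (α : Real.Angle) ≠ (δ : Real.Angle)) →
          (fun N : ℕ => angularCov α β δ γ N - 1 / 2)
            =O[atTop] fun N : ℕ => Real.log N / √(N : ℝ)) ∧
      -- exactly one endpoint at which one arc ends and the other one starts
      (((β : Real.Angle) = (δ : Real.Angle) ∧ (α : Real.Angle) ≠ (γ : Real.Angle)) ∨
        ((α : Real.Angle) = (γ : Real.Angle) ∧ (β : Real.Angle) ≠ (δ : Real.Angle)) →
          (fun N : ℕ => angularCov α β δ γ N + 1 / 2)
            =O[atTop] fun N : ℕ => Real.log N / √(N : ℝ))) ∧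
    (∀ a b c d : ℝ, 0 ≤ a → a < b → b ≤ 1 → 0 ≤ c → c < d → d ≤ 1 →
      -- nested intervals without a common endpoint
      (Set.Icc a b ⊆ Set.Icc c d → a ≠ c → b ≠ d →
          (∀ N : ℕ, 0 ≤ radialCov a b c d N) ∧
          ∃ c₁ : ℝ, 0 < c₁ ∧
            (fun N : ℕ => radialCov a b c d N) =O[atTop] fun N : ℕ => Real.exp (-c₁ * N)) ∧
      -- disjoint intervals
      (Disjoint (Set.Icc a b) (Set.Icc c d) →
          (∀ N : ℕ, radialCov a b c d N ≤ 0) ∧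
          ∃ c₁ : ℝ, 0 < c₁ ∧
            (fun N : ℕ => radialCov a b c d N) =O[atTop] fun N : ℕ => Real.exp (-c₁ * N)) ∧
      -- exactly one common left or exactly one common right endpoint
      (a = c → b ≠ d →
          (fun N : ℕ => radialCov a b c d N - a) =O[atTop] fun N : ℕ => 1 / √(N : ℝ)) ∧
      (b = d → a ≠ c → b < 1 →
          (fun N : ℕ => radialCov a b c d N - b) =O[atTop] fun N : ℕ => 1 / √(N : ℝ)) ∧
      -- adjacent intervals
      (b = c →
          (fun N : ℕ => radialCov a b c d N + b) =O[atTop] fun N : ℕ => 1 / √(N : ℝ)) ∧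
      (a = d →
          (fun N : ℕ => radialCov a b c d N + a) =O[atTop] fun N : ℕ => 1 / √(N : ℝ))) := by
  refine ⟨fun α β δ γ h1 h2 h3 h4 => ⟨fun hsub hαδ hβγ => ⟨fun N => angularCov_nonneg N hsub,
      angularCov_isBigO_of_ne h1 h2 h3 h4 hαδ hβγ (right_ne_left_of_circleArc_subset h1 h4 hsub)
        (left_ne_right_of_circleArc_subset h1 h4 hsub)⟩,
      fun hdisj => ⟨fun N => angularCov_nonpos N hdisj, ?_⟩,
      angularCov_sub_half_isBigO h1 h2 h3 h4, angularCov_add_half_isBigO h1 h2 h3 h4⟩,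
    fun a b c d ha hab hb hc hcd hd => ⟨fun hsub hac hbd => ⟨fun N => radialCov_nonneg N hsub, ?_⟩,
      fun hdisj => ⟨fun N => radialCov_nonpos N hdisj, ?_⟩,
      radialCov_sub_left_isBigO ha hab hb hcd, radialCov_sub_right_isBigO ha hab hc hcd,
      radialCov_add_isBigO_of_right_eq_left ha hab hcd hd, fun had => ?_⟩⟩
  -- Closed arcs contain their endpoints, so disjointness makes all four cross pairs of endpoints
  -- distinct.
  · have hne := Set.disjoint_iff_forall_ne.1 hdisj
    have hα := left_mem_circleArc h1
    have hβ := right_mem_circleArc h1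
    have hδ := left_mem_circleArc h3
    have hγ := right_mem_circleArc h3
    exact angularCov_isBigO_of_ne h1 h2 h3 h4 (hne hα hδ) (hne hβ hγ) (hne hβ hδ) (hne hα hγ)
  · obtain ⟨hca, hbd'⟩ := (Set.Icc_subset_Icc_iff hab.le).1 hsub
    exact radialCov_isBigO_exp ha hab hc hcd hac (hab.trans_le hbd').ne (hca.trans_lt hab).ne' hbd
  · have hne := Set.disjoint_iff_forall_ne.1 hdisj
    have ma := Set.left_mem_Icc.2 hab.le
    have mb := Set.right_mem_Icc.2 hab.le
    have mc := Set.left_mem_Icc.2 hcd.le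
    have md := Set.right_mem_Icc.2 hcd.le
    exact radialCov_isBigO_exp ha hab hc hcd (hne ma mc) (hne ma md) (hne mb mc) (hne mb md)
  -- Exchanging the two intervals reduces a = d to the adjacent case already treated.
  · subst had
    simp only [radialCov_comm a b c a]
    exact radialCov_add_isBigO_of_right_eq_left hc hcd hab hb rfl
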